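/- Let $\mathcal A=\{[{k\atop d}] : k\ge 1,\ d\ge 0\}$ and let $\mathbb Q\langle\mathcal A\rangle$ be the $\mathbb Q$-vector space spanned by the words $[{k_1,\dots,k_r\atop d_1,\dots,d_r}]$ in these letters, with the commutative stuffle product $\ast$ determined by $1\ast w=w\ast 1=w$ and $$aw\ast bv=a(w\ast bv)+b(aw\ast v)+(a\diamond b)(w\ast v),\qquad [{k_1\atop d_1}]\diamond[{k_2\atop d_2}]=[{k_1+k_2\atop d_1+d_2}].$$ Let $\mathfrak A=(\mathfrak A_r)_{r\ge0}$, $\mathfrak A_r=\sum [{k_1,\dots,k_r\atop d_1,\dots,d_r}]\prod_{i} X_i^{k_i-1}\frac{Y_i^{d_i}}{d_i!}$. A map $\rho$ on families $f=(f_r)_{r\ge 0}$, $f_r\in\mathbb Q\langle\mathcal A\rangle[[X_1,Y_1,\dots,X_r,Y_r]]$, induces a linear map on $\mathbb Q\langle\mathcal A\rangle$ sending $[{k_1,\dots,k_r\atop d_1,\dots,d_r}]$ to the coefficient of $\prod_i X_i^{k_i-1}Y_i^{d_i}/d_i!$ in $(\rho\,\mathfrak A)_r$. The swap $\sigma$ is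 induced by $$(\sigma f)_r({X_1,\dots,X_r\atop Y_1,\dots,Y_r})=f_r({Y_1+\dots+Y_r,\ \dots,\ Y_1+Y_2,\ Y_1\atop X_r,\ X_{r-1}-X_r,\ \dots,\ X_1-X_2}).$$ Let $\mathcal G^{f}=(\mathbb Q\langle\mathcal A\rangle,\ast)/\mathcal I$ be the algebra of formal multiple Eisenstein series, where $\mathcal I$ is the ideal generated by all $\sigma(w)-w$, and let $G^f(k)$ be the class of $[{k\atop 0}]$. Consider the maps $$Df_r=\sum_{j=1}^r\frac{\partial}{\partial X_j}\frac{\partial}{\partial Y_j}f_r,\qquad Wf_r=\sum_{j=1}^r\Bigl(\frac{\partial}{\partial X_j}X_j+Y_j\frac{\partial}{\partial Y_j}\Bigr)f_r,$$ $$\delta f_r=\sum_{j=1}^rX_jY_jf_r+\sum_{j=1}^r\Bigl(-(X_j-X_{j+1}+Y_j)\tfrac{\varphi_j^+}{2}-(X_{j-1}-X_j+Y_j)\tfrac{\varphi_j^-}{2}+\bigl(\tfrac{\varphi_j^+}{2}\bigr)^2-\bigl(\tfrac{\varphi_j^-}{2}\bigr)^2\Bigr)f_r,$$ where $X_{r+1}=Y_{r+1}=0$,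 and $\varphi_j^{+}f_r$ (for $1\le j\le r$), respectively $\varphi_j^-f_r$ (for $2\le j\le r$), is obtained from $f_{r-1}$ by substituting for its $X$-variables the tuple $(X_1,\dots,X_r)$ with $X_j$ removed, and for its $Y$-variables the tuple $(Y_1,\dots,Y_r)$ with the neighbours $Y_j,Y_{j+1}$, respectively $Y_{j-1},Y_j$, replaced by their sum (for $\varphi_r^+$: with $Y_r$ dropped); otherwise $\varphi_j^{\pm}f_r=0$. Then the linear maps on $\mathbb Q\langle\mathcal A\rangle$ induced by $D,W,\delta$ descend to derivations $D,W,\delta$ of $\mathcal G^f$ with $[W,D]=2D$, $[W,\delta]=-2\delta$, $[\delta,D]=W$. Let $\widetilde{\mathcal M}^f$ (the formal quasimodular forms) be the smallest subalgebra of $\mathcal G^f$ that contains $G^f(2)$ and is closed under $D,W,\delta$. The following hold. 1. (Ramanujan equations) $DG^f(2)=5G^f(4)-2G^f(2)^2$, $\ DG^f(4)=14G^f(6)-8G^f(2)G^f(4)$, $\ DG^f(6)=\frac{120}{7}G^f(4)^2-12G^f(2)G^f(6)$. 2. $G^f(k)\in\widetilde{\mathcal M}^f$ for every even $k\ge2$.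 3. $\widetilde{\mathcal M}^f=\mathbb Q[G^f(2),G^f(4),G^f(6)]=\mathbb Q[G^f(2),DG^f(2),D^2G^f(2)]$ (the subalgebras generated by these elements). 4. (Chazy equation) $D^3G^f(2)+24\,G^f(2)\,D^2G^f(2)-36\,(DG^f(2))^2=0$. -/

import Mathlib

noncomputable section

namespace FormalMES

/-! ### Words and the stuffle product -/

/-- The alphabet of bi-letters `[k; d]` with `k ≥ 1` and `d ≥ 0`. Addition is componentwise, so that
`[k₁; d₁] + [k₂; d₂] = [k₁ + k₂; d₁ + d₂]`. -/
abbrev Letter : Type := ℕ+ × ℕ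

/-- The rational vector space `ℚ⟨A⟩` with basis the words in the bi-letters. As a ring it carries the
stuffle product (see the instance `CommRing QA` below). -/
def QA : Type := List Letter →₀ ℚ

namespace QA

instance : AddCommGroup QA := inferInstanceAs (AddCommGroup (List Letter →₀ ℚ))

instance : Module ℚ QA := inferInstanceAs (Module ℚ (List Letter →₀ ℚ))

/-- A word, as an element of `ℚ⟨A⟩`. -/
def word (w : List Letter) : QA := Finsupp.single w (1 : ℚ)

/-- The `ℚ`-linear map out of `ℚ⟨A⟩` with prescribed values on words. -/
def lift {M : Type*} [AddCommGroup M] [Module ℚ M] (f : List Letter → M) : QA →ₗ[ℚ] M :=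
  Finsupp.linearCombination ℚ f

@[simp] theorem lift_word {M : Type*} [AddCommGroup M] [Module ℚ M] (f : List Letter → M)
    (w : List Letter) : lift f (word w) = f w := by
  exact (Finsupp.linearCombination_single ℚ (1 : ℚ) w).trans (one_smul ℚ (f w))

theorem hom_ext {M : Type*} [AddCommGroup M] [Module ℚ M] {f g : QA →ₗ[ℚ] M}
    (h : ∀ w, f (word w) = g (word w)) : f = g :=
  Finsupp.lhom_ext' fun w => LinearMap.ext_ring (h w)

/-- Prepend a letter to every word: left concatenation by the letter. -/
def cons (a : Letter) : QA →ₗ[ℚ] QA := lift fun w => word (a :: w)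

@[simp] theorem cons_word (a : Letter) (w : List Letter) : cons a (word w) = word (a :: w) := by
  simp [cons]

/-- The stuffle product of two words. -/
def stuffleWord : List Letter → List Letter → QA
  | [], v => word v
  | a :: u, [] => word (a :: u)
  | a :: u, b :: v =>
      cons a (stuffleWord u (b :: v)) + cons b (stuffleWord (a :: u) v)
        + cons (a + b) (stuffleWord u v)
  termination_by u v => u.length + v.length

/-- The stuffle product, extended bilinearly to `ℚ⟨A⟩`. -/
def stuffle : QA →ₗ[ℚ] QA →ₗ[ℚ] QA := lift fun u => lift fun v => stuffleWord u v

@[simp] theorem stuffle_word (u v : List Letter) :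
    stuffle (word u) (word v) = stuffleWord u v := by
  simp [stuffle]

theorem stuffle_nil_left (x : QA) : stuffle (word []) x = x := by
  have : stuffle (word []) = LinearMap.id := hom_ext fun w => by simp [stuffleWord]
  rw [this]; rfl

theorem stuffleWord_comm (u v : List Letter) : stuffleWord u v = stuffleWord v u := by
  induction u, v using stuffleWord.induct with
  | case1 v => cases v <;> simp [stuffleWord]
  | case2 a u => simp [stuffleWord]
  | case3 a u b v h₁ h₂ h₃ =>
    rw [stuffleWord, stuffleWord, h₁, h₂, h₃, add_comm b a]
    abel

theorem stuffle_comm (x y : QA) : stuffle x y = stuffle y x := by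
  have : stuffle = stuffle.flip := hom_ext fun u => hom_ext fun v => by
    simp [stuffleWord_comm u v]
  exact LinearMap.congr_fun₂ this x y

theorem stuffle_cons_cons (a b : Letter) (x y : QA) :
    stuffle (cons a x) (cons b y) =
      cons a (stuffle x (cons b y)) + cons b (stuffle (cons a x) y)
        + cons (a + b) (stuffle x y) := by
  have : (stuffle.compl₁₂ (cons a) (cons b) : QA →ₗ[ℚ] QA →ₗ[ℚ] QA) =
      (stuffle.compl₁₂ LinearMap.id (cons b)).compr₂ (cons a)
        + (stuffle.compl₁₂ (cons a) LinearMap.id).compr₂ (cons b)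
        + stuffle.compr₂ (cons (a + b)) := hom_ext fun u => hom_ext fun v => by
    simp [stuffleWord]
  simpa using LinearMap.congr_fun₂ this x y

theorem stuffle_assoc_word (u v w : List Letter) :
    stuffle (stuffle (word u) (word v)) (word w) =
      stuffle (word u) (stuffle (word v) (word w)) := by
  match u, v, w with
  | [], v, w => simp only [stuffle_nil_left]
  | u, [], w => simp only [stuffle_nil_left, stuffle_comm (word u) (word [])]
  | u, v, [] =>
    rw [stuffle_comm _ (word []), stuffle_comm _ (word []), stuffle_nil_left, stuffle_nil_left]
  | a :: u, b :: v, c :: w =>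
    have h₁ := stuffle_assoc_word u (b :: v) (c :: w)
    have h₂ := stuffle_assoc_word (a :: u) v (c :: w)
    have h₃ := stuffle_assoc_word (a :: u) (b :: v) w
    have h₄ := stuffle_assoc_word u v (c :: w)
    have h₅ := stuffle_assoc_word u (b :: v) w
    have h₆ := stuffle_assoc_word (a :: u) v w
    have h₇ := stuffle_assoc_word u v w
    simp only [← cons_word] at h₁ h₂ h₃ h₄ h₅ h₆ ⊢
    have e₁ := stuffle_cons_cons a b (word u) (word v)
    have e₂ := stuffle_cons_cons b c (word v) (word w)
    rw [e₁, e₂]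
    rw [e₁] at h₃
    rw [e₂] at h₁
    simp only [map_add, LinearMap.add_apply, stuffle_cons_cons] at h₁ h₃ ⊢
    simp only [h₂, h₄, h₅, h₆, h₇, h₁, ← h₃, map_add, add_assoc]
    abel
  termination_by u.length + v.length + w.length

theorem stuffle_assoc (x y z : QA) :
    stuffle (stuffle x y) z = stuffle x (stuffle y z) := by
  have h₁ (x : QA) (v w : List Letter) :
      stuffle (stuffle x (word v)) (word w) = stuffle x (stuffle (word v) (word w)) := by
    have : stuffle.flip (word w) ∘ₗ stuffle.flip (word v) =
        stuffle.flip (stuffle (word v) (word w)) :=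
      hom_ext fun u => by simpa using stuffle_assoc_word u v w
    exact LinearMap.congr_fun this x
  have h₂ (x y : QA) (w : List Letter) :
      stuffle (stuffle x y) (word w) = stuffle x (stuffle y (word w)) := by
    have : stuffle.flip (word w) ∘ₗ stuffle x = stuffle x ∘ₗ stuffle.flip (word w) :=
      hom_ext fun v => h₁ x v w
    exact LinearMap.congr_fun this y
  have : stuffle (stuffle x y) = stuffle x ∘ₗ stuffle y := hom_ext fun w => h₂ x y w
  exact LinearMap.congr_fun this z

instance : CommRing QA where
  __ := (inferInstance : AddCommGroup QA)
  mul x y := stuffle x y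
  one := word []
  mul_assoc := stuffle_assoc
  mul_comm := stuffle_comm
  one_mul := stuffle_nil_left
  mul_one x := (stuffle_comm x (word [])).trans (stuffle_nil_left x)
  left_distrib x y z := map_add (stuffle x) y z
  right_distrib x y z := LinearMap.map_add₂ stuffle x y z
  zero_mul x := LinearMap.map_zero₂ stuffle x
  mul_zero x := map_zero (stuffle x)

instance : Algebra ℚ QA :=
  Algebra.ofModule (fun r x y => LinearMap.map_smul₂ stuffle r x y)
    (fun r x y => map_smul (stuffle x) r y)

theorem one_def : (1 : QA) = word [] := rfl

theorem mul_def (x y : QA) : x * y = stuffle x y := rfl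

end QA

/-! ### Bimoulds and the maps they induce on words -/

open QA MvPowerSeries

/-- The power series ring in `X₁, Y₁, …, X_r, Y_r` with coefficients in `ℚ⟨A⟩`. The variables
`X_i` and `Y_i` (`1 ≤ i ≤ r`) are indexed by `Sum.inl (i - 1)` and `Sum.inr (i - 1)`. -/
abbrev Series (r : ℕ) : Type := MvPowerSeries (Fin r ⊕ Fin r) QA

/-- Families `(f_r)` with `f_r ∈ ℚ⟨A⟩⟦X₁, Y₁, …, X_r, Y_r⟧` for every `r ≥ 0`. -/
abbrev Bimould : Type := ∀ r : ℕ, Series r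

/-- The variable `X_i`, with the convention `X_i = 0` unless `1 ≤ i ≤ r`. -/
def X (r i : ℕ) : Series r :=
  if h : 1 ≤ i ∧ i ≤ r then MvPowerSeries.X (Sum.inl ⟨i - 1, by omega⟩) else 0

/-- The variable `Y_i`, with the convention `Y_i = 0` unless `1 ≤ i ≤ r`. -/
def Y (r i : ℕ) : Series r :=
  if h : 1 ≤ i ∧ i ≤ r then MvPowerSeries.X (Sum.inr ⟨i - 1, by omega⟩) else 0

/-- `f(x 1, …, x s; y 1, …, y s)`: substitute `x i` for `X_i` and `y i` for `Y_i`. -/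
def eval {r s : ℕ} (f : Series s) (x y : ℕ → Series r) : Series r :=
  MvPowerSeries.subst (Sum.elim (fun i : Fin s => x (i + 1)) (fun i : Fin s => y (i + 1))) f

/-- The generating series `𝔄_r = ∑ [k₁,…,k_r; d₁,…,d_r] ∏ X_i ^ (k_i - 1) Y_i ^ d_i / d_i!`. -/
def genSeries : Bimould := fun r e =>
  (∏ i : Fin r, ((e (Sum.inr i)).factorial : ℚ))⁻¹ •
    word (List.ofFn fun i : Fin r => ((e (Sum.inl i)).succPNat, e (Sum.inr i)))

/-- The exponents of the monomial `∏ X_i ^ (k_i - 1) Y_i ^ d_i` attached to a word. -/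
def exponents (w : List Letter) : Fin w.length ⊕ Fin w.length →₀ ℕ :=
  Finsupp.equivFunOnFinite.symm
    (Sum.elim (fun i => (w.get i).1.natPred) (fun i => (w.get i).2))

/-- The linear map on `ℚ⟨A⟩` induced by a map `ρ` on bimoulds: `[k₁,…,k_r; d₁,…,d_r]` is sent to the
coefficient of `∏ X_i ^ (k_i - 1) Y_i ^ d_i / d_i!` in the `r`-th component of `ρ 𝔄`. -/
def induced (ρ : Bimould → Bimould) : QA →ₗ[ℚ] QA :=
  QA.lift fun w => (∏ i : Fin w.length, ((w.get i).2.factorial : ℚ)) •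
    MvPowerSeries.coeff (exponents w) (ρ genSeries w.length)

/-! ### The swap -/

/-- `(σ f)_r(X; Y) = f_r(Y₁ + ⋯ + Y_r, …, Y₁ + Y₂, Y₁; X_r, X_{r-1} - X_r, …, X₁ - X₂)`. -/
def swapB (f : Bimould) : Bimould := fun r =>
  eval (f r) (fun i => ∑ m ∈ Finset.Icc 1 (r + 1 - i), Y r m)
    (fun i => X r (r + 1 - i) - X r (r + 2 - i))

/-- The swap on `ℚ⟨A⟩`. -/
def swap : QA →ₗ[ℚ] QA := induced swapB

/-! ### The maps `D`, `W` and `δ` -/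

/-- `D f_r = ∑_j ∂/∂X_j ∂/∂Y_j f_r`. -/
def dB (f : Bimould) : Bimould := fun r =>
  ∑ j : Fin r, pderiv QA (Sum.inl j) (pderiv QA (Sum.inr j) (f r))

/-- `W f_r = ∑_j (∂/∂X_j X_j + Y_j ∂/∂Y_j) f_r`. -/
def wB (f : Bimould) : Bimould := fun r =>
  ∑ j : Fin r, (pderiv QA (Sum.inl j) (MvPowerSeries.X (Sum.inl j) * f r)
    + MvPowerSeries.X (Sum.inr j) * pderiv QA (Sum.inr j) (f r))

/-- The tuple `(x 1, x 2, …)` with its `j`-th entry removed. -/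
def remove {M : Type*} (j : ℕ) (x : ℕ → M) : ℕ → M := fun i => if i < j then x i else x (i + 1)

/-- The tuple `(y 1, …, y (j-1), y j + y (j+1), y (j+2), …)`. -/
def contract {M : Type*} [Add M] (j : ℕ) (y : ℕ → M) : ℕ → M := fun i =>
  if i < j then y i else if i = j then y j + y (j + 1) else y (i + 1)

/-- `(φ_j⁺ f)_r(X; Y) = f_{r-1}(p_j X; c_{j,j+1} Y)` for `1 ≤ j ≤ r`, and `0` otherwise. -/
def phiPlus (j : ℕ) (f : Bimould) : Bimould := fun r =>
  if 1 ≤ j ∧ j ≤ r then eval (f (r - 1)) (remove j (X r)) (contract j (Y r)) else 0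

/-- `(φ_j⁻ f)_r(X; Y) = f_{r-1}(p_j X; c_{j-1,j} Y)` for `2 ≤ j ≤ r`, and `0` otherwise. -/
def phiMinus (j : ℕ) (f : Bimould) : Bimould := fun r =>
  if 2 ≤ j ∧ j ≤ r then eval (f (r - 1)) (remove j (X r)) (contract (j - 1) (Y r)) else 0

/-- `δ f_r = (∑_j X_j Y_j) f_r + ∑_j (-(X_j - X_{j+1} + Y_j) φ_j⁺/2 - (X_{j-1} - X_j + Y_j) φ_j⁻/2
+ (φ_j⁺/2)² - (φ_j⁻/2)²) f_r`; the second sum is over `j ≥ 1`, and its terms vanish for `j > r`. -/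
def deltaB (f : Bimould) : Bimould := fun r =>
  (∑ j ∈ Finset.Icc 1 r, X r j * Y r j) * f r
    + ∑ j ∈ Finset.Icc 1 r,
      (-((X r j - X r (j + 1) + Y r j) * (2⁻¹ : ℚ) • phiPlus j f r)
        - (X r (j - 1) - X r j + Y r j) * (2⁻¹ : ℚ) • phiMinus j f r
        + (4⁻¹ : ℚ) • phiPlus j (phiPlus j f) r
        - (4⁻¹ : ℚ) • phiMinus j (phiMinus j f) r)

/-! ### Formal multiple Eisenstein series -/

/-- The ideal of `(ℚ⟨A⟩, ∗)` generated by all `σ(w) - w`. -/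
def swapIdeal : Ideal QA := Ideal.span (Set.range fun w : QA => swap w - w)

/-- The algebra of formal multiple Eisenstein series. -/
abbrev FMES : Type := QA ⧸ swapIdeal

/-- The class in `FMES` of an element of `ℚ⟨A⟩`. -/
abbrev toFMES : QA →ₐ[ℚ] FMES := Ideal.Quotient.mkₐ ℚ swapIdeal

/-- The formal Eisenstein series `G(k)`, the class of the one-letter word `[k; 0]`. -/
def G (k : ℕ+) : FMES := toFMES (word [(k, 0)])

/-- The derivation `E` of `FMES` is the one induced by the map `ρ` on bimoulds. -/
def IsInducedBy (E : Derivation ℚ FMES FMES) (ρ : Bimould → Bimould) : Prop :=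
  ∀ x : QA, E (toFMES x) = toFMES (induced ρ x)

/-- Three derivations `D`, `W`, `δ` form an `𝔰𝔩₂`-triple (brackets are commutators). -/
def IsSl2Triple {A : Type*} [CommRing A] [Algebra ℚ A] (D W δ : Derivation ℚ A A) : Prop :=
  ⁅W, D⁆ = (2 : ℚ) • D ∧ ⁅W, δ⁆ = (-2 : ℚ) • δ ∧ ⁅δ, D⁆ = W

/-- A subalgebra is an `𝔰𝔩₂`-subalgebra if it is closed under the three derivations. -/
def IsSl2Subalgebra {A : Type*} [CommRing A] [Algebra ℚ A] (D W δ : Derivation ℚ A A)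
    (S : Subalgebra ℚ A) : Prop :=
  ∀ x ∈ S, D x ∈ S ∧ W x ∈ S ∧ δ x ∈ S

/-- The algebra of formal quasimodular forms: the smallest `𝔰𝔩₂`-subalgebra containing `G(2)`. -/
def quasimodular (D W δ : Derivation ℚ FMES FMES) : Subalgebra ℚ FMES :=
  sInf {S | IsSl2Subalgebra D W δ S ∧ G 2 ∈ S}

end FormalMES

end

/-! The maps are defined on generating series, but their action on words becomes transparent after
dualizing. A polynomial in x_i, y_i acts on power series in X_i, Y_i as a differential operator
evaluated at 0. Hence `wordOf r` encodes words of depth r as polynomials in x_1, y_1, ..., x_r, y_r,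
and an operator on series becomes its transpose on polynomials: D is multiplication by the quadratic
form Σ x_i y_i (`d_wordOf`), W is the depth plus the Euler derivation (`w_wordOf`), the swap is a
linear change of variables (`swap_wordOf`), and δ is the Laplacian Σ ∂x_j ∂y_j plus corrections that
lower the depth (`delta_wordOf`).

In this model the structural claims are short computations. The swap preserves the quadratic form
and the Laplacian, by Abel summation, and permutes the corrections of δ, so D and δ commute with it.
The bracket [δ, D] = W is the commutator of a Laplacian with multiplication by its quadratic form,
since the corrections commute with D; the brackets with W count degree plus depth.

The derivation property is not visible on polynomials and is proved on words. Summing u θ(v) z over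
all factorizations w = u v z gives a derivation of the stuffle product once θ satisfies
`IsLocalDerivation` (`localOp_mul`), and cutting off suffixes by an infinitesimal character gives
another one (`truncOp_mul`). D is of the first kind, with windows v of one letter; δ is a sum of
both kinds, with windows of at most three letters (`d_word`, `delta_word`). W is a derivation
because it is their commutator. Commuting with the swap then makes all three descend to the
quotient.

For the Eisenstein series, the swap turns the stuffle product of [1; p] and [1; q] into a second,
shuffle-type product formula (`shuffle_relation`). Comparing the two formulas gives a recursion for
the series of even weight, with a derivative as extra term (`eisenstein_relation`), and G(8) = (6/7)
G(4)^2 (`eisenstein_eight`). These yield the Ramanujan equations; the equalities of subalgebras and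
the Chazy equation are algebraic consequences. -/

noncomputable section
namespace FormalMES
open QA

/-! ### Partial derivatives of substituted power series. -/

section ChainRule

open MvPowerSeries MvPowerSeries.WithPiTopology

theorem pderiv_subst_coe {σ τ R : Type*} [Fintype σ] [CommRing R] {a : σ → MvPowerSeries τ R}
    (j : τ) (p : MvPolynomial σ R) :
    pderiv R j (subst a (p : MvPowerSeries σ R)) =
      ∑ i, subst a (pderiv R i (p : MvPowerSeries σ R)) * pderiv R j (a i) := by
  have hc : ∀ q : MvPolynomial σ R, subst a (q : MvPowerSeries σ R) = MvPolynomial.aeval a q :=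
    fun q => subst_coe q
  simp only [pderiv_coe, hc]
  induction p using MvPolynomial.induction_on with
  | C c => simp [MvPolynomial.algHom_C, MvPowerSeries.algebraMap_apply]
  | add p q hp hq => simp only [map_add, hp, hq, add_mul, Finset.sum_add_distrib]
  | mul_X p i hp =>
    classical
    simp only [map_mul, Derivation.leibniz, hp, MvPolynomial.aeval_X, map_add, smul_eq_mul,
      add_mul, Finset.sum_add_distrib, MvPolynomial.pderiv_X, Finset.mul_sum]
    congr 1
    · rw [Finset.sum_eq_single i]
      · simp
      · intro k _ hk; simp [hk]
      · simp
    · refine Finset.sum_congr rfl fun k _ => by ring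

theorem continuous_pderiv {σ R : Type*} [CommRing R] [TopologicalSpace R] [DiscreteTopology R]
    (i : σ) : Continuous (pderiv R i : MvPowerSeries σ R → MvPowerSeries σ R) := by
  refine continuous_pi fun n => ?_
  have : (fun f : MvPowerSeries σ R => pderiv R i f n) =
      fun f => coeff (n + Finsupp.single i 1) f * ((n i : R) + 1) := by
    funext f; exact coeff_pderiv f n
  rw [this]
  exact (continuous_coeff R _).mul continuous_const

/-- Both sides are continuous in f for the product topology over discrete R, and they agree on the
dense set of polynomials, so the polynomial chain rule suffices. -/
theorem pderiv_subst {σ τ R : Type*} [Fintype σ] [CommRing R] {a : σ → MvPowerSeries τ R}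
    (ha : HasSubst a) (j : τ) (f : MvPowerSeries σ R) :
    pderiv R j (subst a f) = ∑ i, subst a (pderiv R i f) * pderiv R j (a i) := by
  let _ : UniformSpace R := ⊥
  have : DiscreteUniformity R := ⟨rfl⟩
  have h := denseRange_toMvPowerSeries (R := R) (σ := σ)
  refine congrFun (DenseRange.equalizer (g := fun f : MvPowerSeries σ R => pderiv R j (subst a f))
    (h := fun f => ∑ i, subst a (pderiv R i f) * pderiv R j (a i)) h ?_ ?_ ?_) f
  · exact (continuous_pderiv j).comp (continuous_subst ha)
  · exact continuous_finsetSum _ fun i _ =>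
      ((continuous_subst ha).comp (continuous_pderiv i)).mul continuous_const
  · funext p
    exact pderiv_subst_coe j p

theorem constantCoeff_subst_of_constantCoeff_zero {σ τ R : Type*} [Finite σ] [CommRing R]
    {a : σ → MvPowerSeries τ R} (ha : ∀ i, constantCoeff (a i) = 0) (f : MvPowerSeries σ R) :
    constantCoeff (subst a f) = constantCoeff f := by
  have hs : HasSubst a := hasSubst_of_constantCoeff_zero ha
  have h := constantCoeff_subst_eq_zero hs ha (f := f - C (constantCoeff f)) (by simp)
  rw [subst_sub hs, map_sub, sub_eq_zero] at h
  rw [h, ← coe_substAlgHom hs, ← Algebra.algebraMap_self_apply (constantCoeff f),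
    ← MvPowerSeries.algebraMap_apply, AlgHom.commutes]
  simp [MvPowerSeries.algebraMap_apply]

end ChainRule

/-! ### Duality between polynomials and power series. -/

section Pairing

variable {σ τ : Type*} [Fintype σ] [Fintype τ]

/-- The pairing of polynomials with power series for which `X ^ e` is sent to `e!` times the
coefficient of `X ^ e`: the polynomial acts as a differential operator, evaluated at `0`. -/
def pair (g : MvPowerSeries σ QA) : MvPolynomial σ ℚ →ₗ[ℚ] QA :=
  (MvPolynomial.basisMonomials σ ℚ).constr ℚ fun e =>
    (∏ i, ((e i).factorial : ℚ)) • MvPowerSeries.coeff e g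

theorem pair_monomial (g : MvPowerSeries σ QA) (e : σ →₀ ℕ) (c : ℚ) :
    pair g (MvPolynomial.monomial e c) =
      c • (∏ i, ((e i).factorial : ℚ)) • MvPowerSeries.coeff e g := by
  have h : MvPolynomial.monomial e c = c • MvPolynomial.basisMonomials σ ℚ e := by
    simp [MvPolynomial.smul_monomial]
  rw [h, map_smul, pair, Module.Basis.constr_basis]

theorem pair_add (f g : MvPowerSeries σ QA) (p : MvPolynomial σ ℚ) :
    pair (f + g) p = pair f p + pair g p := by
  induction p using MvPolynomial.induction_on' with
  | monomial e c => simp [pair_monomial, smul_add]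
  | add p q hp hq => rw [map_add, hp, hq, map_add, map_add]; abel

theorem pair_smul (r : ℚ) (g : MvPowerSeries σ QA) (p : MvPolynomial σ ℚ) :
    pair (r • g) p = r • pair g p := by
  induction p using MvPolynomial.induction_on' with
  | monomial e c =>
    have : MvPowerSeries.coeff e (r • g) = r • MvPowerSeries.coeff e g := rfl
    rw [pair_monomial, pair_monomial, this]
    simp only [smul_smul]; ring_nf
  | add p q hp hq => rw [map_add, hp, hq, map_add, smul_add]

/-- The pairing as a linear map in the power series. -/
def pairL (p : MvPolynomial σ ℚ) : MvPowerSeries σ QA →ₗ[ℚ] QA where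
  toFun g := pair g p
  map_add' f g := pair_add f g p
  map_smul' r g := pair_smul r g p

theorem pair_zero (p : MvPolynomial σ ℚ) : pair (0 : MvPowerSeries σ QA) p = 0 :=
  map_zero (pairL p)

theorem pair_neg (g : MvPowerSeries σ QA) (p : MvPolynomial σ ℚ) : pair (-g) p = -pair g p :=
  map_neg (pairL p) g

theorem pair_sub (f g : MvPowerSeries σ QA) (p : MvPolynomial σ ℚ) :
    pair (f - g) p = pair f p - pair g p :=
  map_sub (pairL p) f g

theorem pair_sum {ι : Type*} (s : Finset ι) (g : ι → MvPowerSeries σ QA) (p : MvPolynomial σ ℚ) :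
    pair (∑ i ∈ s, g i) p = ∑ i ∈ s, pair (g i) p :=
  map_sum (pairL p) g s

theorem pair_C (g : MvPowerSeries σ QA) (c : ℚ) :
    pair g (MvPolynomial.C c) = c • MvPowerSeries.constantCoeff g := by
  rw [MvPolynomial.C_apply, pair_monomial]; simp

/-- The factorials in the pairing are there for this adjunction: raising the exponent e_i by one
multiplies e! by e_i + 1, the factor produced by differentiating the series. -/
theorem pair_mul_X (g : MvPowerSeries σ QA) (p : MvPolynomial σ ℚ) (i : σ) :
    pair g (p * MvPolynomial.X i) = pair (MvPowerSeries.pderiv QA i g) p := by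
  classical
  induction p using MvPolynomial.induction_on' with
  | monomial e c =>
    rw [MvPolynomial.X, MvPolynomial.monomial_mul, pair_monomial, pair_monomial,
      MvPowerSeries.coeff_pderiv, mul_one]
    have h : (∏ j, ((((e + Finsupp.single i 1 : σ →₀ ℕ)) j).factorial : ℚ)) =
        (e i + 1) * ∏ j, ((e j).factorial : ℚ) := by
      rw [← Finset.mul_prod_erase Finset.univ _ (Finset.mem_univ i),
        ← Finset.mul_prod_erase Finset.univ (fun j => ((e j).factorial : ℚ)) (Finset.mem_univ i)]
      rw [Finset.prod_congr rfl (g := fun j => ((e j).factorial : ℚ))]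
      · simp [Nat.factorial_succ]; ring
      · intro j hj
        simp [(Finset.ne_of_mem_erase hj).symm]
    have h2 : (MvPowerSeries.coeff (e + Finsupp.single i 1) g * ((e i : QA) + 1)) =
        ((e i : ℚ) + 1) • MvPowerSeries.coeff (e + Finsupp.single i 1) g := by
      rw [Algebra.smul_def, mul_comm]; simp
    rw [h, h2]
    simp only [smul_smul]; ring_nf
  | add p q hp hq => rw [add_mul, map_add, hp, hq, map_add]

theorem pair_X_mul (g : MvPowerSeries σ QA) (p : MvPolynomial σ ℚ) (i : σ) :
    pair g (MvPolynomial.X i * p) = pair (MvPowerSeries.pderiv QA i g) p := by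
  rw [mul_comm, pair_mul_X]

/-- The other half of the duality follows from `pair_mul_X` by induction, because the commutator of
∂_i with multiplication by a variable is the same on polynomials and on series. -/
theorem pair_pderiv (g : MvPowerSeries σ QA) (p : MvPolynomial σ ℚ) (i : σ) :
    pair g (MvPolynomial.pderiv i p) = pair (MvPowerSeries.X i * g) p := by
  classical
  induction p using MvPolynomial.induction_on generalizing g with
  | C c => simp [pair_C]
  | add p q hp hq => rw [map_add, map_add, hp, hq, map_add]
  | mul_X p j hp =>
    rw [pair_mul_X, Derivation.leibniz, Derivation.leibniz, map_add, smul_eq_mul, smul_eq_mul,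
      mul_comm (MvPolynomial.X j), pair_mul_X, hp, smul_eq_mul, smul_eq_mul, pair_add, add_comm]
    congr 1
    by_cases h : i = j
    · subst h; simp [MvPowerSeries.pderiv_X_self]
    · rw [MvPolynomial.pderiv_X_of_ne (Ne.symm h), MvPowerSeries.pderiv_X_of_ne h]
      simp [pair_zero]

/-- A linear substitution in power series is dual to a linear substitution in polynomials. -/
theorem pair_subst (A : σ → τ → ℚ) {a : σ → MvPowerSeries τ QA}
    (ha : ∀ i, MvPowerSeries.constantCoeff (a i) = 0)
    (hA : ∀ i j, MvPowerSeries.pderiv QA j (a i) = algebraMap ℚ _ (A i j))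
    {α : MvPolynomial τ ℚ →ₐ[ℚ] MvPolynomial σ ℚ}
    (hα : ∀ j, α (MvPolynomial.X j) = ∑ i, A i j • MvPolynomial.X i)
    (f : MvPowerSeries σ QA) (p : MvPolynomial τ ℚ) :
    pair (MvPowerSeries.subst a f) p = pair f (α p) := by
  have hs : MvPowerSeries.HasSubst a := MvPowerSeries.hasSubst_of_constantCoeff_zero ha
  induction p using MvPolynomial.induction_on generalizing f with
  | C c =>
    have : α (MvPolynomial.C c) = MvPolynomial.C c := α.commutes c
    rw [this, pair_C, pair_C, constantCoeff_subst_of_constantCoeff_zero ha]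
  | add p q hp hq => rw [map_add, map_add, hp, hq, map_add]
  | mul_X p j hp =>
    rw [pair_mul_X, pderiv_subst hs, map_mul, hα, Finset.mul_sum, map_sum, pair_sum]
    refine Finset.sum_congr rfl fun i _ => ?_
    rw [hA, mul_comm, ← Algebra.smul_def, pair_smul, hp, mul_smul_comm, map_smul, pair_mul_X]

end Pairing

/-! ### Words of fixed depth as polynomials. -/

section Model

/-- Polynomials in the variables `x_i`, `y_i`, dual to the variables `X_i`, `Y_i` of bimoulds. -/
abbrev Poly : Type := MvPolynomial (ℕ ⊕ ℕ) ℚ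

/-- The variable `x_i`. -/
def px (i : ℕ) : Poly := MvPolynomial.X (Sum.inl i)

/-- The variable `y_i`. -/
def py (i : ℕ) : Poly := MvPolynomial.X (Sum.inr i)

/-- The algebra map with `x_i ↦ a i` and `y_i ↦ b i`. -/
def subs {B : Type*} [CommRing B] [Algebra ℚ B] (a b : ℕ → B) : Poly →ₐ[ℚ] B :=
  MvPolynomial.aeval (Sum.elim a b)

@[simp] theorem subs_px {B : Type*} [CommRing B] [Algebra ℚ B] (a b : ℕ → B) (i : ℕ) :
    subs a b (px i) = a i := by simp [subs, px]

@[simp] theorem subs_py {B : Type*} [CommRing B] [Algebra ℚ B] (a b : ℕ → B) (i : ℕ) :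
    subs a b (py i) = b i := by simp [subs, py]

theorem algHom_ext_xy {B : Type*} [CommRing B] [Algebra ℚ B] {α β : Poly →ₐ[ℚ] B}
    (hx : ∀ i, α (px i) = β (px i)) (hy : ∀ i, α (py i) = β (py i)) : α = β :=
  MvPolynomial.algHom_ext fun v => by
    cases v with
    | inl i => exact hx i
    | inr i => exact hy i

theorem derivation_comp_algHom {σ B : Type*} [CommRing B] [Algebra ℚ B]
    (α : MvPolynomial σ ℚ →ₐ[ℚ] B) (d : Derivation ℚ B B)
    (d' : Derivation ℚ (MvPolynomial σ ℚ) (MvPolynomial σ ℚ))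
    (h : ∀ v, d (α (MvPolynomial.X v)) = α (d' (MvPolynomial.X v))) (p : MvPolynomial σ ℚ) :
    d (α p) = α (d' p) := by
  induction p using MvPolynomial.induction_on with
  | C c =>
    have h1 : α (MvPolynomial.C c) = algebraMap ℚ B c := α.commutes c
    rw [h1, MvPolynomial.derivation_C]; simp
  | add p q hp hq => simp only [map_add, hp, hq]
  | mul_X p i hp =>
    rw [map_mul, Derivation.leibniz, Derivation.leibniz, hp, h]
    simp only [map_add, smul_eq_mul, map_mul]

theorem derivation_comp_algHom_xy {B : Type*} [CommRing B] [Algebra ℚ B]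
    (α : Poly →ₐ[ℚ] B) (d : Derivation ℚ B B) (d' : Derivation ℚ Poly Poly)
    (hx : ∀ i, d (α (px i)) = α (d' (px i))) (hy : ∀ i, d (α (py i)) = α (d' (py i))) (p : Poly) :
    d (α p) = α (d' p) :=
  derivation_comp_algHom α d d' (fun v => by
    cases v with
    | inl i => exact hx i
    | inr i => exact hy i) p

/-- Restriction to the variables `x_i`, `y_i` with `1 ≤ i ≤ r`; the others are set to `0`. -/
def res (r : ℕ) : Poly →ₐ[ℚ] MvPolynomial (Fin r ⊕ Fin r) ℚ :=
  subs (fun i => if h : 1 ≤ i ∧ i ≤ r then MvPolynomial.X (Sum.inl ⟨i - 1, by omega⟩) else 0)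
    (fun i => if h : 1 ≤ i ∧ i ≤ r then MvPolynomial.X (Sum.inr ⟨i - 1, by omega⟩) else 0)

theorem res_px_eq_zero {r i : ℕ} (h : ¬(1 ≤ i ∧ i ≤ r)) : res r (px i) = 0 := by
  simp [res, h]

theorem res_py_eq_zero {r i : ℕ} (h : ¬(1 ≤ i ∧ i ≤ r)) : res r (py i) = 0 := by
  simp [res, h]

theorem res_px_succ {r : ℕ} (j : Fin r) : res r (px (j + 1)) = MvPolynomial.X (Sum.inl j) := by
  have : 1 ≤ (j : ℕ) + 1 ∧ (j : ℕ) + 1 ≤ r := by omega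
  simp [res]

theorem res_py_succ {r : ℕ} (j : Fin r) : res r (py (j + 1)) = MvPolynomial.X (Sum.inr j) := by
  have : 1 ≤ (j : ℕ) + 1 ∧ (j : ℕ) + 1 ≤ r := by omega
  simp [res]

/-- The derivative with respect to `x_i`, or zero unless `1 ≤ i ≤ r`. -/
def dx (r i : ℕ) : Derivation ℚ Poly Poly :=
  if 1 ≤ i ∧ i ≤ r then MvPolynomial.pderiv (Sum.inl i) else 0

/-- The derivative with respect to `y_i`, or zero unless `1 ≤ i ≤ r`. -/
def dy (r i : ℕ) : Derivation ℚ Poly Poly :=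
  if 1 ≤ i ∧ i ≤ r then MvPolynomial.pderiv (Sum.inr i) else 0

theorem dx_px (r i k : ℕ) : dx r i (px k) = if 1 ≤ i ∧ i ≤ r ∧ k = i then 1 else 0 := by
  unfold dx px
  by_cases h : 1 ≤ i ∧ i ≤ r
  · by_cases hk : k = i
    · subst hk; simp [h]
    · rw [if_pos h, MvPolynomial.pderiv_X_of_ne (by simpa using hk), if_neg (by tauto)]
  · rw [if_neg h, if_neg (by tauto)]; rfl

theorem dx_py (r i k : ℕ) : dx r i (py k) = 0 := by
  unfold dx py
  split_ifs
  · exact MvPolynomial.pderiv_X_of_ne (by simp)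
  · rfl

theorem dy_py (r i k : ℕ) : dy r i (py k) = if 1 ≤ i ∧ i ≤ r ∧ k = i then 1 else 0 := by
  unfold dy py
  by_cases h : 1 ≤ i ∧ i ≤ r
  · by_cases hk : k = i
    · subst hk; simp [h]
    · rw [if_pos h, MvPolynomial.pderiv_X_of_ne (by simpa using hk), if_neg (by tauto)]
  · rw [if_neg h, if_neg (by tauto)]; rfl

theorem dy_px (r i k : ℕ) : dy r i (px k) = 0 := by
  unfold dy px
  split_ifs
  · exact MvPolynomial.pderiv_X_of_ne (by simp)
  · rfl

theorem pderiv_inl_res (r : ℕ) (j : Fin r) (p : Poly) :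
    MvPolynomial.pderiv (Sum.inl j) (res r p) = res r (dx r (j + 1) p) := by
  refine derivation_comp_algHom_xy (res r) _ _ (fun i => ?_) (fun i => ?_) p
  · rw [dx_px]
    by_cases h : 1 ≤ i ∧ i ≤ r
    · obtain ⟨i, rfl⟩ : ∃ k : Fin r, i = k + 1 := ⟨⟨i - 1, by omega⟩, by simp; omega⟩
      rw [res_px_succ, MvPolynomial.pderiv_X]
      by_cases hij : i = j
      · subst hij; simp
      · have : (i : ℕ) ≠ j := fun h => hij (Fin.ext h)
        simp [this, hij]
    · rw [res_px_eq_zero h, if_neg (by omega)]; simp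
  · rw [dx_py, map_zero]
    by_cases h : 1 ≤ i ∧ i ≤ r
    · obtain ⟨i, rfl⟩ : ∃ k : Fin r, i = k + 1 := ⟨⟨i - 1, by omega⟩, by simp; omega⟩
      rw [res_py_succ, MvPolynomial.pderiv_X_of_ne (by simp)]
    · rw [res_py_eq_zero h, map_zero]

theorem pderiv_inr_res (r : ℕ) (j : Fin r) (p : Poly) :
    MvPolynomial.pderiv (Sum.inr j) (res r p) = res r (dy r (j + 1) p) := by
  refine derivation_comp_algHom_xy (res r) _ _ (fun i => ?_) (fun i => ?_) p
  · rw [dy_px, map_zero]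
    by_cases h : 1 ≤ i ∧ i ≤ r
    · obtain ⟨i, rfl⟩ : ∃ k : Fin r, i = k + 1 := ⟨⟨i - 1, by omega⟩, by simp; omega⟩
      rw [res_px_succ, MvPolynomial.pderiv_X_of_ne (by simp)]
    · rw [res_px_eq_zero h, map_zero]
  · rw [dy_py]
    by_cases h : 1 ≤ i ∧ i ≤ r
    · obtain ⟨i, rfl⟩ : ∃ k : Fin r, i = k + 1 := ⟨⟨i - 1, by omega⟩, by simp; omega⟩
      rw [res_py_succ, MvPolynomial.pderiv_X]
      by_cases hij : i = j
      · subst hij; simp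
      · have : (i : ℕ) ≠ j := fun h => hij (Fin.ext h)
        simp [this, hij]
    · rw [res_py_eq_zero h, if_neg (by omega)]; simp

/-- The pairing of `Poly` with series in `X₁, Y₁, …, X_r, Y_r`. -/
def pairing {r : ℕ} (g : Series r) : Poly →ₗ[ℚ] QA := pair g ∘ₗ (res r).toLinearMap

theorem pairing_apply {r : ℕ} (g : Series r) (p : Poly) : pairing g p = pair g (res r p) := rfl

theorem pairing_add {r : ℕ} (f g : Series r) (p : Poly) :
    pairing (f + g) p = pairing f p + pairing g p := by
  simp only [pairing_apply, pair_add]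

theorem pairing_sub {r : ℕ} (f g : Series r) (p : Poly) :
    pairing (f - g) p = pairing f p - pairing g p := by
  simp only [pairing_apply, pair_sub]

theorem pairing_neg {r : ℕ} (f : Series r) (p : Poly) :
    pairing (-f) p = -pairing f p := by
  simp only [pairing_apply, pair_neg]

theorem pairing_smul {r : ℕ} (c : ℚ) (f : Series r) (p : Poly) :
    pairing (c • f) p = c • pairing f p := by
  simp only [pairing_apply, pair_smul]

theorem pairing_zero {r : ℕ} (p : Poly) : pairing (0 : Series r) p = 0 := by
  simp only [pairing_apply, pair_zero]

theorem pairing_sum {r : ℕ} {ι : Type*} (s : Finset ι) (f : ι → Series r) (p : Poly) :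
    pairing (∑ i ∈ s, f i) p = ∑ i ∈ s, pairing (f i) p := by
  simp only [pairing_apply, pair_sum]

theorem pairing_X_mul {r : ℕ} (i : ℕ) (g : Series r) (p : Poly) :
    pairing (X r i * g) p = pairing g (dx r i p) := by
  by_cases h : 1 ≤ i ∧ i ≤ r
  · obtain ⟨i, rfl⟩ : ∃ k : Fin r, i = k + 1 := ⟨⟨i - 1, by omega⟩, by simp; omega⟩
    rw [pairing_apply, pairing_apply, ← pderiv_inl_res, pair_pderiv]
    simp [X]
  · simp [X, dx, h, pairing_zero]

theorem pairing_Y_mul {r : ℕ} (i : ℕ) (g : Series r) (p : Poly) :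
    pairing (Y r i * g) p = pairing g (dy r i p) := by
  by_cases h : 1 ≤ i ∧ i ≤ r
  · obtain ⟨i, rfl⟩ : ∃ k : Fin r, i = k + 1 := ⟨⟨i - 1, by omega⟩, by simp; omega⟩
    rw [pairing_apply, pairing_apply, ← pderiv_inr_res, pair_pderiv]
    simp [Y]
  · simp [Y, dy, h, pairing_zero]

theorem sum_Icc_eq_sum_fin {M : Type*} [AddCommMonoid M] (r : ℕ) (f : ℕ → M) :
    ∑ i ∈ Finset.Icc 1 r, f i = ∑ j : Fin r, f (j + 1) := by
  induction r with
  | zero => simp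
  | succ r ih => rw [Finset.sum_Icc_succ_top (by omega), Fin.sum_univ_castSucc, ih]; simp

theorem constantCoeff_X (r i : ℕ) : MvPowerSeries.constantCoeff (X r i) = 0 := by
  unfold X; split_ifs <;> simp

theorem constantCoeff_Y (r i : ℕ) : MvPowerSeries.constantCoeff (Y r i) = 0 := by
  unfold Y; split_ifs <;> simp

theorem pderiv_inl_X (r i : ℕ) (j : Fin r) :
    MvPowerSeries.pderiv QA (Sum.inl j) (X r i) =
      algebraMap ℚ _ (if (j : ℕ) + 1 = i then (1 : ℚ) else 0) := by
  unfold X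
  split_ifs with h h' h'
  · have : (⟨i - 1, by omega⟩ : Fin r) = j := Fin.ext (by simp; omega)
    rw [this, MvPowerSeries.pderiv_X_self, map_one]
  · rw [MvPowerSeries.pderiv_X_of_ne, map_zero]
    simp only [ne_eq, Sum.inl.injEq, Fin.ext_iff]; omega
  · omega
  · simp

theorem pderiv_inr_X (r i : ℕ) (j : Fin r) :
    MvPowerSeries.pderiv QA (Sum.inr j) (X r i) = 0 := by
  unfold X
  split_ifs with h
  · exact MvPowerSeries.pderiv_X_of_ne (by simp)
  · simp

theorem pderiv_inr_Y (r i : ℕ) (j : Fin r) :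
    MvPowerSeries.pderiv QA (Sum.inr j) (Y r i) =
      algebraMap ℚ _ (if (j : ℕ) + 1 = i then (1 : ℚ) else 0) := by
  unfold Y
  split_ifs with h h' h'
  · have : (⟨i - 1, by omega⟩ : Fin r) = j := Fin.ext (by simp; omega)
    rw [this, MvPowerSeries.pderiv_X_self, map_one]
  · rw [MvPowerSeries.pderiv_X_of_ne, map_zero]
    simp only [ne_eq, Sum.inr.injEq, Fin.ext_iff]; omega
  · omega
  · simp

theorem pderiv_inl_Y (r i : ℕ) (j : Fin r) :
    MvPowerSeries.pderiv QA (Sum.inl j) (Y r i) = 0 := by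
  unfold Y
  split_ifs with h
  · exact MvPowerSeries.pderiv_X_of_ne (by simp)
  · simp

/-- A reduction of `pair_subst` to variables indexed by natural numbers. The conditions on α are
only imposed after `res s`, so α need not respect the boundary of the index range before
restriction. -/
theorem pairing_eval {r s : ℕ} (x y : ℕ → Series r) (A B : ℕ → Fin r ⊕ Fin r → ℚ)
    (hx : ∀ i, MvPowerSeries.constantCoeff (x i) = 0)
    (hy : ∀ i, MvPowerSeries.constantCoeff (y i) = 0)
    (hA : ∀ i j, MvPowerSeries.pderiv QA j (x i) = algebraMap ℚ _ (A i j))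
    (hB : ∀ i j, MvPowerSeries.pderiv QA j (y i) = algebraMap ℚ _ (B i j))
    {α : Poly →ₐ[ℚ] Poly}
    (hαx : ∀ j : Fin r, res s (α (px (j + 1))) =
      ∑ i ∈ Finset.Icc 1 s, (A i (Sum.inl j) • res s (px i) + B i (Sum.inl j) • res s (py i)))
    (hαy : ∀ j : Fin r, res s (α (py (j + 1))) =
      ∑ i ∈ Finset.Icc 1 s, (A i (Sum.inr j) • res s (px i) + B i (Sum.inr j) • res s (py i)))
    (hx0 : ∀ i, ¬(1 ≤ i ∧ i ≤ r) → res s (α (px i)) = 0)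
    (hy0 : ∀ i, ¬(1 ≤ i ∧ i ≤ r) → res s (α (py i)) = 0)
    (f : Series s) (p : Poly) :
    pairing (eval f x y) p = pairing f (α p) := by
  -- β is the map that α induces on the finitely many variables in range; `pair_subst` applies to β.
  let β : MvPolynomial (Fin r ⊕ Fin r) ℚ →ₐ[ℚ] MvPolynomial (Fin s ⊕ Fin s) ℚ :=
    MvPolynomial.aeval (Sum.elim (fun j => res s (α (px (j + 1)))) fun j => res s (α (py (j + 1))))
  have hβ : (res s).comp α = β.comp (res r) := by
    refine algHom_ext_xy (fun i => ?_) (fun i => ?_)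
    · by_cases h : 1 ≤ i ∧ i ≤ r
      · obtain ⟨i, rfl⟩ : ∃ k : Fin r, i = k + 1 := ⟨⟨i - 1, by omega⟩, by simp; omega⟩
        simp [β, res_px_succ]
      · simp [hx0 i h, res_px_eq_zero h]
    · by_cases h : 1 ≤ i ∧ i ≤ r
      · obtain ⟨i, rfl⟩ : ∃ k : Fin r, i = k + 1 := ⟨⟨i - 1, by omega⟩, by simp; omega⟩
        simp [β, res_py_succ]
      · simp [hy0 i h, res_py_eq_zero h]
  have hβ' : res s (α p) = β (res r p) := DFunLike.congr_fun hβ p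
  rw [pairing_apply, pairing_apply, hβ', eval]
  refine pair_subst (σ := Fin s ⊕ Fin s) (τ := Fin r ⊕ Fin r)
    (Sum.elim (fun i j => A (i + 1) j) (fun i j => B (i + 1) j)) ?_ ?_ ?_ f _
  · rintro (i | i)
    · exact hx _
    · exact hy _
  · rintro (i | i) j
    · exact hA _ _
    · exact hB _ _
  · have key (j : Fin r ⊕ Fin r) :
        ∑ i ∈ Finset.Icc 1 s, (A i j • res s (px i) + B i j • res s (py i)) =
          ∑ i, (Sum.elim (fun (i : Fin s) j => A (i + 1) j) (fun (i : Fin s) j => B (i + 1) j)) i j •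
            MvPolynomial.X i := by
      rw [sum_Icc_eq_sum_fin, Finset.sum_add_distrib, Fintype.sum_sum_type]
      simp [res_px_succ, res_py_succ]
    rintro (j | j)
    · rw [← key, ← hαx]; simp [β]
    · rw [← key, ← hαy]; simp [β]

theorem induced_word {r : ℕ} (ρ : Bimould → Bimould) (w : List Letter) (hw : w.length = r)
    (e : Fin r ⊕ Fin r →₀ ℕ)
    (he : ∀ i : Fin r, w.get (i.cast hw.symm) = ((e (Sum.inl i)).succPNat, e (Sum.inr i))) :
    induced ρ (word w) = (∏ i : Fin r, ((e (Sum.inr i)).factorial : ℚ)) •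
      MvPowerSeries.coeff e (ρ genSeries r) := by
  subst hw
  have h1 (i : Fin w.length) : w.get i = ((e (Sum.inl i)).succPNat, e (Sum.inr i)) := he i
  have h2 : exponents w = e := by
    ext (i | i)
    · simpa [exponents] using congrArg (fun a : Letter => a.1.natPred) (h1 i)
    · simpa [exponents] using congrArg (fun a : Letter => a.2) (h1 i)
  rw [induced, lift_word, h2]
  congr 1
  exact Finset.prod_congr rfl fun i _ => by rw [h1]

/-- The elements of `ℚ⟨A⟩` in depth `r`: the monomial `∏ x_i ^ (k_i - 1) / (k_i - 1)! * y_i ^ d_i`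
is sent to the word `[k₁,…,k_r; d₁,…,d_r]`. -/
def wordOf (r : ℕ) : Poly →ₗ[ℚ] QA := pairing (genSeries r)

/-- The factor d! in `induced` cancels the 1/d! in `genSeries`, so that on all polynomials, not only
on monomials, `induced ρ` is the pairing with the transformed series. This is the passage from
operators on series to operators on polynomials. -/
theorem induced_wordOf (ρ : Bimould → Bimould) (r : ℕ) (p : Poly) :
    induced ρ (wordOf r p) = pairing (ρ genSeries r) p := by
  rw [wordOf, pairing_apply, pairing_apply]
  generalize res r p = q
  induction q using MvPolynomial.induction_on' with
  | monomial e c =>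
    have h : MvPowerSeries.coeff e (genSeries r) = (∏ i : Fin r, ((e (Sum.inr i)).factorial : ℚ))⁻¹ •
      word (List.ofFn fun i : Fin r => ((e (Sum.inl i)).succPNat, e (Sum.inr i))) := rfl
    rw [pair_monomial, pair_monomial, h, map_smul, map_smul, map_smul,
      induced_word ρ _ (List.length_ofFn) e (fun i => by simp)]
    congr 2
    rw [smul_smul, inv_mul_cancel₀, one_smul]
    exact Finset.prod_ne_zero_iff.2 fun i _ => by positivity
  | add p q hp hq => rw [map_add, map_add, hp, hq, map_add]

theorem wordOf_congr {r : ℕ} {p q : Poly} (h : res r p = res r q) : wordOf r p = wordOf r q := by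
  rw [wordOf, pairing_apply, pairing_apply, h]

end Model

/-! ### The transposes of D, W, δ and the swap. -/

section Duals

/-- The dual of removing `X_j` and contracting `Y_c`, `Y_{c+1}`. -/
def phi (j c : ℕ) : Poly →ₐ[ℚ] Poly :=
  subs (fun i => if i < j then px i else if i = j then 0 else px (i - 1))
    (fun i => if i ≤ c then py i else py (i - 1))

theorem phi_px (j c i : ℕ) :
    phi j c (px i) = if i < j then px i else if i = j then 0 else px (i - 1) := by simp [phi]

theorem phi_py (j c i : ℕ) : phi j c (py i) = if i ≤ c then py i else py (i - 1) := by simp [phi]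

/-- Transposition sends each variable to the sum of the slots in which it is used: X_j is used
nowhere, so x_j goes to 0, while Y_c and Y_{c+1} share slot c, so y_c and y_{c+1} are identified. -/
theorem pairing_phi {r j c : ℕ} (hj : 1 ≤ j ∧ j ≤ r) (hc : 1 ≤ c ∧ c ≤ r) (f : Series (r - 1))
    (p : Poly) :
    pairing (eval f (remove j (X r)) (contract c (Y r))) p = pairing f (phi j c p) := by
  refine pairing_eval _ _
    (fun i => Sum.elim (fun m => if i < j then (if (m : ℕ) + 1 = i then 1 else 0)
      else (if (m : ℕ) + 1 = i + 1 then 1 else 0)) (fun _ => 0))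
    (fun i => Sum.elim (fun _ => 0) (fun m => if i < c then (if (m : ℕ) + 1 = i then 1 else 0)
      else if i = c then
        (if (m : ℕ) + 1 = c then 1 else 0) + (if (m : ℕ) + 1 = c + 1 then 1 else 0)
      else (if (m : ℕ) + 1 = i + 1 then 1 else 0)))
    ?_ ?_ ?_ ?_ ?_ ?_ ?_ ?_ f p
  · intro i; unfold remove; split_ifs <;> exact constantCoeff_X _ _
  · intro i; unfold contract; split_ifs <;> simp [constantCoeff_Y]
  · rintro i (m | m)
    · unfold remove; split_ifs <;> simp_all [pderiv_inl_X]
    · unfold remove; split_ifs <;> simp [pderiv_inr_X]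
  · rintro i (m | m)
    · unfold contract; split_ifs <;> simp [pderiv_inl_Y]
    · simp only [contract, Sum.elim_inr]
      by_cases h : i < c
      · simp only [h, if_true, pderiv_inr_Y]
      · by_cases h' : i = c
        · simp only [h', lt_irrefl, if_true, if_false, map_add, pderiv_inr_Y]
        · simp only [h, h', if_false, pderiv_inr_Y]
  · intro m
    rw [phi_px]
    have hm := m.2
    -- Solved for i: the slot that contains X_{m+1} is unique, and exists unless m + 1 = j.
    have key (i : ℕ) : ((if i < j then (if (m : ℕ) + 1 = i then 1 else 0)
      else (if (m : ℕ) + 1 = i + 1 then 1 else 0)) : ℚ) =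
        if i = (if (m : ℕ) + 1 < j then (m : ℕ) + 1 else m) ∧ (m : ℕ) + 1 ≠ j then 1 else 0 := by
      grind
    simp only [Sum.elim_inl, key, zero_smul, add_zero]
    by_cases h1 : (m : ℕ) + 1 = j
    · simp [h1]
    · simp only [h1, ne_eq, not_false_eq_true, and_true, ite_smul, one_smul, zero_smul,
        Finset.sum_ite_eq', Finset.mem_Icc, if_false]
      by_cases h2 : (m : ℕ) + 1 < j
      · rw [if_pos h2, if_pos h2, if_pos (by omega)]
      · rw [if_neg h2, if_neg h2, if_pos (by omega)]; simp
  · intro m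
    rw [phi_py]
    have hm := m.2
    have key (i : ℕ) : (if i < c then (if (m : ℕ) + 1 = i then 1 else 0)
      else if i = c then
        (if (m : ℕ) + 1 = c then 1 else 0) + (if (m : ℕ) + 1 = c + 1 then 1 else 0)
      else (if (m : ℕ) + 1 = i + 1 then 1 else 0) : ℚ) =
        if i = (if (m : ℕ) + 1 ≤ c then (m : ℕ) + 1 else m) then 1 else 0 := by
      grind
    simp only [Sum.elim_inr, key, zero_smul, zero_add]
    simp only [ite_smul, one_smul, zero_smul, Finset.sum_ite_eq', Finset.mem_Icc]
    by_cases h2 : (m : ℕ) + 1 ≤ c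
    · simp only [if_pos h2]
      -- The negative case is m + 1 = r = c, where Y_r is dropped; the restriction to r - 1
      -- variables kills y_r accordingly.
      by_cases h3 : 1 ≤ (m : ℕ) + 1 ∧ (m : ℕ) + 1 ≤ r - 1
      · rw [if_pos h3]
      · rw [if_neg h3, res_py_eq_zero h3]
    · simp only [if_neg h2, Nat.add_sub_cancel]
      rw [if_pos (by omega)]
  · intro i hi
    rw [phi_px]
    split_ifs
    · exact res_px_eq_zero (by omega)
    · simp
    · exact res_px_eq_zero (by omega)
  · intro i hi
    rw [phi_py]
    split_ifs
    · exact res_py_eq_zero (by omega)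
    · exact res_py_eq_zero (by omega)

theorem pairing_phiPlus (j : ℕ) (f : Bimould) (r : ℕ) (p : Poly) :
    pairing (phiPlus j f r) p =
      if 1 ≤ j ∧ j ≤ r then pairing (f (r - 1)) (phi j j p) else 0 := by
  unfold phiPlus
  split_ifs with h
  · exact pairing_phi h h _ _
  · exact pairing_zero _

theorem pairing_phiMinus (j : ℕ) (f : Bimould) (r : ℕ) (p : Poly) :
    pairing (phiMinus j f r) p =
      if 2 ≤ j ∧ j ≤ r then pairing (f (r - 1)) (phi j (j - 1) p) else 0 := by
  unfold phiMinus
  split_ifs with h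
  · exact pairing_phi (by omega) (by omega) _ _
  · exact pairing_zero _

/-- The derivation `∂x_j - ∂x_{j+1} + ∂y_j`. -/
def eta (r j : ℕ) : Derivation ℚ Poly Poly := dx r j - dx r (j + 1) + dy r j

/-- The derivation `∂x_{j-1} - ∂x_j + ∂y_j`. -/
def etaMinus (r j : ℕ) : Derivation ℚ Poly Poly := dx r (j - 1) - dx r j + dy r j

/-- Transposition reverses composition: multiplying φ_j f by a linear form means first
differentiating p and then applying `phi`. The conditions in the sum record when φ_j^- and the
squares of φ_j^± are nonzero in depth r. -/
theorem delta_wordOf (r : ℕ) (p : Poly) :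
    induced deltaB (wordOf r p) = wordOf r (∑ j ∈ Finset.Icc 1 r, dy r j (dx r j p)) +
      ∑ j ∈ Finset.Icc 1 r,
        (-((2⁻¹ : ℚ) • wordOf (r - 1) (phi j j (eta r j p)))
          - (if 2 ≤ j then (2⁻¹ : ℚ) • wordOf (r - 1) (phi j (j - 1) (etaMinus r j p)) else 0)
          + (if j ≤ r - 1 then (4⁻¹ : ℚ) • wordOf (r - 1 - 1) (phi j j (phi j j p)) else 0)
          - (if 2 ≤ j ∧ j ≤ r - 1 then
              (4⁻¹ : ℚ) • wordOf (r - 1 - 1) (phi j (j - 1) (phi j (j - 1) p)) else 0)) := by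
  rw [induced_wordOf]
  simp only [deltaB, pairing_add, pairing_sum, pairing_sub, pairing_neg, Finset.sum_mul,
    mul_assoc, pairing_X_mul, pairing_Y_mul, map_sum, wordOf]
  congr 1
  refine Finset.sum_congr rfl fun j hj => ?_
  have hj' := Finset.mem_Icc.1 hj
  congr 1
  · congr 1
    · congr 1
      · congr 1
        rw [add_mul, sub_mul, pairing_add, pairing_sub, pairing_X_mul, pairing_X_mul,
          pairing_Y_mul, pairing_smul, pairing_smul, pairing_smul, pairing_phiPlus,
          pairing_phiPlus, pairing_phiPlus, if_pos hj', if_pos hj', if_pos hj', ← smul_sub,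
          ← smul_add, ← map_sub, ← map_add, ← map_sub, ← map_add]
        rfl
      · rw [add_mul, sub_mul, pairing_add, pairing_sub, pairing_X_mul, pairing_X_mul,
          pairing_Y_mul, pairing_smul, pairing_smul, pairing_smul, pairing_phiMinus,
          pairing_phiMinus, pairing_phiMinus]
        by_cases h : 2 ≤ j
        · have h' : 2 ≤ j ∧ j ≤ r := ⟨h, hj'.2⟩
          rw [if_pos h', if_pos h', if_pos h', ← smul_sub,
            ← smul_add, ← map_sub, ← map_add, ← map_sub, ← map_add, if_pos h]
          rfl
        · rw [if_neg h, if_neg (by omega), if_neg (by omega), if_neg (by omega)]; simp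
    · rw [pairing_smul, pairing_phiPlus, if_pos hj', pairing_phiPlus]
      by_cases h : j ≤ r - 1
      · rw [if_pos ⟨hj'.1, h⟩, if_pos h]
      · rw [if_neg h, if_neg (by omega), smul_zero]
  · rw [pairing_smul, pairing_phiMinus]
    by_cases h : 2 ≤ j ∧ j ≤ r - 1
    · rw [if_pos h, if_pos ⟨h.1, hj'.2⟩, pairing_phiMinus, if_pos h]
    · rw [if_neg h]
      by_cases h' : 2 ≤ j ∧ j ≤ r
      · rw [if_pos h', pairing_phiMinus, if_neg h, smul_zero]
      · rw [if_neg h', smul_zero]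

/-- The quadratic form `∑ x_i y_i`. -/
def quad (r : ℕ) : Poly := ∑ i ∈ Finset.Icc 1 r, px i * py i

theorem res_quad (r : ℕ) :
    res r (quad r) = ∑ j : Fin r, MvPolynomial.X (Sum.inl j) * MvPolynomial.X (Sum.inr j) := by
  rw [quad, map_sum, sum_Icc_eq_sum_fin]
  simp only [map_mul, res_px_succ, res_py_succ]

theorem d_wordOf (r : ℕ) (p : Poly) :
    induced dB (wordOf r p) = wordOf r (quad r * p) := by
  rw [induced_wordOf, wordOf, pairing_apply, pairing_apply, map_mul, res_quad, Finset.sum_mul,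
    map_sum, dB, pair_sum]
  refine Finset.sum_congr rfl fun j _ => ?_
  rw [mul_comm (MvPolynomial.X (Sum.inl j)), mul_assoc, pair_X_mul, pair_X_mul]

/-- The Euler derivation. -/
def euler : Derivation ℚ Poly Poly := MvPolynomial.mkDerivation ℚ MvPolynomial.X

@[simp] theorem euler_px (i : ℕ) : euler (px i) = px i := MvPolynomial.mkDerivation_X _ _ _

@[simp] theorem euler_py (i : ℕ) : euler (py i) = py i := MvPolynomial.mkDerivation_X _ _ _

theorem derivation_sum_apply {A ι : Type*} [CommRing A] [Algebra ℚ A] (s : Finset ι)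
    (d : ι → Derivation ℚ A A) (a : A) : (∑ i ∈ s, d i) a = ∑ i ∈ s, d i a := by
  have := congrFun (map_sum (Derivation.coeFnAddMonoidHom (R := ℚ) (A := A) (M := A)) d s) a
  rw [Finset.sum_apply] at this
  exact this

theorem euler_res (r : ℕ) (p : Poly) : res r (euler p) =
    ∑ j : Fin r, (MvPolynomial.X (Sum.inl j) * MvPolynomial.pderiv (Sum.inl j) (res r p) +
      MvPolynomial.X (Sum.inr j) * MvPolynomial.pderiv (Sum.inr j) (res r p)) := by
  let d : Derivation ℚ (MvPolynomial (Fin r ⊕ Fin r) ℚ) (MvPolynomial (Fin r ⊕ Fin r) ℚ) :=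
    MvPolynomial.mkDerivation ℚ MvPolynomial.X
  have h1 : d (res r p) = res r (euler p) := by
    refine derivation_comp_algHom_xy (res r) _ _ (fun i => ?_) (fun i => ?_) p
    · rw [euler_px]
      by_cases h : 1 ≤ i ∧ i ≤ r
      · obtain ⟨i, rfl⟩ : ∃ k : Fin r, i = k + 1 := ⟨⟨i - 1, by omega⟩, by simp; omega⟩
        rw [res_px_succ]; exact MvPolynomial.mkDerivation_X _ _ _
      · rw [res_px_eq_zero h, map_zero]
    · rw [euler_py]
      by_cases h : 1 ≤ i ∧ i ≤ r
      · obtain ⟨i, rfl⟩ : ∃ k : Fin r, i = k + 1 := ⟨⟨i - 1, by omega⟩, by simp; omega⟩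
        rw [res_py_succ]; exact MvPolynomial.mkDerivation_X _ _ _
      · rw [res_py_eq_zero h, map_zero]
  rw [← h1, Finset.sum_add_distrib,
    ← Fintype.sum_sum_type (fun v => MvPolynomial.X v * MvPolynomial.pderiv v (res r p))]
  have h2 : d = ∑ v, (MvPolynomial.X v : MvPolynomial (Fin r ⊕ Fin r) ℚ) •
      MvPolynomial.pderiv v := by
    refine MvPolynomial.derivation_ext fun v => ?_
    classical
    rw [derivation_sum_apply, Finset.sum_eq_single v]
    · simp [d, MvPolynomial.mkDerivation_X]
    · intro w _ hw
      simp [MvPolynomial.pderiv_X_of_ne (Ne.symm hw)]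
    · simp
  rw [h2, derivation_sum_apply]
  rfl

/-- Each ∂_X X equals X ∂_X + 1; the r summands 1 add up to the depth and the rest is the Euler
operator, which is its own transpose. -/
theorem w_wordOf (r : ℕ) (p : Poly) :
    induced wB (wordOf r p) = (r : ℚ) • wordOf r p + wordOf r (euler p) := by
  rw [induced_wordOf, wordOf, pairing_apply, pairing_apply, pairing_apply, euler_res,
    wB, pair_sum, map_sum]
  have : (r : ℚ) • pair (genSeries r) (res r p) =
      ∑ j : Fin r, pair (genSeries r) (res r p) := by
    simp [Nat.cast_smul_eq_nsmul]
  rw [this, ← Finset.sum_add_distrib]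
  refine Finset.sum_congr rfl fun j _ => ?_
  rw [pair_add, ← pair_X_mul, ← pair_pderiv, ← pair_pderiv, ← pair_X_mul, Derivation.leibniz,
    MvPolynomial.pderiv_X_self, map_add, map_add, smul_eq_mul, smul_eq_mul, mul_one]
  abel

/-- The dual of the swap in depth `r`. -/
def swapPoly (r : ℕ) : Poly →ₐ[ℚ] Poly :=
  subs (fun m => if 1 ≤ m ∧ m ≤ r then py (r + 1 - m) - py (r + 2 - m) else 0)
    (fun m => if 1 ≤ m ∧ m ≤ r then ∑ i ∈ Finset.Icc 1 (r + 1 - m), px i else 0)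

theorem swapPoly_px (r m : ℕ) : swapPoly r (px m) =
    if 1 ≤ m ∧ m ≤ r then py (r + 1 - m) - py (r + 2 - m) else 0 := by simp [swapPoly]

theorem swapPoly_py (r m : ℕ) : swapPoly r (py m) =
    if 1 ≤ m ∧ m ≤ r then ∑ i ∈ Finset.Icc 1 (r + 1 - m), px i else 0 := by simp [swapPoly]

theorem swap_wordOf (r : ℕ) (p : Poly) : swap (wordOf r p) = wordOf r (swapPoly r p) := by
  rw [swap, induced_wordOf, swapB, wordOf]
  refine pairing_eval _ _
    (fun i => Sum.elim (fun _ => 0) (fun m => if (m : ℕ) + 1 ≤ r + 1 - i then 1 else 0))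
    (fun i => Sum.elim (fun m => (if (m : ℕ) + 1 = r + 1 - i then 1 else 0) -
      (if (m : ℕ) + 1 = r + 2 - i then 1 else 0)) (fun _ => 0))
    ?_ ?_ ?_ ?_ ?_ ?_ ?_ ?_ _ p
  · intro i; simp [constantCoeff_Y]
  · intro i; simp [constantCoeff_X]
  · rintro i (m | m)
    · simp [pderiv_inl_Y]
    · simp only [map_sum, pderiv_inr_Y, Sum.elim_inr]
      rw [← map_sum, Finset.sum_ite_eq]
      congr 1
      simp
  · rintro i (m | m)
    · simp [pderiv_inl_X]
    · simp [pderiv_inr_X]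
  · intro m
    have hm := m.2
    rw [swapPoly_px, if_pos (by omega), map_sub]
    simp only [Sum.elim_inl, zero_smul, zero_add, sub_smul, Finset.sum_sub_distrib, ite_smul,
      one_smul]
    congr 1
    · rw [Finset.sum_eq_single (r + 1 - (m + 1))]
      · rw [if_pos (by omega)]
      · intro i hi hne; rw [Finset.mem_Icc] at hi; rw [if_neg (by omega)]
      · intro h; rw [Finset.mem_Icc] at h; omega
    · rw [Finset.sum_eq_single (r + 2 - (m + 1))]
      · rw [if_pos (by omega)]
      · intro i hi hne; rw [Finset.mem_Icc] at hi; rw [if_neg (by omega)]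
      · intro h; rw [Finset.mem_Icc] at h; rw [res_py_eq_zero (by omega), ite_self]
  · intro m
    have hm := m.2
    rw [swapPoly_py, if_pos (by omega), map_sum]
    simp only [Sum.elim_inr, zero_smul, add_zero, ite_smul, one_smul]
    rw [← Finset.sum_filter]
    refine Finset.sum_congr ?_ fun _ _ => rfl
    ext i; simp only [Finset.mem_Icc, Finset.mem_filter]; omega
  · intro i hi; rw [swapPoly_px, if_neg hi, map_zero]
  · intro i hi; rw [swapPoly_py, if_neg hi, map_zero]

end Duals

/-! ### The swap commutes with D and δ. -/

section SwapCommutes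

theorem derivation_ext_xy {d d' : Derivation ℚ Poly Poly} (hx : ∀ i, d (px i) = d' (px i))
    (hy : ∀ i, d (py i) = d' (py i)) : d = d' :=
  MvPolynomial.derivation_ext fun v => by
    cases v with
    | inl i => exact hx i
    | inr i => exact hy i

theorem dx_dy_comm (r i j : ℕ) (p : Poly) : dx r i (dy r j p) = dy r j (dx r i p) := by
  have h : ⁅dx r i, dy r j⁆ = 0 := derivation_ext_xy
    (fun k => by
      rw [Derivation.commutator_apply, dy_px, dx_px]; split_ifs <;> simp)
    (fun k => by
      rw [Derivation.commutator_apply, dx_py, dy_py]; split_ifs <;> simp)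
  have h' := DFunLike.congr_fun h p
  rw [Derivation.commutator_apply] at h'
  exact sub_eq_zero.1 h'

theorem dx_euler (r i : ℕ) (p : Poly) : dx r i (euler p) = euler (dx r i p) + dx r i p := by
  have h : ⁅dx r i, euler⁆ = dx r i := derivation_ext_xy
    (fun k => by
      rw [Derivation.commutator_apply, euler_px, dx_px]; split_ifs <;> simp)
    (fun k => by
      rw [Derivation.commutator_apply, euler_py, dx_py]; simp)
  have h' := DFunLike.congr_fun h p
  rw [Derivation.commutator_apply] at h'
  rw [← sub_eq_iff_eq_add', h']

theorem dy_euler (r i : ℕ) (p : Poly) : dy r i (euler p) = euler (dy r i p) + dy r i p := by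
  have h : ⁅dy r i, euler⁆ = dy r i := derivation_ext_xy
    (fun k => by
      rw [Derivation.commutator_apply, euler_px, dy_px]; simp)
    (fun k => by
      rw [Derivation.commutator_apply, euler_py, dy_py]; split_ifs <;> simp)
  have h' := DFunLike.congr_fun h p
  rw [Derivation.commutator_apply] at h'
  rw [← sub_eq_iff_eq_add', h']

theorem dx_sum_px (r j N : ℕ) (hN : N ≤ r) :
    dx r j (∑ i ∈ Finset.Icc 1 N, px i) = if 1 ≤ j ∧ j ≤ N then 1 else 0 := by
  rw [map_sum]
  by_cases h : 1 ≤ j ∧ j ≤ N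
  · rw [Finset.sum_eq_single j, dx_px, if_pos (by omega), if_pos h]
    · intro b _ hb; rw [dx_px, if_neg (by tauto)]
    · intro h'; rw [Finset.mem_Icc] at h'; omega
  · rw [if_neg h]
    refine Finset.sum_eq_zero fun i hi => ?_
    rw [Finset.mem_Icc] at hi
    rw [dx_px, if_neg (by omega)]

theorem dx_swapPoly {r j : ℕ} (hj : 1 ≤ j) (p : Poly) :
    dx r j (swapPoly r p) = swapPoly r (∑ m ∈ Finset.Icc 1 (r + 1 - j), dy r m p) := by
  rw [← derivation_sum_apply]
  refine derivation_comp_algHom_xy (swapPoly r) _ _ (fun m => ?_) (fun m => ?_) p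
  · rw [derivation_sum_apply, swapPoly_px]
    simp only [dy_px, Finset.sum_const_zero, map_zero]
    split_ifs
    · rw [map_sub, dx_py, dx_py, sub_zero]
    · simp
  · rw [derivation_sum_apply, swapPoly_py]
    simp only [dy_py]
    by_cases h : 1 ≤ m ∧ m ≤ r
    · rw [if_pos h, dx_sum_px _ _ _ (by omega)]
      by_cases h' : m ≤ r + 1 - j
      · rw [if_pos (by omega), Finset.sum_eq_single m]
        · simp [h]
        · intro b _ hb; rw [if_neg (by omega)]
        · intro h'; rw [Finset.mem_Icc] at h'; omega
      · rw [if_neg (by omega), Finset.sum_eq_zero, map_zero]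
        intro b hb; rw [Finset.mem_Icc] at hb; rw [if_neg (by omega)]
    · rw [if_neg h, Finset.sum_eq_zero, map_zero, map_zero]
      intro b hb; rw [Finset.mem_Icc] at hb; rw [if_neg (by omega)]

theorem dy_swapPoly {r j : ℕ} (hj : 1 ≤ j ∧ j ≤ r) (p : Poly) :
    dy r j (swapPoly r p) = swapPoly r (dx r (r + 1 - j) p - dx r (r + 2 - j) p) := by
  have := derivation_comp_algHom_xy (swapPoly r) (dy r j)
    (dx r (r + 1 - j) - dx r (r + 2 - j)) (fun m => ?_) (fun m => ?_) p
  · rwa [Derivation.sub_apply] at this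
  · rw [Derivation.sub_apply, swapPoly_px, dx_px, dx_px, map_sub]
    by_cases h : 1 ≤ m ∧ m ≤ r
    · rw [if_pos h, map_sub, dy_py, dy_py]
      congr 1
      · by_cases h' : r + 1 - m = j
        · rw [if_pos (by omega), if_pos (by omega), map_one]
        · rw [if_neg (by omega), if_neg (by omega), map_zero]
      · by_cases h' : r + 2 - m = j
        · rw [if_pos (by omega), if_pos (by omega), map_one]
        · rw [if_neg (by omega), if_neg (by omega), map_zero]
    · rw [if_neg h, if_neg (by omega), if_neg (by omega)]; simp
  · rw [Derivation.sub_apply, swapPoly_py, dx_py, dx_py, sub_zero, map_zero]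
    split_ifs
    · rw [map_sum]; exact Finset.sum_eq_zero fun i _ => dy_px _ _ _
    · simp

theorem sum_Icc_reflect {M : Type*} [AddCommMonoid M] (r : ℕ) (f : ℕ → M) :
    ∑ j ∈ Finset.Icc 1 r, f j = ∑ j ∈ Finset.Icc 1 r, f (r + 1 - j) := by
  refine Finset.sum_nbij' (fun j => r + 1 - j) (fun j => r + 1 - j) ?_ ?_ ?_ ?_ ?_ <;>
    intro j hj <;> rw [Finset.mem_Icc] at hj
  · rw [Finset.mem_Icc]; omega
  · rw [Finset.mem_Icc]; omega
  · omega
  · omega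
  · congr 1; omega

/-- For fixed m the sum over k ≥ m telescopes, leaving the diagonal term and a boundary term. The
boundary term vanishes in both applications, where index r + 1 is out of range. -/
theorem abel_summation {M : Type*} [AddCommGroup M] (r : ℕ) (F : ℕ → ℕ → M) :
    ∑ k ∈ Finset.Icc 1 r, ∑ m ∈ Finset.Icc 1 k, (F k m - F (k + 1) m) =
      ∑ k ∈ Finset.Icc 1 r, F k k - ∑ m ∈ Finset.Icc 1 r, F (r + 1) m := by
  induction r with
  | zero => simp
  | succ r ih =>
    rw [Finset.sum_Icc_succ_top (by omega), ih, Finset.sum_sub_distrib,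
      Finset.sum_Icc_succ_top (by omega) (fun m => F (r + 1) m),
      Finset.sum_Icc_succ_top (by omega) (fun m => F m m)]
    abel

/-- By the chain rule, ∂x_j turns into a partial sum of the ∂y_m and ∂y_j into a difference of
consecutive ∂x's, which is the pattern of `abel_summation` after reversing the order of j. -/
theorem laplace_swapPoly (r : ℕ) (p : Poly) :
    ∑ j ∈ Finset.Icc 1 r, dy r j (dx r j (swapPoly r p)) =
      swapPoly r (∑ j ∈ Finset.Icc 1 r, dy r j (dx r j p)) := by
  have h1 : ∑ j ∈ Finset.Icc 1 r, dy r j (dx r j (swapPoly r p)) =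
      swapPoly r (∑ j ∈ Finset.Icc 1 r, ∑ m ∈ Finset.Icc 1 (r + 1 - j),
        (dx r (r + 1 - j) (dy r m p) - dx r (r + 1 - j + 1) (dy r m p))) := by
    rw [map_sum]
    refine Finset.sum_congr rfl fun j hj => ?_
    rw [Finset.mem_Icc] at hj
    rw [dx_swapPoly hj.1, dy_swapPoly hj, map_sum, map_sum, ← Finset.sum_sub_distrib]
    congr 2
    funext m
    congr 3
    omega
  rw [h1, ← sum_Icc_reflect r (fun k => ∑ m ∈ Finset.Icc 1 k,
    (dx r k (dy r m p) - dx r (k + 1) (dy r m p))), abel_summation r (fun k m => dx r k (dy r m p))]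
  have h2 : dx r (r + 1) = 0 := by rw [dx, if_neg (by omega)]
  simp [h2, dx_dy_comm]

/-- The difference of two partial sums of ∂y's is a single ∂y, and ∂y_j becomes a difference of
∂x's, so the three terms only trade places. The linear factors in δ are chosen for this symmetry. -/
theorem eta_swapPoly {r j : ℕ} (hj : 1 ≤ j ∧ j ≤ r) (p : Poly) :
    eta r j (swapPoly r p) = swapPoly r (eta r (r + 1 - j) p) := by
  simp only [eta, Derivation.add_apply, Derivation.sub_apply]
  rw [dx_swapPoly hj.1, dx_swapPoly (by omega), dy_swapPoly hj, ← map_sub, ← map_add]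
  obtain ⟨k, rfl⟩ : ∃ k, r = j + k := ⟨r - j, by omega⟩
  rw [show j + k + 1 - j = k + 1 by omega, show j + k + 1 - (j + 1) = k by omega,
    show j + k + 2 - j = k + 1 + 1 by omega, Finset.sum_Icc_succ_top (by omega)]
  congr 1; ring

theorem etaMinus_swapPoly {r j : ℕ} (hj : 2 ≤ j ∧ j ≤ r) (p : Poly) :
    etaMinus r j (swapPoly r p) = swapPoly r (etaMinus r (r + 2 - j) p) := by
  simp only [etaMinus, Derivation.add_apply, Derivation.sub_apply]
  rw [dx_swapPoly (by omega), dx_swapPoly (by omega), dy_swapPoly (by omega), ← map_sub, ← map_add]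
  obtain ⟨k, rfl⟩ : ∃ k, r = j + k := ⟨r - j, by omega⟩
  rw [show j + k + 1 - j = k + 1 by omega, show j + k + 1 - (j - 1) = k + 1 + 1 by omega,
    show j + k + 2 - j = k + 1 + 1 by omega, Finset.sum_Icc_succ_top (by omega)]
  congr 1
  simp only [Nat.add_sub_cancel]; ring

theorem phi_sum_px {j : ℕ} (hj : 1 ≤ j) (c N : ℕ) :
    phi j c (∑ i ∈ Finset.Icc 1 N, px i) =
      ∑ i ∈ Finset.Icc 1 (if N < j then N else N - 1), px i := by
  induction N with
  | zero => simp
  | succ N ih =>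
    rw [Finset.sum_Icc_succ_top (by omega), map_add, ih, phi_px]
    by_cases h1 : N + 1 < j
    · rw [if_pos (by omega), if_pos h1, if_pos h1, Finset.sum_Icc_succ_top (by omega)]
    · rw [if_neg h1, if_neg h1]
      by_cases h2 : N + 1 = j
      · rw [if_pos (by omega), if_pos h2, add_zero]; rfl
      · rw [if_neg (by omega), if_neg h2, Nat.add_sub_cancel]
        obtain ⟨k, rfl⟩ : ∃ k, N = k + 1 := ⟨N - 1, by omega⟩
        rw [Nat.add_sub_cancel, Finset.sum_Icc_succ_top (by omega)]

/-- The swap exchanges removing an X and merging two Y's, so the indices j and c trade roles under i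
↦ r + 1 - i. Thus φ_j^+ goes to φ_{r+1-j}^+ and φ_j^- to φ_{r+2-j}^-. The restriction is needed for
the variable y_r, which survives `phi` when c = r. -/
theorem res_phi_swapPoly {r j c : ℕ} (hj : 1 ≤ j ∧ j ≤ r) (hc : 1 ≤ c ∧ c ≤ r) (p : Poly) :
    res (r - 1) (phi j c (swapPoly r p)) =
      res (r - 1) (swapPoly (r - 1) (phi (r + 1 - c) (r + 1 - j) p)) := by
  have : (res (r - 1)).comp ((phi j c).comp (swapPoly r)) =
      (res (r - 1)).comp ((swapPoly (r - 1)).comp (phi (r + 1 - c) (r + 1 - j))) := by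
    refine algHom_ext_xy (fun m => ?_) (fun m => ?_)
    · simp only [AlgHom.comp_apply, swapPoly_px, phi_px]
      by_cases hm : 1 ≤ m ∧ m ≤ r
      · rw [if_pos hm, map_sub, phi_py, phi_py]
        by_cases h1 : m < r + 1 - c
        · rw [if_pos h1, if_neg (by omega), if_neg (by omega), swapPoly_px, if_pos (by omega)]
          congr 3 <;> omega
        · by_cases h2 : m = r + 1 - c
          · rw [if_neg h1, if_pos h2, if_pos (by omega), map_zero, map_zero, map_sub]
            by_cases h3 : m = 1
            · rw [if_neg (by omega), res_py_eq_zero (by omega), res_py_eq_zero (by omega), sub_zero]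
            · rw [if_neg (by omega), show r + 2 - m - 1 = r + 1 - m by omega, sub_self]
          · rw [if_neg h1, if_neg h2, if_pos (by omega), if_pos (by omega), swapPoly_px,
              if_pos (by omega)]
            rw [show r - 1 + 1 - (m - 1) = r + 1 - m by omega,
              show r - 1 + 2 - (m - 1) = r + 2 - m by omega]
      · rw [if_neg hm]
        split_ifs
        · rw [swapPoly_px, if_neg (by omega)]; simp
        · simp
        · rw [swapPoly_px, if_neg (by omega)]; simp
    · simp only [AlgHom.comp_apply, swapPoly_py, phi_py]
      by_cases hm : 1 ≤ m ∧ m ≤ r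
      · rw [if_pos hm, phi_sum_px hj.1]
        by_cases h1 : m ≤ r + 1 - j
        · rw [if_neg (by omega), if_pos h1, swapPoly_py]
          by_cases h2 : m = r
          · rw [if_neg (by omega), show r + 1 - m - 1 = 0 by omega]; simp
          · rw [if_pos (by omega), show r + 1 - m - 1 = r - 1 + 1 - m by omega]
        · rw [if_pos (by omega), if_neg h1, swapPoly_py, if_pos (by omega),
            show r + 1 - m = r - 1 + 1 - (m - 1) by omega]
      · rw [if_neg hm]
        split_ifs
        · rw [swapPoly_py, if_neg (by omega)]; simp
        · rw [swapPoly_py, if_neg (by omega)]; simp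
  exact DFunLike.congr_fun this p

/-- By `pairing_phi`, the left side is already a pairing with a series in depth s, hence sees p only
through `res s p`. This allows congruences modulo out-of-range variables to pass through `phi`. -/
theorem wordOf_phi_congr {s j c : ℕ} (hj : 1 ≤ j ∧ j ≤ s) (hc : 1 ≤ c ∧ c ≤ s) {p q : Poly}
    (h : res s p = res s q) : wordOf (s - 1) (phi j c p) = wordOf (s - 1) (phi j c q) := by
  rw [wordOf, ← pairing_phi hj hc, ← pairing_phi hj hc, pairing_apply, pairing_apply, h]

/-- Removing two neighbours gives the same result in either indexing. It absorbs the mismatch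
between reflecting in depth r and then in depth r - 1. -/
theorem phi_phi_succ (a b : ℕ) (p : Poly) :
    phi a b (phi (a + 1) (b + 1) p) = phi a b (phi a b p) := by
  have : (phi a b).comp (phi (a + 1) (b + 1)) = (phi a b).comp (phi a b) := by
    refine algHom_ext_xy (fun i => ?_) (fun i => ?_)
    · simp only [AlgHom.comp_apply, phi_px]
      rcases lt_trichotomy i a with h | h | h
      · simp [h, phi_px, show i < a + 1 by omega]
      · simp [h, phi_px]
      · by_cases h' : i = a + 1
        · simp [h', phi_px]
        · rw [if_neg (by omega), if_neg h', if_neg (by omega), if_neg (by omega)]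
    · simp only [AlgHom.comp_apply, phi_py]
      rcases lt_trichotomy i (b + 1) with h | h | h
      · rw [if_pos (by omega), if_pos (by omega)]
      · simp [h, phi_py]
      · rw [if_neg (by omega), if_neg (by omega)]
  exact DFunLike.congr_fun this p

theorem wordOf_phi_swapPoly {r j c : ℕ} (hj : 1 ≤ j ∧ j ≤ r) (hc : 1 ≤ c ∧ c ≤ r) (p : Poly) :
    wordOf (r - 1) (phi j c (swapPoly r p)) =
      swap (wordOf (r - 1) (phi (r + 1 - c) (r + 1 - j) p)) := by
  rw [swap_wordOf]
  exact wordOf_congr (res_phi_swapPoly hj hc p)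

theorem wordOf_phi_phi_swapPoly {r j c : ℕ} (hj : 1 ≤ j ∧ j ≤ r - 1) (hc : 1 ≤ c ∧ c ≤ r - 1)
    (p : Poly) :
    wordOf (r - 1 - 1) (phi j c (phi j c (swapPoly r p))) =
      swap (wordOf (r - 1 - 1) (phi (r - c) (r - j) (phi (r - c) (r - j) p))) := by
  rw [wordOf_phi_congr hj hc (res_phi_swapPoly (r := r) (by omega) (by omega) p),
    wordOf_phi_swapPoly hj hc, show r + 1 - c = r - c + 1 by omega,
    show r + 1 - j = r - j + 1 by omega, show r - 1 + 1 - c = r - c by omega,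
    show r - 1 + 1 - j = r - j by omega, phi_phi_succ]

theorem sum_Icc_ite_reflect {M : Type*} [AddCommMonoid M] {r a b : ℕ} (hb : b ≤ r) (ha : 1 ≤ a)
    (f : ℕ → M) :
    (∑ j ∈ Finset.Icc 1 r, if a ≤ j ∧ j ≤ b then f j else 0) =
      ∑ j ∈ Finset.Icc 1 r, if a ≤ j ∧ j ≤ b then f (a + b - j) else 0 := by
  rw [← Finset.sum_filter, ← Finset.sum_filter]
  refine Finset.sum_nbij' (fun j => a + b - j) (fun j => a + b - j) ?_ ?_ ?_ ?_ ?_ <;>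
    intro j hj <;> simp only [Finset.mem_filter, Finset.mem_Icc] at hj ⊢
  · omega
  · omega
  · omega
  · omega
  · congr 1; omega

/-- The four families of corrections are matched separately, each by a reflection of its own index
range: [1, r] and [2, r] for φ^+ and φ^-, then [1, r - 1] and [2, r - 1] for their squares. -/
theorem delta_swap_wordOf (r : ℕ) (p : Poly) :
    induced deltaB (swap (wordOf r p)) = swap (induced deltaB (wordOf r p)) := by
  rw [swap_wordOf, delta_wordOf, delta_wordOf, map_add, swap_wordOf, laplace_swapPoly]
  congr 1
  rw [map_sum]
  simp only [Finset.sum_add_distrib, Finset.sum_sub_distrib, map_add, map_sub]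
  congr 1
  · congr 1
    · congr 1
      · rw [sum_Icc_reflect]
        refine Finset.sum_congr rfl fun j hj => ?_
        rw [Finset.mem_Icc] at hj
        rw [eta_swapPoly (by omega), wordOf_phi_swapPoly (by omega) (by omega),
          show r + 1 - (r + 1 - j) = j by omega, map_neg, map_smul]
      · have h := sum_Icc_ite_reflect (le_refl r) (show 1 ≤ 2 by omega) fun j =>
          (2⁻¹ : ℚ) • wordOf (r - 1) (phi j (j - 1) (etaMinus r j (swapPoly r p)))
        have e (j : ℕ) (hj : j ∈ Finset.Icc 1 r) (F : ℕ → QA) :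
            (if 2 ≤ j then F j else 0) = if 2 ≤ j ∧ j ≤ r then F j else 0 := by
          rw [Finset.mem_Icc] at hj
          simp [hj.2]
        rw [Finset.sum_congr rfl fun j hj => e j hj fun j =>
          (2⁻¹ : ℚ) • wordOf (r - 1) (phi j (j - 1) (etaMinus r j (swapPoly r p))), h]
        refine Finset.sum_congr rfl fun j hj => ?_
        rw [Finset.mem_Icc] at hj
        by_cases h2 : 2 ≤ j
        · rw [if_pos (by omega), if_pos h2, etaMinus_swapPoly (by omega),
            wordOf_phi_swapPoly (by omega) (by omega), map_smul]
          rw [show r + 1 - (2 + r - j - 1) = j by omega, show r + 1 - (2 + r - j) = j - 1 by omega,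
            show r + 2 - (2 + r - j) = j by omega]
        · rw [if_neg (by omega), if_neg h2, map_zero]
    · have h := sum_Icc_ite_reflect (show r - 1 ≤ r by omega) (show 1 ≤ 1 by omega) fun j =>
          (4⁻¹ : ℚ) • wordOf (r - 1 - 1) (phi j j (phi j j (swapPoly r p)))
      have e (j : ℕ) (hj : j ∈ Finset.Icc 1 r) (F : ℕ → QA) :
          (if j ≤ r - 1 then F j else 0) = if 1 ≤ j ∧ j ≤ r - 1 then F j else 0 := by
        rw [Finset.mem_Icc] at hj
        simp [hj.1]
      rw [Finset.sum_congr rfl fun j hj => e j hj fun j =>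
          (4⁻¹ : ℚ) • wordOf (r - 1 - 1) (phi j j (phi j j (swapPoly r p))), h]
      refine Finset.sum_congr rfl fun j hj => ?_
      rw [Finset.mem_Icc] at hj
      by_cases h2 : j ≤ r - 1
      · rw [if_pos (by omega), if_pos h2, wordOf_phi_phi_swapPoly (by omega) (by omega), map_smul,
          show r - (1 + (r - 1) - j) = j by omega]
      · rw [if_neg (by omega), if_neg h2, map_zero]
  · rw [sum_Icc_ite_reflect (show r - 1 ≤ r by omega) (show 1 ≤ 2 by omega) fun j =>
          (4⁻¹ : ℚ) • wordOf (r - 1 - 1) (phi j (j - 1) (phi j (j - 1) (swapPoly r p)))]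
    refine Finset.sum_congr rfl fun j hj => ?_
    by_cases h2 : 2 ≤ j ∧ j ≤ r - 1
    · rw [if_pos h2, if_pos h2, wordOf_phi_phi_swapPoly (by omega) (by omega), map_smul,
        show r - (2 + (r - 1) - j - 1) = j by omega, show r - (2 + (r - 1) - j) = j - 1 by omega]
    · rw [if_neg h2, if_neg h2, map_zero]

/-- The same telescoping as for the Laplacian, now with boundary terms that contain y_{r+1}, which
the restriction sets to 0. -/
theorem res_swapPoly_quad (r : ℕ) : res r (swapPoly r (quad r)) = res r (quad r) := by
  have h := abel_summation r fun k m => py k * px m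
  have h1 : swapPoly r (quad r) = (∑ k ∈ Finset.Icc 1 r, ∑ m ∈ Finset.Icc 1 k,
      (py k * px m - py (k + 1) * px m)) := by
    rw [quad, map_sum, sum_Icc_reflect]
    refine Finset.sum_congr rfl fun j hj => ?_
    rw [Finset.mem_Icc] at hj
    rw [map_mul, swapPoly_px, swapPoly_py, if_pos (by omega), if_pos (by omega),
      show r + 1 - (r + 1 - j) = j by omega, show r + 2 - (r + 1 - j) = j + 1 by omega,
      Finset.mul_sum]
    simp only [sub_mul]
  rw [h1, h, map_sub, map_sum (res r) _ (Finset.Icc 1 r)]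
  have h2 : res r (py (r + 1)) = 0 := res_py_eq_zero (by omega)
  simp [quad, h2, mul_comm]

theorem d_swap_wordOf (r : ℕ) (p : Poly) :
    induced dB (swap (wordOf r p)) = swap (induced dB (wordOf r p)) := by
  rw [swap_wordOf, d_wordOf, d_wordOf, swap_wordOf]
  refine wordOf_congr ?_
  rw [map_mul, map_mul, map_mul, res_swapPoly_quad]

end SwapCommutes

/-! ### The commutation relations on words. -/

section Brackets

theorem dx_quad (r j : ℕ) : dx r j (quad r) = if 1 ≤ j ∧ j ≤ r then py j else 0 := by
  rw [quad, map_sum]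
  by_cases h : 1 ≤ j ∧ j ≤ r
  · rw [if_pos h, Finset.sum_eq_single j]
    · simp [Derivation.leibniz, dx_px, dx_py, h]
    · intro b _ hb; simp [Derivation.leibniz, dx_px, dx_py, hb]
    · intro h'; rw [Finset.mem_Icc] at h'; omega
  · rw [if_neg h]
    refine Finset.sum_eq_zero fun i hi => ?_
    rw [Finset.mem_Icc] at hi
    rw [Derivation.leibniz, dx_px, dx_py, if_neg (by omega)]; simp

theorem dy_quad (r j : ℕ) : dy r j (quad r) = if 1 ≤ j ∧ j ≤ r then px j else 0 := by
  rw [quad, map_sum]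
  by_cases h : 1 ≤ j ∧ j ≤ r
  · rw [if_pos h, Finset.sum_eq_single j]
    · simp [Derivation.leibniz, dy_px, dy_py, h]
    · intro b _ hb; simp [Derivation.leibniz, dy_px, dy_py, hb]
    · intro h'; rw [Finset.mem_Icc] at h'; omega
  · rw [if_neg h]
    refine Finset.sum_eq_zero fun i hi => ?_
    rw [Finset.mem_Icc] at hi
    rw [Derivation.leibniz, dy_px, dy_py, if_neg (by omega)]; simp

theorem phi_quad {r j c : ℕ} (hj : 1 ≤ j ∧ j ≤ r) (hc : c = j ∨ c = j - 1) :
    phi j c (quad r) = quad (r - 1) := by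
  have key (N : ℕ) : phi j c (quad N) = quad (if N < j then N else N - 1) := by
    induction N with
    | zero => simp [quad]
    | succ N ih =>
      have h (M : ℕ) : quad (M + 1) = quad M + px (M + 1) * py (M + 1) :=
        Finset.sum_Icc_succ_top (by omega) _
      rw [h, map_add, ih, map_mul, phi_px, phi_py]
      by_cases h1 : N + 1 < j
      · rw [if_pos (by omega), if_pos h1, if_pos (by omega), if_pos h1, h]
      · rw [if_neg h1, if_neg h1]
        by_cases h2 : N + 1 = j
        · rw [if_pos (by omega), if_pos h2, zero_mul, add_zero]; rfl
        · obtain ⟨k, rfl⟩ : ∃ k, N = k + 1 := ⟨N - 1, by omega⟩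
          rw [if_neg (by omega), if_neg h2, if_neg (by omega), Nat.add_sub_cancel,
            Nat.add_sub_cancel, h]
  rw [key, if_neg (by omega)]

/-- The derivative is y_j - y_{j+1} + x_j, and `phi j j` kills x_j and identifies the two y's. For j
= r the term y_{r+1} is missing, but then y_r is out of range in depth r - 1. Hence the corrections
of δ commute with multiplication by the quadratic form. -/
theorem res_phi_eta_quad {r j : ℕ} (hj : 1 ≤ j ∧ j ≤ r) :
    res (r - 1) (phi j j (eta r j (quad r))) = 0 := by
  simp only [eta, Derivation.add_apply, Derivation.sub_apply, dx_quad, dy_quad, if_pos hj]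
  simp only [map_add, map_sub, phi_py, phi_px, lt_irrefl, if_true, if_false, le_refl,
    add_zero]
  by_cases h : j + 1 ≤ r
  · rw [if_pos (by omega), phi_py, if_neg (by omega), Nat.add_sub_cancel, sub_self]
  · rw [if_neg (by omega), map_zero, map_zero, sub_zero, res_py_eq_zero (by omega)]

theorem phi_etaMinus_quad {r j : ℕ} (hj : 2 ≤ j ∧ j ≤ r) :
    phi j (j - 1) (etaMinus r j (quad r)) = 0 := by
  have h1 : 1 ≤ j ∧ j ≤ r := by omega
  have h2 : 1 ≤ j - 1 ∧ j - 1 ≤ r := by omega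
  simp only [etaMinus, Derivation.add_apply, Derivation.sub_apply, dx_quad, dy_quad, if_pos h1,
    if_pos h2]
  simp only [map_add, map_sub, phi_py, phi_px, lt_irrefl, if_true, if_false, le_refl]
  rw [if_neg (by omega), sub_self, zero_add]

theorem wordOf_euler (r : ℕ) (p : Poly) : wordOf r (∑ j ∈ Finset.Icc 1 r,
    (px j * dx r j p + py j * dy r j p)) = wordOf r (euler p) := by
  refine wordOf_congr ?_
  rw [euler_res, map_sum, sum_Icc_eq_sum_fin]
  simp only [map_add, map_mul, res_px_succ, res_py_succ, pderiv_inl_res, pderiv_inr_res]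

/-- Leibniz in each index j produces the cross terms x_j ∂x_j and y_j ∂y_j and the constant ∂x_j
∂y_j (x_j y_j) = 1. Their sum is W. -/
theorem wordOf_laplace_quad (r : ℕ) (p : Poly) :
    wordOf r (∑ j ∈ Finset.Icc 1 r, dy r j (dx r j (quad r * p))) =
      wordOf r (quad r * ∑ j ∈ Finset.Icc 1 r, dy r j (dx r j p)) +
        ((r : ℚ) • wordOf r p + wordOf r (euler p)) := by
  have h : (r : ℚ) • wordOf r p = wordOf r (∑ j ∈ Finset.Icc 1 r, p) := by
    rw [Finset.sum_const, Nat.card_Icc, map_nsmul, Nat.add_sub_cancel, Nat.cast_smul_eq_nsmul]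
  rw [h, ← wordOf_euler, ← map_add, ← map_add, Finset.mul_sum, ← Finset.sum_add_distrib,
    ← Finset.sum_add_distrib]
  congr 1
  refine Finset.sum_congr rfl fun j hj => ?_
  rw [Finset.mem_Icc] at hj
  simp only [Derivation.leibniz, dx_quad, if_pos hj, smul_eq_mul, map_add, dy_quad, dy_py]
  simp only [hj.1, hj.2, and_self, if_true, mul_one]
  ring

theorem wordOf_phi_eta_quad {r j : ℕ} (hj : 1 ≤ j ∧ j ≤ r) (p : Poly) :
    wordOf (r - 1) (phi j j (eta r j (quad r * p))) =
      induced dB (wordOf (r - 1) (phi j j (eta r j p))) := by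
  rw [d_wordOf]
  refine wordOf_congr ?_
  rw [Derivation.leibniz]
  simp only [smul_eq_mul, map_add, map_mul, res_phi_eta_quad hj, phi_quad hj (Or.inl rfl), mul_zero,
    add_zero]

theorem wordOf_phi_etaMinus_quad {r j : ℕ} (hj : 2 ≤ j ∧ j ≤ r) (p : Poly) :
    wordOf (r - 1) (phi j (j - 1) (etaMinus r j (quad r * p))) =
      induced dB (wordOf (r - 1) (phi j (j - 1) (etaMinus r j p))) := by
  rw [d_wordOf]
  refine wordOf_congr ?_
  rw [Derivation.leibniz]
  simp only [smul_eq_mul, map_add, map_mul, phi_etaMinus_quad hj,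
    phi_quad (show 1 ≤ j ∧ j ≤ r by omega) (Or.inr rfl), mul_zero, add_zero]

theorem wordOf_phi_phi_quad {r j c : ℕ} (hj : 1 ≤ j ∧ j ≤ r - 1) (hc : c = j ∨ c = j - 1)
    (p : Poly) :
    wordOf (r - 1 - 1) (phi j c (phi j c (quad r * p))) =
      induced dB (wordOf (r - 1 - 1) (phi j c (phi j c p))) := by
  rw [d_wordOf, map_mul, map_mul, phi_quad (by omega) hc, phi_quad hj hc]

theorem delta_d_wordOf (r : ℕ) (p : Poly) :
    induced deltaB (induced dB (wordOf r p)) =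
      induced dB (induced deltaB (wordOf r p)) + induced wB (wordOf r p) := by
  rw [w_wordOf, d_wordOf, delta_wordOf, delta_wordOf, wordOf_laplace_quad, map_add, d_wordOf,
    add_right_comm, map_sum]
  congr 1
  congr 1
  refine Finset.sum_congr rfl fun j hj => ?_
  rw [Finset.mem_Icc] at hj
  rw [wordOf_phi_eta_quad hj, map_sub, map_add, map_sub, map_neg, map_smul]
  congr 1
  · congr 1
    · congr 1
      split_ifs with h
      · rw [wordOf_phi_etaMinus_quad (by omega), map_smul]
      · rw [map_zero]
    · split_ifs with h
      · rw [wordOf_phi_phi_quad (by omega) (Or.inl rfl), map_smul]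
      · rw [map_zero]
  · split_ifs with h
    · rw [wordOf_phi_phi_quad (by omega) (Or.inr rfl), map_smul]
    · rw [map_zero]

theorem euler_quad (r : ℕ) : euler (quad r) = 2 * quad r := by
  rw [quad, map_sum, Finset.mul_sum]
  refine Finset.sum_congr rfl fun i _ => ?_
  rw [Derivation.leibniz, euler_px, euler_py, smul_eq_mul, smul_eq_mul]; ring

theorem w_d_wordOf (r : ℕ) (p : Poly) :
    induced wB (induced dB (wordOf r p)) =
      induced dB (induced wB (wordOf r p)) + (2 : ℚ) • induced dB (wordOf r p) := by
  rw [w_wordOf, d_wordOf, w_wordOf, map_add, map_smul, d_wordOf, d_wordOf, Derivation.leibniz,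
    euler_quad, ← map_smul (wordOf r) (2 : ℚ), map_add, add_assoc]
  congr 2
  congr 1
  rw [smul_eq_mul, MvPolynomial.smul_eq_C_mul]
  simp only [map_ofNat]; ring

theorem phi_euler (j c : ℕ) (p : Poly) : euler (phi j c p) = phi j c (euler p) := by
  refine derivation_comp_algHom_xy (phi j c) _ _ (fun i => ?_) (fun i => ?_) p
  · rw [euler_px, phi_px]; split_ifs <;> simp
  · rw [euler_py, phi_py]; split_ifs <;> simp

theorem eta_euler (r j : ℕ) (p : Poly) : eta r j (euler p) = euler (eta r j p) + eta r j p := by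
  simp only [eta, Derivation.add_apply, Derivation.sub_apply, dx_euler, dy_euler, map_add, map_sub]
  abel

theorem etaMinus_euler (r j : ℕ) (p : Poly) :
    etaMinus r j (euler p) = euler (etaMinus r j p) + etaMinus r j p := by
  simp only [etaMinus, Derivation.add_apply, Derivation.sub_apply, dx_euler, dy_euler, map_add,
    map_sub]
  abel

/-- W is diagonal with eigenvalue depth plus degree, and every term of δ lowers this number by 2:
the Laplacian lowers the degree by 2, the middle terms lower degree and depth by 1 each, the squares
lower the depth by 2. -/
theorem w_delta_wordOf (r : ℕ) (p : Poly) :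
    induced wB (induced deltaB (wordOf r p)) =
      induced deltaB (induced wB (wordOf r p)) + (-2 : ℚ) • induced deltaB (wordOf r p) := by
  rw [w_wordOf, map_add, map_smul, delta_wordOf, delta_wordOf]
  simp only [map_add, map_sum, Finset.smul_sum, ← Finset.sum_add_distrib, smul_add]
  refine Finset.sum_congr rfl fun j hj => ?_
  rw [Finset.mem_Icc] at hj
  have hr : ((r - 1 : ℕ) : ℚ) = r - 1 := by rw [Nat.cast_sub (by omega)]; simp
  rw [dx_euler, map_add, dy_euler, eta_euler, etaMinus_euler]
  have e2 : induced wB (if 2 ≤ j then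
        (2⁻¹ : ℚ) • wordOf (r - 1) (phi j (j - 1) (etaMinus r j p)) else 0) =
      (r - 1 : ℚ) • (if 2 ≤ j then
        (2⁻¹ : ℚ) • wordOf (r - 1) (phi j (j - 1) (etaMinus r j p)) else 0) +
      (if 2 ≤ j then
        (2⁻¹ : ℚ) • wordOf (r - 1) (phi j (j - 1) (euler (etaMinus r j p))) else 0) := by
    split_ifs
    · rw [map_smul, w_wordOf, hr, phi_euler]; module
    · simp
  have e3 : induced wB (if j ≤ r - 1 then
        (4⁻¹ : ℚ) • wordOf (r - 1 - 1) (phi j j (phi j j p)) else 0) =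
      (r - 2 : ℚ) • (if j ≤ r - 1 then
        (4⁻¹ : ℚ) • wordOf (r - 1 - 1) (phi j j (phi j j p)) else 0) +
      (if j ≤ r - 1 then
        (4⁻¹ : ℚ) • wordOf (r - 1 - 1) (phi j j (phi j j (euler p))) else 0) := by
    split_ifs
    · rw [map_smul, w_wordOf, phi_euler, phi_euler, Nat.cast_sub (by omega), hr]
      push_cast
      module
    · simp
  have e4 : induced wB (if 2 ≤ j ∧ j ≤ r - 1 then
        (4⁻¹ : ℚ) • wordOf (r - 1 - 1) (phi j (j - 1) (phi j (j - 1) p)) else 0) =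
      (r - 2 : ℚ) • (if 2 ≤ j ∧ j ≤ r - 1 then
        (4⁻¹ : ℚ) • wordOf (r - 1 - 1) (phi j (j - 1) (phi j (j - 1) p)) else 0) +
      (if 2 ≤ j ∧ j ≤ r - 1 then
        (4⁻¹ : ℚ) • wordOf (r - 1 - 1) (phi j (j - 1) (phi j (j - 1) (euler p))) else 0) := by
    split_ifs
    · rw [map_smul, w_wordOf, phi_euler, phi_euler, Nat.cast_sub (by omega), hr]
      push_cast
      module
    · simp
  have e5 : (if 2 ≤ j then (2⁻¹ : ℚ) • wordOf (r - 1)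
        (phi j (j - 1) (euler (etaMinus r j p) + etaMinus r j p)) else 0) =
      (if 2 ≤ j then
        (2⁻¹ : ℚ) • wordOf (r - 1) (phi j (j - 1) (euler (etaMinus r j p))) else 0) +
      (if 2 ≤ j then
        (2⁻¹ : ℚ) • wordOf (r - 1) (phi j (j - 1) (etaMinus r j p)) else 0) := by
    split_ifs
    · rw [map_add, map_add, smul_add]
    · simp
  rw [e5, map_sub, map_add, map_sub, e2, e3, e4, map_neg, map_smul, w_wordOf, w_wordOf, hr,
    phi_euler]
  simp only [map_add]
  module

end Brackets

/-! ### Derivations of the stuffle product built from deconcatenation. -/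

section LocalOperators

open TensorProduct

theorem cons_mul_cons (a b : Letter) (x y : QA) :
    cons a x * cons b y = cons a (x * cons b y) + cons b (cons a x * y) + cons (a + b) (x * y) :=
  stuffle_cons_cons a b x y

/-- Deconcatenation of words. -/
def deconcWord : List Letter → QA ⊗[ℚ] QA
  | [] => 1 ⊗ₜ 1
  | a :: w => 1 ⊗ₜ word (a :: w) + (cons a).rTensor QA (deconcWord w)

/-- The deconcatenation coproduct. -/
def deconc : QA →ₗ[ℚ] QA ⊗[ℚ] QA := QA.lift deconcWord

theorem deconc_one : deconc 1 = 1 ⊗ₜ 1 := by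
  rw [one_def, deconc, lift_word, deconcWord, one_def]

theorem deconc_cons (a : Letter) (x : QA) :
    deconc (cons a x) = 1 ⊗ₜ cons a x + (cons a).rTensor QA (deconc x) := by
  have : deconc ∘ₗ cons a = TensorProduct.mk ℚ QA QA 1 ∘ₗ cons a +
      (cons a).rTensor QA ∘ₗ deconc := hom_ext fun w => by
    simp [deconc, deconcWord]
  exact LinearMap.congr_fun this x

theorem rTensor_cons_mul (a b : Letter) (s t : QA ⊗[ℚ] QA) :
    (cons a).rTensor QA s * (cons b).rTensor QA t =
      (cons a).rTensor QA (s * (cons b).rTensor QA t) +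
        (cons b).rTensor QA ((cons a).rTensor QA s * t) + (cons (a + b)).rTensor QA (s * t) := by
  induction s with
  | zero => simp
  | add s₁ s₂ h₁ h₂ => simp only [map_add, add_mul, h₁, h₂]; abel
  | tmul u₁ u₂ =>
    induction t with
    | zero => simp
    | add t₁ t₂ h₁ h₂ => simp only [map_add, mul_add, h₁, h₂]; abel
    | tmul v₁ v₂ =>
      simp only [LinearMap.rTensor_tmul, Algebra.TensorProduct.tmul_mul_tmul, cons_mul_cons,
        TensorProduct.add_tmul]

theorem one_tmul_mul_rTensor_cons (b : Letter) (x : QA) (t : QA ⊗[ℚ] QA) :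
    (1 ⊗ₜ x) * (cons b).rTensor QA t = (cons b).rTensor QA ((1 ⊗ₜ x) * t) := by
  induction t with
  | zero => simp
  | add t₁ t₂ h₁ h₂ => simp only [map_add, mul_add, h₁, h₂]
  | tmul v₁ v₂ =>
    simp only [LinearMap.rTensor_tmul, Algebra.TensorProduct.tmul_mul_tmul, one_mul]

theorem rTensor_cons_mul_one_tmul (b : Letter) (x : QA) (t : QA ⊗[ℚ] QA) :
    (cons b).rTensor QA t * (1 ⊗ₜ x) = (cons b).rTensor QA (t * (1 ⊗ₜ x)) := by
  rw [mul_comm, one_tmul_mul_rTensor_cons, mul_comm]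

/-- Cutting a term of the product cuts both factors, and the two pieces are terms of the products of
the corresponding pieces. In the recursion, the cut before the first letter is split off. -/
theorem deconc_mul_word (u v : List Letter) :
    deconc (word u * word v) = deconc (word u) * deconc (word v) := by
  induction u, v using stuffleWord.induct with
  | case1 v => rw [← one_def, one_mul, deconc_one, ← Algebra.TensorProduct.one_def, one_mul]
  | case2 a u => rw [← one_def, mul_one, deconc_one, ← Algebra.TensorProduct.one_def, mul_one]
  | case3 a u b v h₁ h₂ h₃ =>
    simp only [← cons_word] at h₁ h₂ h₃ ⊢
    rw [cons_mul_cons, map_add, map_add, deconc_cons, deconc_cons, deconc_cons, h₁, h₂, h₃,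
      deconc_cons, deconc_cons]
    simp only [add_mul, mul_add, map_add, rTensor_cons_mul, one_tmul_mul_rTensor_cons,
      rTensor_cons_mul_one_tmul, Algebra.TensorProduct.tmul_mul_tmul, one_mul, cons_mul_cons,
      TensorProduct.tmul_add]
    abel

theorem deconc_mul (x y : QA) : deconc (x * y) = deconc x * deconc y := by
  have h : (LinearMap.mul ℚ QA).compr₂ deconc =
      (LinearMap.mul ℚ (QA ⊗[ℚ] QA)).compl₁₂ deconc deconc :=
    hom_ext fun u => hom_ext fun v => by simpa using deconc_mul_word u v
  simpa using LinearMap.congr_fun₂ h x y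

/-- The constant term of an element of `ℚ⟨A⟩`. -/
def counit : QA →ₗ[ℚ] ℚ := QA.lift fun w => if w = [] then 1 else 0

theorem counit_one : counit 1 = 1 := by simp [one_def, counit]

@[simp] theorem counit_cons (a : Letter) (x : QA) : counit (cons a x) = 0 := by
  have : counit ∘ₗ cons a = 0 := hom_ext fun w => by simp [counit]
  exact LinearMap.congr_fun this x

/-- Linear combinations of letters. -/
abbrev Letters : Type := Letter →₀ ℚ

/-- Prepend a linear combination of letters. -/
def consL : Letters →ₗ[ℚ] QA →ₗ[ℚ] QA := Finsupp.linearCombination ℚ cons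

/-- Add a letter to all letters of a linear combination. -/
def shiftL (b : Letter) : Letters →ₗ[ℚ] Letters := Finsupp.lmapDomain ℚ ℚ (· + b)

theorem consL_single (a : Letter) (c : ℚ) : consL (Finsupp.single a c) = c • cons a := by
  simp [consL]

theorem shiftL_single (a b : Letter) (c : ℚ) :
    shiftL b (Finsupp.single a c) = Finsupp.single (a + b) c := by
  simp [shiftL]

theorem consL_mul_cons (p : Letters) (b : Letter) (x y : QA) :
    consL p x * cons b y =
      consL p (x * cons b y) + cons b (consL p x * y) + consL (shiftL b p) (x * y) := by
  induction p using Finsupp.induction_linear with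
  | zero => simp
  | add p q hp hq => simp only [map_add, LinearMap.add_apply, add_mul, hp, hq]; abel
  | single a c =>
    rw [shiftL_single, consL_single, consL_single]
    simp only [LinearMap.smul_apply, smul_mul_assoc, cons_mul_cons, map_smul, smul_add]

/-- `u ⊗ v` is sent to `θ(u) v`. -/
def act (θ : QA →ₗ[ℚ] Letters) : QA ⊗[ℚ] QA →ₗ[ℚ] QA := TensorProduct.lift (consL ∘ₗ θ)

@[simp] theorem act_tmul (θ : QA →ₗ[ℚ] Letters) (u v : QA) : act θ (u ⊗ₜ v) = consL (θ u) v := by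
  simp [act]

theorem act_zero : act 0 = 0 := by ext; simp

/-- The local operator `w ↦ ∑ u θ(v) z`, the sum over all factorizations `w = u v z`, `v ≠ 1`,
on words. -/
def localWord (θ : QA →ₗ[ℚ] Letters) : List Letter → QA
  | [] => 0
  | a :: w => cons a (localWord θ w) + act (θ ∘ₗ cons a) (deconc (word w))

/-- The local operator `w ↦ ∑ u θ(v) z`, the sum over all factorizations `w = u v z`, `v ≠ 1`. -/
def localOp (θ : QA →ₗ[ℚ] Letters) : QA →ₗ[ℚ] QA := QA.lift (localWord θ)

theorem localOp_one (θ : QA →ₗ[ℚ] Letters) : localOp θ 1 = 0 := by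
  simp [one_def, localOp, localWord]

theorem localOp_cons (θ : QA →ₗ[ℚ] Letters) (a : Letter) (x : QA) :
    localOp θ (cons a x) = cons a (localOp θ x) + act (θ ∘ₗ cons a) (deconc x) := by
  have : localOp θ ∘ₗ cons a = cons a ∘ₗ localOp θ + act (θ ∘ₗ cons a) ∘ₗ deconc :=
    hom_ext fun w => by simp [localOp, localWord]
  exact LinearMap.congr_fun this x

/-- The condition on `θ` under which the local operator is a derivation. -/
def IsLocalDerivation (θ : QA →ₗ[ℚ] Letters) : Prop :=
  ∀ a b x y, θ (cons a x * cons b y) =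
    counit y • shiftL b (θ (cons a x)) + counit x • shiftL a (θ (cons b y))

/-- `u ⊗ v` is sent to `χ(u) v`. -/
def evalLeft (χ : QA →ₗ[ℚ] ℚ) : QA ⊗[ℚ] QA →ₗ[ℚ] QA :=
  TensorProduct.lift ((LinearMap.lsmul ℚ QA : ℚ →ₗ[ℚ] QA →ₗ[ℚ] QA) ∘ₗ χ)

@[simp] theorem evalLeft_tmul (χ : QA →ₗ[ℚ] ℚ) (u v : QA) : evalLeft χ (u ⊗ₜ v) = χ u • v := by
  simp [evalLeft]

theorem evalLeft_counit_deconc (x : QA) : evalLeft counit (deconc x) = x := by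
  have : evalLeft counit ∘ₗ deconc = LinearMap.id := hom_ext fun w => by
    cases w with
    | nil => simp [← one_def, deconc_one, counit_one]
    | cons a w =>
      have h : evalLeft counit ∘ₗ (cons a).rTensor QA = 0 := by ext; simp
      have h' := LinearMap.congr_fun h (deconc (word w))
      simp only [LinearMap.comp_apply, LinearMap.zero_apply] at h'
      rw [← cons_word, LinearMap.comp_apply, deconc_cons, map_add, h', evalLeft_tmul, counit_one]
      simp
  exact LinearMap.congr_fun this x

/-- When a word starting with the new letter φ(u) is multiplied by one starting with b, the new
letter comes first, comes second, or is merged with b. The merged term is what `IsLocalDerivation`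
has to supply. -/
theorem act_mul_cons (φ : QA →ₗ[ℚ] Letters) (s : QA ⊗[ℚ] QA) (b : Letter) (y : QA) :
    act φ s * cons b y = act φ (s * (1 ⊗ₜ cons b y)) + cons b (act φ s * y) +
      act (shiftL b ∘ₗ φ) (s * (1 ⊗ₜ y)) := by
  induction s with
  | zero => simp
  | add s₁ s₂ h₁ h₂ => simp only [map_add, add_mul, h₁, h₂]; abel
  | tmul u v =>
    simp only [Algebra.TensorProduct.tmul_mul_tmul, act_tmul, mul_one, consL_mul_cons,
      LinearMap.comp_apply]

/-- The left side collects the windows at the front of the product that involve letters of both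
factors. By the hypothesis on θ such mixed windows cancel, except when one factor contributes
exactly one letter; there they give the merged terms on the right. -/
theorem act_quasi_shuffle {θ : QA →ₗ[ℚ] Letters} (hθ : IsLocalDerivation θ) (a b : Letter)
    (s t : QA ⊗[ℚ] QA) :
    act (θ ∘ₗ cons a) (s * (cons b).rTensor QA t) + act (θ ∘ₗ cons b) ((cons a).rTensor QA s * t) +
        act (θ ∘ₗ cons (a + b)) (s * t) =
      act (shiftL b ∘ₗ θ ∘ₗ cons a) (s * (1 ⊗ₜ evalLeft counit t)) +
        act (shiftL a ∘ₗ θ ∘ₗ cons b) (t * (1 ⊗ₜ evalLeft counit s)) := by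
  induction s with
  | zero => simp
  | add s₁ s₂ h₁ h₂ =>
    simp only [map_add, add_mul, TensorProduct.tmul_add, mul_add] at h₁ h₂ ⊢
    linear_combination (exp := 1) h₁ + h₂
  | tmul u₁ u₂ =>
    induction t with
    | zero => simp
    | add t₁ t₂ h₁ h₂ =>
      simp only [map_add, add_mul, TensorProduct.tmul_add, mul_add] at h₁ h₂ ⊢
      linear_combination (exp := 1) h₁ + h₂
    | tmul v₁ v₂ =>
      have h := congrArg (fun p => consL p (u₂ * v₂)) (hθ a b u₁ v₁)
      simp only [cons_mul_cons, map_add, LinearMap.add_apply, map_smul, LinearMap.smul_apply] at h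
      simp only [LinearMap.rTensor_tmul, Algebra.TensorProduct.tmul_mul_tmul, act_tmul,
        LinearMap.comp_apply, evalLeft_tmul, h, mul_one, mul_smul_comm, map_smul, mul_comm v₂ u₂]

/-- In the recursion of the stuffle product, windows that do not meet the front are covered by
induction. Those at the front are compared by `act_quasi_shuffle`, and its merged terms are those of
`act_mul_cons`. -/
theorem localOp_mul_word {θ : QA →ₗ[ℚ] Letters} (hθ : IsLocalDerivation θ) (u v : List Letter) :
    localOp θ (word u * word v) = localOp θ (word u) * word v + word u * localOp θ (word v) := by
  induction u, v using stuffleWord.induct with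
  | case1 v => rw [← one_def, one_mul, localOp_one, zero_mul, zero_add, one_mul]
  | case2 a u => rw [← one_def, mul_one, localOp_one, mul_zero, add_zero, mul_one]
  | case3 a u b v h₁ h₂ h₃ =>
    simp only [← cons_word] at h₁ h₂ h₃ ⊢
    generalize word u = x at *
    generalize word v = y at *
    have e := act_quasi_shuffle hθ a b (deconc x) (deconc y)
    rw [evalLeft_counit_deconc, evalLeft_counit_deconc] at e
    have e₁ := act_mul_cons (θ ∘ₗ cons a) (deconc x) b y
    have e₂ := act_mul_cons (θ ∘ₗ cons b) (deconc y) a x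
    rw [cons_mul_cons, map_add, map_add, localOp_cons, localOp_cons, localOp_cons, h₁, h₂, h₃,
      localOp_cons, localOp_cons, deconc_mul, deconc_mul, deconc_mul, deconc_cons, deconc_cons]
    simp only [add_mul, mul_add, map_add, cons_mul_cons, e₁]
    rw [mul_comm (cons a x) (act _ _), e₂, mul_comm x (act _ _), mul_comm (act _ _) y,
      mul_comm (1 ⊗ₜ cons a x) (deconc y)]
    rw [mul_comm (act _ _) x, mul_comm y (act _ _)]
    linear_combination (exp := 1) e

theorem localOp_mul {θ : QA →ₗ[ℚ] Letters} (hθ : IsLocalDerivation θ) (x y : QA) :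
    localOp θ (x * y) = localOp θ x * y + x * localOp θ y := by
  have h : (LinearMap.mul ℚ QA).compr₂ (localOp θ) =
      (LinearMap.mul ℚ QA).compl₁₂ (localOp θ) LinearMap.id +
        (LinearMap.mul ℚ QA).compl₁₂ LinearMap.id (localOp θ) :=
    hom_ext fun u => hom_ext fun v => by simpa using localOp_mul_word hθ u v
  simpa using LinearMap.congr_fun₂ h x y

/-- `u ⊗ v` is sent to `χ(v) u`. -/
def evalRight (χ : QA →ₗ[ℚ] ℚ) : QA ⊗[ℚ] QA →ₗ[ℚ] QA :=
  TensorProduct.lift ((LinearMap.lsmul ℚ QA : ℚ →ₗ[ℚ] QA →ₗ[ℚ] QA) ∘ₗ χ).flip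

@[simp] theorem evalRight_tmul (χ : QA →ₗ[ℚ] ℚ) (u v : QA) : evalRight χ (u ⊗ₜ v) = χ v • u := by
  simp [evalRight]

/-- The operator `w ↦ ∑ χ(v) u`, the sum over all factorizations `w = u v`. -/
def truncOp (χ : QA →ₗ[ℚ] ℚ) : QA →ₗ[ℚ] QA := evalRight χ ∘ₗ deconc

theorem truncOp_one (χ : QA →ₗ[ℚ] ℚ) : truncOp χ 1 = χ 1 • 1 := by
  simp [truncOp, deconc_one]

theorem truncOp_cons (χ : QA →ₗ[ℚ] ℚ) (a : Letter) (x : QA) :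
    truncOp χ (cons a x) = χ (cons a x) • 1 + cons a (truncOp χ x) := by
  have h : evalRight χ ∘ₗ (cons a).rTensor QA = cons a ∘ₗ evalRight χ := by ext; simp
  have h' := LinearMap.congr_fun h (deconc x)
  simp only [LinearMap.comp_apply] at h'
  rw [truncOp, LinearMap.comp_apply, deconc_cons, map_add, h', evalRight_tmul]
  rfl

theorem truncOp_counit (x : QA) : truncOp counit x = x := by
  have : truncOp counit = LinearMap.id := hom_ext fun w => by
    induction w with
    | nil => rw [← one_def, truncOp_one, counit_one, one_smul]; rfl
    | cons a w ih =>
      rw [← cons_word, truncOp_cons, ih, counit_cons, zero_smul, zero_add]; rfl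
  exact LinearMap.congr_fun this x

/-- Since deconcatenation is multiplicative, an infinitesimal character applied to the right tensor
factor gives a derivation, with `truncOp counit`, the identity, in the role of the evaluation. -/
theorem truncOp_mul {χ : QA →ₗ[ℚ] ℚ}
    (hχ : ∀ x y, χ (x * y) = χ x * counit y + counit x * χ y) (x y : QA) :
    truncOp χ (x * y) = truncOp χ x * y + x * truncOp χ y := by
  have key (s t : QA ⊗[ℚ] QA) : evalRight χ (s * t) =
      evalRight χ s * evalRight counit t + evalRight counit s * evalRight χ t := by
    induction s with
    | zero => simp
    | add s₁ s₂ h₁ h₂ => simp only [map_add, add_mul, h₁, h₂]; abel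
    | tmul u₁ u₂ =>
      induction t with
      | zero => simp
      | add t₁ t₂ h₁ h₂ => simp only [map_add, mul_add, h₁, h₂]; abel
      | tmul v₁ v₂ =>
        simp only [Algebra.TensorProduct.tmul_mul_tmul, evalRight_tmul, hχ, smul_mul_smul_comm,
          add_smul]
  have h := key (deconc x) (deconc y)
  rw [← deconc_mul] at h
  have hx := truncOp_counit x
  have hy := truncOp_counit y
  simp only [truncOp, LinearMap.comp_apply] at hx hy ⊢
  rw [h, hx, hy]

/-- Every word in the product is at least as long as each factor. This reduces the identities for θ,
the tail and the raising map to finitely many lengths. -/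
theorem map_stuffleWord_eq_zero {M : Type*} [AddCommGroup M] [Module ℚ M] (u v : List Letter)
    (φ : QA →ₗ[ℚ] M) (n : ℕ) (hφ : ∀ w : List Letter, n ≤ w.length → φ (word w) = 0)
    (h : n ≤ u.length ∨ n ≤ v.length) : φ (word u * word v) = 0 := by
  induction u, v using stuffleWord.induct generalizing φ n with
  | case1 v =>
    rw [← one_def, one_mul]
    exact hφ v (by simp only [List.length_nil] at h; omega)
  | case2 a u =>
    rw [← one_def, mul_one]
    exact hφ _ (by simp only [List.length_nil, List.length_cons] at h ⊢; omega)
  | case3 a u b v h₁ h₂ h₃ =>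
    have hc (c : Letter) (w : List Letter) (hw : n - 1 ≤ w.length) :
        (φ ∘ₗ cons c) (word w) = 0 := by
      rw [LinearMap.comp_apply, cons_word]
      exact hφ _ (by simp; omega)
    simp only [List.length_cons] at h
    have e₁ := h₁ (φ ∘ₗ cons a) (n - 1) (hc a) (by simp; omega)
    have e₂ := h₂ (φ ∘ₗ cons b) (n - 1) (hc b) (by simp; omega)
    have e₃ := h₃ (φ ∘ₗ cons (a + b)) (n - 1) (hc (a + b)) (by omega)
    simp only [← cons_word, LinearMap.comp_apply] at e₁ e₂ e₃ ⊢
    rw [cons_mul_cons, map_add, map_add, e₁, e₂, e₃]; simp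

end LocalOperators

/-! ### The window map of δ satisfies the derivation criterion. -/

section Theta

/-- The letter `[n + 1; d]`. -/
def lett (n d : ℕ) : Letter := (n.succPNat, d)

theorem exists_lett (a : Letter) : ∃ n d, a = lett n d :=
  ⟨a.1.natPred, a.2, by simp [lett]⟩

theorem lett_add_lett (n d m e : ℕ) : lett n d + lett m e = lett (n + m + 1) (d + e) := by
  refine Prod.ext (PNat.eq ?_) rfl
  simp only [lett, Prod.fst_add, PNat.add_coe, Nat.succPNat_coe]; omega

/-- The letter `[n + 1; d]` as a linear combination of letters. -/
def basisL (n d : ℕ) : Letters := Finsupp.single (lett n d) 1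

/-- The multiple `c [n + 1; d - 1]`. -/
def lowerL (c n d : ℕ) : Letters := (c : ℚ) • basisL n (d - 1)

theorem shiftL_basisL (n d m e : ℕ) :
    shiftL (lett m e) (basisL n d) = basisL (n + m + 1) (d + e) := by
  rw [basisL, shiftL_single, lett_add_lett, basisL]

/-- The bound c ≤ d protects the truncated d - 1: when d = 0 the coefficient vanishes as well. -/
theorem shiftL_lowerL {c d : ℕ} (h : c ≤ d) (n m e : ℕ) :
    shiftL (lett m e) (lowerL c n d) = lowerL c (n + m + 1) (d + e) := by
  rw [lowerL, map_smul, shiftL_basisL, lowerL]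
  rcases Nat.eq_zero_or_pos c with rfl | hc
  · simp
  · rw [show d - 1 + e = d + e - 1 by omega]

theorem lowerL_add (c c' n d : ℕ) : lowerL (c + c') n d = lowerL c n d + lowerL c' n d := by
  simp [lowerL, add_smul]

/-- The part of `δ` on a single letter `[n + 1; d]` that replaces it by a letter. -/
def theta₁ (n d : ℕ) : Letters := if 1 ≤ n then lowerL d (n - 1) d else 0

/-- The part of `δ` that replaces two adjacent letters `[n + 1, m + 1; d, e]` by one. -/
def theta₂ (n d m e : ℕ) : Letters :=
  (-(2⁻¹) : ℚ) • ((if n = 1 then basisL m (d + e) else 0)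
    - (if n = 0 ∧ 1 ≤ m then basisL (m - 1) (d + e) else 0)
    + (if n = 0 then lowerL d m (d + e) else 0)
    + (if m = 0 ∧ 1 ≤ n then basisL (n - 1) (d + e) else 0)
    - (if m = 1 then basisL n (d + e) else 0)
    + (if m = 0 then lowerL e n (d + e) else 0))

/-- The part of `δ` that replaces three adjacent letters `[n + 1, m + 1, k + 1; d, e, f]` by one. -/
def theta₃ (n d m e k f : ℕ) : Letters :=
  (4⁻¹ : ℚ) • ((if n = 0 ∧ m = 0 then basisL k (d + e + f) else 0)
    - (if m = 0 ∧ k = 0 then basisL n (d + e + f) else 0))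

/-- The part of `δ` that replaces a word by a linear combination of letters, on words. -/
def thetaWord : List Letter → Letters
  | [a] => theta₁ a.1.natPred a.2
  | [a, b] => theta₂ a.1.natPred a.2 b.1.natPred b.2
  | [a, b, c] => theta₃ a.1.natPred a.2 b.1.natPred b.2 c.1.natPred c.2
  | _ => 0

/-- The part of `δ` that replaces a word by a linear combination of letters. -/
def theta : QA →ₗ[ℚ] Letters := QA.lift thetaWord

theorem theta_long (w : List Letter) (h : 4 ≤ w.length) : theta (word w) = 0 := by
  match w with
  | a :: b :: c :: d :: w => simp [theta, thetaWord]

theorem theta_one (n d : ℕ) : theta (cons (lett n d) 1) = theta₁ n d := by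
  simp [one_def, theta, thetaWord, lett]

theorem theta_two (n d m e : ℕ) :
    theta (cons (lett n d) (cons (lett m e) 1)) = theta₂ n d m e := by
  simp [one_def, theta, thetaWord, lett]

theorem theta_three (n d m e k f : ℕ) :
    theta (cons (lett n d) (cons (lett m e) (cons (lett k f) 1))) = theta₃ n d m e k f := by
  simp [one_def, theta, thetaWord, lett]

theorem theta_four (a b c d : Letter) (x : QA) : theta (cons a (cons b (cons c (cons d x)))) = 0 := by
  have : theta ∘ₗ cons a ∘ₗ cons b ∘ₗ cons c ∘ₗ cons d = 0 := hom_ext fun w => by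
    simp [theta_long]
  exact LinearMap.congr_fun this x

/-- Two single letters: the coefficient d of the lowering part is additive under merging, and the
boundary cases where an index is 0 or 1 are repaired by `theta₂`. -/
theorem theta₁₁ (n d m e : ℕ) : theta₂ n d m e + theta₂ m e n d + theta₁ (n + m + 1) (d + e) =
    shiftL (lett m e) (theta₁ n d) + shiftL (lett n d) (theta₁ m e) := by
  unfold theta₁ theta₂
  rcases n with _ | _ | n <;> rcases m with _ | _ | m <;>
    simp [shiftL_lowerL, lowerL_add] <;> ring_nf <;> module

/-- One letter against two: only the merging of [n + 1; d] with the letter replacing the other two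
survives, and `theta₃` compensates the cases with an index 0. -/
theorem theta₁₂ (n d m e k f : ℕ) : theta₃ n d m e k f + (theta₃ m e n d k f + theta₃ m e k f n d
      + theta₂ m e (n + k + 1) (d + f)) + theta₂ (n + m + 1) (d + e) k f =
    shiftL (lett n d) (theta₂ m e k f) := by
  unfold theta₂ theta₃
  have h1 : e ≤ e + f := by omega
  have h2 : f ≤ e + f := by omega
  rcases n with _ | _ | n <;> rcases m with _ | _ | m <;> rcases k with _ | _ | k <;>
    simp [shiftL_lowerL, shiftL_basisL] <;> ring_nf <;> module

theorem theta₂₂ (n d m e k f l g : ℕ) :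
    theta (cons (lett n d) (cons (lett m e) 1) * cons (lett k f) (cons (lett l g) 1)) = 0 := by
  simp only [cons_mul_cons, one_mul, mul_one, map_add, lett_add_lett, theta_two, theta_three,
    theta_four]
  unfold theta₂ theta₃
  rcases n with _ | n <;> rcases m with _ | m <;> rcases k with _ | k <;> rcases l with _ | l <;>
    simp <;> ring_nf <;> module

theorem theta₁₃ (n d m e k f l g : ℕ) :
    theta (cons (lett n d) 1 * cons (lett m e) (cons (lett k f) (cons (lett l g) 1))) =
      shiftL (lett n d) (theta₃ m e k f l g) := by
  simp only [cons_mul_cons, one_mul, mul_one, map_add, lett_add_lett, theta_three, theta_four]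
  unfold theta₃
  rcases n with _ | n <;> rcases m with _ | m <;> rcases k with _ | k <;> rcases l with _ | l <;>
    simp [shiftL_basisL] <;> ring_nf <;> module

theorem theta₂₃ (n d m e k f l g j h : ℕ) :
    theta (cons (lett n d) (cons (lett m e) 1) *
      cons (lett k f) (cons (lett l g) (cons (lett j h) 1))) = 0 := by
  simp only [cons_mul_cons, one_mul, mul_one, map_add, lett_add_lett, theta_three, theta_four]
  simp [theta₃]

theorem theta₃₃ (n d m e k f l g j h i c : ℕ) :
    theta (cons (lett n d) (cons (lett m e) (cons (lett i c) 1)) *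
      cons (lett k f) (cons (lett l g) (cons (lett j h) 1))) = 0 := by
  simp only [cons_mul_cons, one_mul, mul_one, map_add, lett_add_lett, theta_three, theta_four]
  simp [theta₃]

theorem counit_word_cons (a : Letter) (w : List Letter) : counit (word (a :: w)) = 0 := by
  rw [← cons_word, counit_cons]

/-- The condition is symmetric in the two factors, so the second may be taken to be the longer one.
Since θ vanishes on words of four or more letters, six pairs of lengths remain. -/
theorem theta_isLocalDerivation : IsLocalDerivation theta := by
  have main (a b : Letter) (u v : List Letter) (huv : u.length ≤ v.length) :
      theta (cons a (word u) * cons b (word v)) =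
        counit (word v) • shiftL b (theta (cons a (word u))) +
          counit (word u) • shiftL a (theta (cons b (word v))) := by
    by_cases hv : 3 ≤ v.length
    · have h1 : theta (cons b (word v)) = 0 := by rw [cons_word]; exact theta_long _ (by simpa)
      have h2 : counit (word v) = 0 := by
        cases v with
        | nil => simp at hv
        | cons c v => exact counit_word_cons c v
      rw [h1, h2, cons_word, cons_word,
        map_stuffleWord_eq_zero _ _ theta 4 theta_long (Or.inr (by simpa))]
      simp
    · obtain ⟨n, d, rfl⟩ := exists_lett a
      obtain ⟨m, e, rfl⟩ := exists_lett b
      have hone : word [] = 1 := rfl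
      match u, v, huv, hv with
      | [], [], _, _ =>
        rw [hone, counit_one, one_smul, one_smul, theta_one, theta_one, ← theta₁₁]
        simp only [cons_mul_cons, one_mul, mul_one, map_add, lett_add_lett, theta_two, theta_one]
      | [], [c], _, _ =>
        obtain ⟨k, f, rfl⟩ := exists_lett c
        rw [← cons_word, hone, counit_one, one_smul, counit_cons, zero_smul, zero_add, theta_two,
          ← theta₁₂]
        simp only [cons_mul_cons, one_mul, mul_one, map_add, lett_add_lett, theta_two, theta_three]
      | [], [c, c'], _, _ =>
        obtain ⟨k, f, rfl⟩ := exists_lett c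
        obtain ⟨l, g, rfl⟩ := exists_lett c'
        rw [← cons_word, ← cons_word, hone, counit_one, one_smul, counit_cons, zero_smul, zero_add,
          theta_three, theta₁₃]
      | [x], [c], _, _ =>
        obtain ⟨k, f, rfl⟩ := exists_lett c
        obtain ⟨i, h, rfl⟩ := exists_lett x
        rw [← cons_word, ← cons_word, hone, counit_cons, counit_cons, theta₂₂]
        simp
      | [x], [c, c'], _, _ =>
        obtain ⟨k, f, rfl⟩ := exists_lett c
        obtain ⟨l, g, rfl⟩ := exists_lett c'
        obtain ⟨i, h, rfl⟩ := exists_lett x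
        rw [← cons_word, ← cons_word, ← cons_word, hone, counit_cons, counit_cons, theta₂₃]
        simp
      | [x, x'], [c, c'], _, _ =>
        obtain ⟨k, f, rfl⟩ := exists_lett c
        obtain ⟨l, g, rfl⟩ := exists_lett c'
        obtain ⟨i, h, rfl⟩ := exists_lett x
        obtain ⟨i', h', rfl⟩ := exists_lett x'
        rw [← cons_word, ← cons_word, ← cons_word, ← cons_word, hone, counit_cons, counit_cons,
          theta₃₃]
        simp
      | _, c :: c' :: c'' :: v, _, hv => simp at hv
      | x :: x' :: x'' :: u, [c, c'], huv, _ => simp at huv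
      | x :: x' :: u, [c], huv, _ => simp at huv
      | x :: u, [], huv, _ => simp at huv
  intro a b x y
  have h : ((LinearMap.mul ℚ QA).compl₁₂ (cons a) (cons b)).compr₂ theta =
      (LinearMap.lsmul ℚ Letters ∘ₗ counit).flip ∘ₗ shiftL b ∘ₗ theta ∘ₗ cons a +
        (LinearMap.lsmul ℚ Letters ∘ₗ counit).compl₂ (shiftL a ∘ₗ theta ∘ₗ cons b) :=
    hom_ext fun u => hom_ext fun v => by
      simp only [LinearMap.compr₂_apply, LinearMap.mul_apply', LinearMap.compl₁₂_apply,
        LinearMap.add_apply, LinearMap.comp_apply, LinearMap.flip_apply, LinearMap.lsmul_apply,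
        LinearMap.compl₂_apply]
      rcases le_total u.length v.length with h | h
      · exact main a b u v h
      · rw [mul_comm, main b a v u h, add_comm]
  simpa using LinearMap.congr_fun₂ h x y

end Theta

/-! ### The suffix map of δ, the window map of D, and words as monomials. -/

section Words

/-- The part of `δ` that drops a word, on words. -/
def tailWord : List Letter → ℚ
  | [a] => -2⁻¹ * ((if a = lett 1 0 then 1 else 0) + (if a = lett 0 1 then 1 else 0))
  | [a, b] => if a = lett 0 0 ∧ b = lett 0 0 then 4⁻¹ else 0
  | _ => 0

/-- The part of `δ` that drops a word. -/
def tail : QA →ₗ[ℚ] ℚ := QA.lift tailWord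

theorem lett_inj {n d m e : ℕ} : lett n d = lett m e ↔ n = m ∧ d = e := by
  simp [lett, Prod.ext_iff, Nat.succPNat_inj]

theorem tail_one : tail 1 = 0 := by simp [one_def, tail, tailWord]

theorem tail_cons_one (n d : ℕ) : tail (cons (lett n d) 1) =
    -2⁻¹ * ((if n = 1 ∧ d = 0 then 1 else 0) + (if n = 0 ∧ d = 1 then 1 else 0)) := by
  simp [one_def, tail, tailWord, lett_inj]

theorem tail_cons_cons_one (n d m e : ℕ) : tail (cons (lett n d) (cons (lett m e) 1)) =
    if (n = 0 ∧ d = 0) ∧ (m = 0 ∧ e = 0) then 4⁻¹ else 0 := by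
  simp [one_def, tail, tailWord, lett_inj]

theorem tail_long (w : List Letter) (h : 3 ≤ w.length) : tail (word w) = 0 := by
  match w with
  | a :: b :: c :: w => simp [tail, tailWord]

theorem tail_three (a b c : Letter) (x : QA) : tail (cons a (cons b (cons c x))) = 0 := by
  have : tail ∘ₗ cons a ∘ₗ cons b ∘ₗ cons c = 0 := hom_ext fun w => by simp [tail_long]
  exact LinearMap.congr_fun this x

theorem tail_cons_mul_cons (a b : Letter) (u v : List Letter) (huv : u.length ≤ v.length) :
    tail (cons a (word u) * cons b (word v)) = 0 := by
  by_cases hv : 2 ≤ v.length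
  · rw [cons_word, cons_word]
    exact map_stuffleWord_eq_zero _ _ tail 3 tail_long (Or.inr (by simpa))
  · obtain ⟨n, d, rfl⟩ := exists_lett a
    obtain ⟨m, e, rfl⟩ := exists_lett b
    have hone : word [] = 1 := rfl
    match u, v, huv, hv with
    | [], [], _, _ =>
      simp only [hone, cons_mul_cons, one_mul, mul_one, map_add, lett_add_lett, tail_cons_one,
        tail_cons_cons_one]
      split_ifs <;> first | omega | tauto | norm_num
    | [], [c], _, _ =>
      obtain ⟨k, f, rfl⟩ := exists_lett c
      rw [← cons_word]
      simp only [hone, cons_mul_cons, one_mul, mul_one, map_add, lett_add_lett, tail_three,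
        tail_cons_cons_one]
      split_ifs <;> first | omega | tauto | norm_num
    | [x], [c], _, _ =>
      obtain ⟨k, f, rfl⟩ := exists_lett c
      obtain ⟨i, h, rfl⟩ := exists_lett x
      rw [← cons_word, ← cons_word]
      simp only [hone, cons_mul_cons, one_mul, mul_one, map_add, lett_add_lett, tail_three,
        tail_cons_cons_one]
      split_ifs <;> first | omega | tauto | norm_num
    | _, c :: c' :: v, _, hv => simp at hv
    | x :: x' :: u, [c], huv, _ => simp at huv
    | x :: u, [], huv, _ => simp at huv

/-- The decisive product is [1; 0] with itself, equal to 2 [1, 1; 0, 0] + [2; 0], whose value is 2/4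
- 1/2 = 0. The letter [1; 1] is never a sum of two letters, so its coefficient is unconstrained. -/
theorem tail_mul (x y : QA) : tail (x * y) = tail x * counit y + counit x * tail y := by
  have h : (LinearMap.mul ℚ QA).compr₂ tail =
      (LinearMap.mul ℚ ℚ).compl₁₂ tail counit + (LinearMap.mul ℚ ℚ).compl₁₂ counit tail :=
    hom_ext fun u => hom_ext fun v => by
      simp only [LinearMap.compr₂_apply, LinearMap.mul_apply', LinearMap.compl₁₂_apply,
        LinearMap.add_apply]
      cases u with
      | nil => rw [← one_def, one_mul, counit_one, tail_one]; ring
      | cons a u =>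
        cases v with
        | nil => rw [← one_def, mul_one, counit_one, tail_one]; ring
        | cons b v =>
          simp only [← cons_word, counit_cons, zero_mul, mul_zero, add_zero]
          rcases le_total u.length v.length with h | h
          · exact tail_cons_mul_cons a b u v h
          · rw [mul_comm]; exact tail_cons_mul_cons b a v u h
  simpa using LinearMap.congr_fun₂ h x y

/-- The part of `D` that replaces a word by a linear combination of letters, on words. -/
def raiseWord : List Letter → Letters
  | [a] => ((a.1.natPred : ℚ) + 1) • basisL (a.1.natPred + 1) (a.2 + 1)
  | _ => 0

/-- The part of `D` that replaces a word by a linear combination of letters. -/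
def raise : QA →ₗ[ℚ] Letters := QA.lift raiseWord

theorem raise_one (n d : ℕ) :
    raise (cons (lett n d) 1) = ((n : ℚ) + 1) • basisL (n + 1) (d + 1) := by
  simp [one_def, raise, raiseWord, lett]

theorem raise_long (w : List Letter) (h : 2 ≤ w.length) : raise (word w) = 0 := by
  match w with
  | a :: b :: w => simp [raise, raiseWord]

theorem raise_two (a b : Letter) (x : QA) : raise (cons a (cons b x)) = 0 := by
  have : raise ∘ₗ cons a ∘ₗ cons b = 0 := hom_ext fun w => by simp [raise_long]
  exact LinearMap.congr_fun this x

/-- The map sends [k; d] to k [k + 1; d + 1], and the coefficient k is additive when letters are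
merged. -/
theorem raise_isLocalDerivation : IsLocalDerivation raise := by
  have main (a b : Letter) (u v : List Letter) (huv : u.length ≤ v.length) :
      raise (cons a (word u) * cons b (word v)) =
        counit (word v) • shiftL b (raise (cons a (word u))) +
          counit (word u) • shiftL a (raise (cons b (word v))) := by
    cases v with
    | nil =>
      obtain rfl : u = [] := by simpa using huv
      obtain ⟨n, d, rfl⟩ := exists_lett a
      obtain ⟨m, e, rfl⟩ := exists_lett b
      have hone : word [] = 1 := rfl
      simp only [hone, cons_mul_cons, one_mul, mul_one, map_add, lett_add_lett, raise_one,
        raise_two, counit_one, map_smul, shiftL_basisL]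
      rw [show n + 1 + m + 1 = n + m + 1 + 1 by omega, show m + 1 + n + 1 = n + m + 1 + 1 by omega,
        show d + 1 + e = d + e + 1 by omega, show e + 1 + d = d + e + 1 by omega]
      push_cast
      module
    | cons c v =>
      rw [cons_word, cons_word,
        map_stuffleWord_eq_zero _ _ raise 2 raise_long (Or.inr (by simp)), counit_word_cons,
        raise_long (b :: c :: v) (by simp)]
      simp
  intro a b x y
  have h : ((LinearMap.mul ℚ QA).compl₁₂ (cons a) (cons b)).compr₂ raise =
      (LinearMap.lsmul ℚ Letters ∘ₗ counit).flip ∘ₗ shiftL b ∘ₗ raise ∘ₗ cons a +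
        (LinearMap.lsmul ℚ Letters ∘ₗ counit).compl₂ (shiftL a ∘ₗ raise ∘ₗ cons b) :=
    hom_ext fun u => hom_ext fun v => by
      simp only [LinearMap.compr₂_apply, LinearMap.mul_apply', LinearMap.compl₁₂_apply,
        LinearMap.add_apply, LinearMap.comp_apply, LinearMap.flip_apply, LinearMap.lsmul_apply,
        LinearMap.compl₂_apply]
      rcases le_total u.length v.length with h | h
      · exact main a b u v h
      · rw [mul_comm, main b a v u h, add_comm]
  simpa using LinearMap.congr_fun₂ h x y

/-- Increase the indices of all variables by one. -/
def shiftP : Poly →ₐ[ℚ] Poly :=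
  subs (fun i => if i = 0 then 0 else px (i + 1)) (fun i => if i = 0 then 0 else py (i + 1))

theorem shiftP_px (i : ℕ) : shiftP (px i) = if i = 0 then 0 else px (i + 1) := by simp [shiftP]

theorem shiftP_py (i : ℕ) : shiftP (py i) = if i = 0 then 0 else py (i + 1) := by simp [shiftP]

/-- The monomial `x₁ ^ n / n! * y₁ ^ d`. -/
def mon (n d : ℕ) : Poly := MvPolynomial.C ((n.factorial : ℚ)⁻¹) * px 1 ^ n * py 1 ^ d

theorem res_shiftP (r : ℕ) (p : Poly) : res (r + 1) (shiftP p) =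
    MvPolynomial.rename (Sum.map Fin.succ Fin.succ) (res r p) := by
  have : (res (r + 1)).comp shiftP =
      (MvPolynomial.rename (Sum.map Fin.succ Fin.succ)).comp (res r) := by
    refine algHom_ext_xy (fun i => ?_) (fun i => ?_)
    · simp only [AlgHom.comp_apply, shiftP_px]
      by_cases h : 1 ≤ i ∧ i ≤ r
      · obtain ⟨i, rfl⟩ : ∃ k : Fin r, i = k + 1 := ⟨⟨i - 1, by omega⟩, by simp; omega⟩
        rw [res_px_succ, if_neg (by omega), MvPolynomial.rename_X]
        exact res_px_succ i.succ
      · rw [res_px_eq_zero h, map_zero]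
        split_ifs
        · simp
        · exact res_px_eq_zero (by omega)
    · simp only [AlgHom.comp_apply, shiftP_py]
      by_cases h : 1 ≤ i ∧ i ≤ r
      · obtain ⟨i, rfl⟩ : ∃ k : Fin r, i = k + 1 := ⟨⟨i - 1, by omega⟩, by simp; omega⟩
        rw [res_py_succ, if_neg (by omega), MvPolynomial.rename_X]
        exact res_py_succ i.succ
      · rw [res_py_eq_zero h, map_zero]
        split_ifs
        · simp
        · exact res_py_eq_zero (by omega)
  exact DFunLike.congr_fun this p

theorem pair_genSeries_monomial (r : ℕ) (e : Fin r ⊕ Fin r →₀ ℕ) (c : ℚ) :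
    pair (genSeries r) (MvPolynomial.monomial e c) =
      (c * ∏ i : Fin r, ((e (Sum.inl i)).factorial : ℚ)) •
        word (List.ofFn fun i : Fin r => lett (e (Sum.inl i)) (e (Sum.inr i))) := by
  have h : MvPowerSeries.coeff e (genSeries r) = (∏ i : Fin r, ((e (Sum.inr i)).factorial : ℚ))⁻¹ •
      word (List.ofFn fun i : Fin r => ((e (Sum.inl i)).succPNat, e (Sum.inr i))) := rfl
  rw [pair_monomial, h, Fintype.prod_sum_type, smul_smul, smul_smul]
  have hne : (∏ i : Fin r, ((e (Sum.inr i)).factorial : ℚ)) ≠ 0 :=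
    Finset.prod_ne_zero_iff.2 fun i _ => by positivity
  congr 1
  field_simp

/-- Prepending a letter is multiplication by its monomial in x_1, y_1 after renumbering the other
variables. It is the bridge from polynomials to recursions on words. -/
theorem wordOf_mon_mul_shiftP (r n d : ℕ) (p : Poly) :
    wordOf (r + 1) (mon n d * shiftP p) = cons (lett n d) (wordOf r p) := by
  have h0 : res (r + 1) (mon n d) = MvPolynomial.monomial
      (Finsupp.single (Sum.inl 0) n + Finsupp.single (Sum.inr 0) d) ((n.factorial : ℚ)⁻¹) := by
    have h1 : res (r + 1) (px 1) = MvPolynomial.X (Sum.inl 0) := res_px_succ (r := r + 1) 0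
    have h2 : res (r + 1) (py 1) = MvPolynomial.X (Sum.inr 0) := res_py_succ (r := r + 1) 0
    have h3 (c : ℚ) : res (r + 1) (MvPolynomial.C c) = MvPolynomial.C c := (res (r + 1)).commutes c
    rw [mon, map_mul, map_mul, map_pow, map_pow, h1, h2, h3, MvPolynomial.X_pow_eq_monomial,
      MvPolynomial.X_pow_eq_monomial, MvPolynomial.C_mul_monomial, MvPolynomial.monomial_mul]
    simp
  rw [wordOf, pairing_apply, wordOf, pairing_apply, map_mul, h0, res_shiftP]
  generalize res r p = q
  induction q using MvPolynomial.induction_on' with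
  | add p q hp hq => simp only [map_add, mul_add, hp, hq]
  | monomial e c =>
    have hinj : Function.Injective (Sum.map (Fin.succ (n := r)) (Fin.succ (n := r))) :=
      (Fin.succ_injective r).sumMap (Fin.succ_injective r)
    rw [MvPolynomial.rename_monomial, MvPolynomial.monomial_mul, pair_genSeries_monomial,
      pair_genSeries_monomial, map_smul, cons_word, List.ofFn_succ, Fin.prod_univ_succ]
    have i0 : (Finsupp.mapDomain (Sum.map Fin.succ Fin.succ) e : Fin (r + 1) ⊕ Fin (r + 1) →₀ ℕ)
        (Sum.inl 0) = 0 := Finsupp.mapDomain_of_notMem_range _ _ (by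
          rintro ⟨x | x, hx⟩ <;> simp at hx)
    have j0 : (Finsupp.mapDomain (Sum.map Fin.succ Fin.succ) e : Fin (r + 1) ⊕ Fin (r + 1) →₀ ℕ)
        (Sum.inr 0) = 0 := Finsupp.mapDomain_of_notMem_range _ _ (by
          rintro ⟨x | x, hx⟩ <;> simp at hx)
    have i1 (i : Fin r) : (Finsupp.mapDomain (Sum.map Fin.succ Fin.succ) e :
        Fin (r + 1) ⊕ Fin (r + 1) →₀ ℕ) (Sum.inl i.succ) = e (Sum.inl i) :=
      Finsupp.mapDomain_apply hinj e (Sum.inl i)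
    have j1 (i : Fin r) : (Finsupp.mapDomain (Sum.map Fin.succ Fin.succ) e :
        Fin (r + 1) ⊕ Fin (r + 1) →₀ ℕ) (Sum.inr i.succ) = e (Sum.inr i) :=
      Finsupp.mapDomain_apply hinj e (Sum.inr i)
    simp only [Finsupp.add_apply, i0, j0, i1, j1]
    have hn : (n.factorial : ℚ) ≠ 0 := by positivity
    simp only [Finsupp.single_eq_same, ne_eq, reduceCtorEq, not_false_eq_true,
      Finsupp.single_eq_of_ne, Sum.inl.injEq, Sum.inr.injEq, Fin.succ_ne_zero, add_zero, zero_add]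
    congr 1
    field_simp

/-- The polynomial representing a word. -/
def mono : List Letter → Poly
  | [] => 1
  | a :: w => mon a.1.natPred a.2 * shiftP (mono w)

theorem mono_cons (n d : ℕ) (w : List Letter) :
    mono (lett n d :: w) = mon n d * shiftP (mono w) := by simp [mono, lett]

theorem wordOf_zero_one : wordOf 0 1 = 1 := by
  have h := pair_genSeries_monomial 0 0 1
  rw [wordOf, pairing_apply, map_one, one_def]
  simpa using h

theorem wordOf_mono (w : List Letter) : wordOf w.length (mono w) = word w := by
  induction w with
  | nil => exact wordOf_zero_one
  | cons a w ih =>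
    obtain ⟨n, d, rfl⟩ := exists_lett a
    rw [mono_cons, List.length_cons, wordOf_mon_mul_shiftP, ih, cons_word]

end Words

/-! ### The recursion of δ in the first letter. -/

section DeltaRecursion

theorem derivation_C (d : Derivation ℚ Poly Poly) (c : ℚ) : d (MvPolynomial.C c) = 0 :=
  MvPolynomial.derivation_C d c

theorem dx_mon_of_ne {r j : ℕ} (hj : j ≠ 1) (n d : ℕ) : dx r j (mon n d) = 0 := by
  rw [mon, Derivation.leibniz, Derivation.leibniz, Derivation.leibniz_pow, Derivation.leibniz_pow,
    derivation_C, dx_px, dx_py, if_neg (by omega)]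
  simp

theorem dy_mon_of_ne {r j : ℕ} (hj : j ≠ 1) (n d : ℕ) : dy r j (mon n d) = 0 := by
  rw [mon, Derivation.leibniz, Derivation.leibniz, Derivation.leibniz_pow, Derivation.leibniz_pow,
    derivation_C, dy_px, dy_py, if_neg (by omega)]
  simp

theorem dx_mon_zero (r d : ℕ) : dx r 1 (mon 0 d) = 0 := by
  simp [mon, Derivation.leibniz_pow, dx_py]

theorem dx_mon_succ {r : ℕ} (hr : 1 ≤ r) (n d : ℕ) : dx r 1 (mon (n + 1) d) = mon n d := by
  rw [mon, Derivation.leibniz, Derivation.leibniz, Derivation.leibniz_pow, Derivation.leibniz_pow,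
    derivation_C, dx_px, dx_py, mon]
  have hc : MvPolynomial.C (((n + 1).factorial : ℚ)⁻¹) * ((n : Poly) + 1) =
      (MvPolynomial.C ((n.factorial : ℚ)⁻¹) : Poly) := by
    have : ((n : Poly) + 1) = MvPolynomial.C ((n : ℚ) + 1) := by simp
    rw [this, ← map_mul]
    congr 1
    rw [Nat.factorial_succ]
    push_cast
    field_simp
  simp only [hr, le_refl, and_self, if_true, smul_eq_mul, nsmul_eq_mul, mul_zero, zero_add,
    add_zero, mul_one, Nat.add_sub_cancel]
  push_cast
  linear_combination (px 1 ^ n * py 1 ^ d) * hc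

theorem dy_mon {r : ℕ} (hr : 1 ≤ r) (n d : ℕ) : dy r 1 (mon n d) = (d : ℚ) • mon n (d - 1) := by
  rw [mon, Derivation.leibniz, Derivation.leibniz, Derivation.leibniz_pow, Derivation.leibniz_pow,
    derivation_C, dy_px, dy_py, mon, Nat.cast_smul_eq_nsmul]
  simp only [hr, le_refl, and_self, if_true, smul_eq_mul, nsmul_eq_mul, mul_zero,
    add_zero, mul_one]
  ring

theorem dx_shiftP (r j : ℕ) (p : Poly) : dx (r + 1) (j + 1) (shiftP p) = shiftP (dx r j p) := by
  refine derivation_comp_algHom_xy shiftP _ _ (fun i => ?_) (fun i => ?_) p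
  · rw [shiftP_px, dx_px]
    split_ifs with h1 h2 h2
    · omega
    · simp
    · rw [dx_px, if_pos (by omega), map_one]
    · rw [dx_px, map_zero, if_neg (by omega)]
  · rw [shiftP_py, dx_py, map_zero]
    split_ifs
    · simp
    · rw [dx_py]

theorem dy_shiftP (r j : ℕ) (p : Poly) : dy (r + 1) (j + 1) (shiftP p) = shiftP (dy r j p) := by
  refine derivation_comp_algHom_xy shiftP _ _ (fun i => ?_) (fun i => ?_) p
  · rw [shiftP_px, dy_px, map_zero]
    split_ifs
    · simp
    · rw [dy_px]
  · rw [shiftP_py, dy_py]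
    split_ifs with h1 h2 h2
    · omega
    · simp
    · rw [dy_py, if_pos (by omega), map_one]
    · rw [dy_py, map_zero, if_neg (by omega)]

theorem dx_out (r : ℕ) : dx r 0 = 0 := by rw [dx, if_neg (by omega)]

theorem dy_out (r : ℕ) : dy r 0 = 0 := by rw [dy, if_neg (by omega)]

theorem dx_mon_mul_shiftP {r j : ℕ} (hj : 1 ≤ j) (n d : ℕ) (p : Poly) :
    dx (r + 1) (j + 1) (mon n d * shiftP p) = mon n d * shiftP (dx r j p) := by
  rw [Derivation.leibniz, dx_mon_of_ne (by omega), dx_shiftP]; simp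

theorem dy_mon_mul_shiftP {r j : ℕ} (hj : 1 ≤ j) (n d : ℕ) (p : Poly) :
    dy (r + 1) (j + 1) (mon n d * shiftP p) = mon n d * shiftP (dy r j p) := by
  rw [Derivation.leibniz, dy_mon_of_ne (by omega), dy_shiftP]; simp

theorem dx_one_mon_mul_shiftP (r n d : ℕ) (p : Poly) :
    dx (r + 1) 1 (mon n d * shiftP p) = dx (r + 1) 1 (mon n d) * shiftP p := by
  have h := dx_shiftP r 0 p
  rw [dx_out] at h
  rw [Derivation.leibniz, h]; simp [mul_comm]

theorem dy_one_mon_mul_shiftP (r n d : ℕ) (p : Poly) :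
    dy (r + 1) 1 (mon n d * shiftP p) = dy (r + 1) 1 (mon n d) * shiftP p := by
  have h := dy_shiftP r 0 p
  rw [dy_out] at h
  rw [Derivation.leibniz, h]; simp [mul_comm]

theorem eta_mon_mul_shiftP {r j : ℕ} (hj : 1 ≤ j) (n d : ℕ) (p : Poly) :
    eta (r + 1) (j + 1) (mon n d * shiftP p) = mon n d * shiftP (eta r j p) := by
  simp only [eta, Derivation.add_apply, Derivation.sub_apply]
  rw [dx_mon_mul_shiftP hj, dx_mon_mul_shiftP (by omega), dy_mon_mul_shiftP hj, map_add, map_sub]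
  ring

theorem etaMinus_mon_mul_shiftP {r j : ℕ} (hj : 2 ≤ j) (n d : ℕ) (p : Poly) :
    etaMinus (r + 1) (j + 1) (mon n d * shiftP p) = mon n d * shiftP (etaMinus r j p) := by
  simp only [etaMinus, Derivation.add_apply, Derivation.sub_apply]
  obtain ⟨j, rfl⟩ : ∃ k, j = k + 1 := ⟨j - 1, by omega⟩
  simp only [Nat.add_sub_cancel]
  rw [dx_mon_mul_shiftP (by omega), dx_mon_mul_shiftP (by omega), dy_mon_mul_shiftP (by omega),
    map_add, map_sub]
  ring

theorem phi_mon {j c : ℕ} (hj : 1 ≤ j) (n d : ℕ) :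
    phi (j + 1) (c + 1) (mon n d) = mon n d := by
  have h (q : ℚ) : phi (j + 1) (c + 1) (MvPolynomial.C q) = MvPolynomial.C q :=
    (phi (j + 1) (c + 1)).commutes q
  rw [mon, map_mul, map_mul, map_pow, map_pow, h, phi_px, phi_py, if_pos (by omega),
    if_pos (by omega)]

theorem phi_shiftP {j c : ℕ} (hj : 1 ≤ j) (hc : 1 ≤ c) (p : Poly) :
    phi (j + 1) (c + 1) (shiftP p) = shiftP (phi j c p) := by
  have : (phi (j + 1) (c + 1)).comp shiftP = shiftP.comp (phi j c) := by
    refine algHom_ext_xy (fun i => ?_) (fun i => ?_)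
    · simp only [AlgHom.comp_apply, shiftP_px, phi_px]
      by_cases h0 : i = 0
      · rw [if_pos h0, if_pos (by omega), shiftP_px, if_pos h0, map_zero]
      · rw [if_neg h0, phi_px]
        rcases lt_trichotomy i j with h | h | h
        · rw [if_pos (by omega), if_pos h, shiftP_px, if_neg h0]
        · rw [if_neg (by omega), if_pos (by omega), if_neg (by omega), if_pos h, map_zero]
        · rw [if_neg (by omega), if_neg (by omega), if_neg (by omega), if_neg (by omega), shiftP_px,
            if_neg (by omega), show i - 1 + 1 = i + 1 - 1 by omega]
    · simp only [AlgHom.comp_apply, shiftP_py, phi_py]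
      by_cases h0 : i = 0
      · rw [if_pos h0, if_pos (by omega), shiftP_py, if_pos h0, map_zero]
      · rw [if_neg h0, phi_py]
        by_cases h : i ≤ c
        · rw [if_pos (by omega), if_pos h, shiftP_py, if_neg h0]
        · rw [if_neg (by omega), if_neg h, shiftP_py, if_neg (by omega),
            show i - 1 + 1 = i + 1 - 1 by omega]
  exact DFunLike.congr_fun this p

theorem phi_mon_mul_shiftP {j c : ℕ} (hj : 1 ≤ j) (hc : 1 ≤ c) (n d : ℕ) (p : Poly) :
    phi (j + 1) (c + 1) (mon n d * shiftP p) = mon n d * shiftP (phi j c p) := by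
  rw [map_mul, phi_mon hj, phi_shiftP hj hc]

theorem phi_one_one_mon (n d : ℕ) : phi 1 1 (mon n d) = if n = 0 then py 1 ^ d else 0 := by
  have h (q : ℚ) : phi 1 1 (MvPolynomial.C q) = MvPolynomial.C q := (phi 1 1).commutes q
  rw [mon, map_mul, map_mul, map_pow, map_pow, h, phi_px, phi_py]
  by_cases hn : n = 0
  · simp [hn]
  · simp [hn]

theorem res_phi_one_one_shiftP (r : ℕ) (p : Poly) : res r (phi 1 1 (shiftP p)) = res r p := by
  have : (res r).comp ((phi 1 1).comp shiftP) = res r := by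
    refine algHom_ext_xy (fun i => ?_) (fun i => ?_)
    · simp only [AlgHom.comp_apply, shiftP_px]
      by_cases h0 : i = 0
      · rw [if_pos h0, map_zero, map_zero, res_px_eq_zero (by omega)]
      · rw [if_neg h0, phi_px, if_neg (by omega), if_neg (by omega), Nat.add_sub_cancel]
    · simp only [AlgHom.comp_apply, shiftP_py]
      by_cases h0 : i = 0
      · rw [if_pos h0, map_zero, map_zero, res_py_eq_zero (by omega)]
      · rw [if_neg h0, phi_py, if_neg (by omega), Nat.add_sub_cancel]
  exact DFunLike.congr_fun this p

theorem phi_two_one_shiftP_shiftP (p : Poly) : phi 2 1 (shiftP (shiftP p)) = shiftP p := by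
  have : ((phi 2 1).comp (shiftP.comp shiftP)) = shiftP := by
    refine algHom_ext_xy (fun i => ?_) (fun i => ?_)
    · simp only [AlgHom.comp_apply, shiftP_px]
      by_cases h0 : i = 0
      · rw [if_pos h0, map_zero, map_zero]
      · rw [if_neg h0, shiftP_px, if_neg (by omega), phi_px, if_neg (by omega), if_neg (by omega),
          Nat.add_sub_cancel]
    · simp only [AlgHom.comp_apply, shiftP_py]
      by_cases h0 : i = 0
      · rw [if_pos h0, map_zero, map_zero]
      · rw [if_neg h0, shiftP_py, if_neg (by omega), phi_py, if_neg (by omega), Nat.add_sub_cancel]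
  exact DFunLike.congr_fun this p

theorem phi_two_one_mon_mul_shiftP_mon_mul (n d m e : ℕ) (p : Poly) :
    phi 2 1 (mon n d * shiftP (mon m e * shiftP p)) =
      if m = 0 then mon n (d + e) * shiftP p else 0 := by
  have h (q : ℚ) : phi 2 1 (MvPolynomial.C q) = MvPolynomial.C q := (phi 2 1).commutes q
  have h' (q : ℚ) : shiftP (MvPolynomial.C q) = MvPolynomial.C q := shiftP.commutes q
  have hm : phi 2 1 (shiftP (mon m e)) = if m = 0 then py 1 ^ e else 0 := by
    rw [mon]
    simp only [map_mul, map_pow, h, h', shiftP_px, shiftP_py]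
    rw [if_neg (by omega), if_neg (by omega), phi_px, phi_py]
    by_cases hn : m = 0
    · simp [hn]
    · simp [hn]
  rw [map_mul, map_mul, map_mul, phi_two_one_shiftP_shiftP, hm, phi_mon (le_refl 1) (c := 0)]
  split_ifs
  · rw [mon, mon]; ring
  · simp

theorem py_pow_mul_mon (D n d : ℕ) : py 1 ^ D * mon n d = mon n (d + D) := by
  rw [mon, mon]; ring

/-- Terms that do not touch the first letter form δ of the remaining word, with that letter
prepended. The others are those with j = 1, and those with φ_2^-, which merges the first two Y's. -/
theorem delta_wordOf_succ (r n d : ℕ) (p : Poly) :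
    induced deltaB (wordOf (r + 1) (mon n d * shiftP p)) =
      cons (lett n d) (induced deltaB (wordOf r p)) +
      (wordOf (r + 1) (dy (r + 1) 1 (dx (r + 1) 1 (mon n d)) * shiftP p)
        - (2⁻¹ : ℚ) • wordOf r (phi 1 1 (eta (r + 1) 1 (mon n d * shiftP p)))
        - (if 1 ≤ r then
            (2⁻¹ : ℚ) • wordOf r (phi 2 1 (etaMinus (r + 1) 2 (mon n d * shiftP p))) else 0)
        + (if 1 ≤ r then
            (4⁻¹ : ℚ) • wordOf (r - 1) (phi 1 1 (phi 1 1 (mon n d * shiftP p))) else 0)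
        - (if 2 ≤ r then
            (4⁻¹ : ℚ) • wordOf (r - 1) (phi 2 1 (phi 2 1 (mon n d * shiftP p))) else 0)) := by
  have hsplit (F : ℕ → QA) : ∑ j ∈ Finset.Icc 1 (r + 1), F j =
      F 1 + ∑ j ∈ Finset.Icc 1 r, F (j + 1) := by
    rw [sum_Icc_eq_sum_fin, Fin.sum_univ_succ, sum_Icc_eq_sum_fin]; simp
  have hite (F : ℕ → QA) (b : ℕ) : (∑ j ∈ Finset.Icc 1 r, if j ≤ b then F j else 0) =
      (if 1 ≤ r ∧ 1 ≤ b then F 1 else 0) +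
        ∑ j ∈ Finset.Icc 1 r, if 2 ≤ j ∧ j ≤ b then F j else 0 := by
    cases r with
    | zero => simp
    | succ r =>
      rw [sum_Icc_eq_sum_fin, Fin.sum_univ_succ, sum_Icc_eq_sum_fin, Fin.sum_univ_succ]
      simp
  set A := mon n d
  set P := A * shiftP p with hP
  rw [delta_wordOf, delta_wordOf, map_sum, hsplit, hsplit, map_add]
  have t1 : ∑ j ∈ Finset.Icc 1 r, wordOf (r + 1) (dy (r + 1) (j + 1) (dx (r + 1) (j + 1) P)) =
      cons (lett n d) (wordOf r (∑ j ∈ Finset.Icc 1 r, dy r j (dx r j p))) := by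
    rw [map_sum, map_sum]
    refine Finset.sum_congr rfl fun j hj => ?_
    rw [Finset.mem_Icc] at hj
    rw [hP, dx_mon_mul_shiftP hj.1, dy_mon_mul_shiftP hj.1, wordOf_mon_mul_shiftP]
  have t2 : ∑ j ∈ Finset.Icc 1 r, -((2⁻¹ : ℚ) • wordOf r (phi (j + 1) (j + 1)
      (eta (r + 1) (j + 1) P))) = ∑ j ∈ Finset.Icc 1 r, cons (lett n d)
        (-((2⁻¹ : ℚ) • wordOf (r - 1) (phi j j (eta r j p)))) := by
    refine Finset.sum_congr rfl fun j hj => ?_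
    rw [Finset.mem_Icc] at hj
    obtain ⟨r, rfl⟩ : ∃ k, r = k + 1 := ⟨r - 1, by omega⟩
    rw [hP, eta_mon_mul_shiftP hj.1, phi_mon_mul_shiftP hj.1 (by omega), wordOf_mon_mul_shiftP, map_neg,
      map_smul, Nat.add_sub_cancel]
  have t3 : (∑ j ∈ Finset.Icc 1 r, if 2 ≤ j + 1 then (2⁻¹ : ℚ) • wordOf r (phi (j + 1) j
      (etaMinus (r + 1) (j + 1) P)) else 0) =
      (if 1 ≤ r then (2⁻¹ : ℚ) • wordOf r (phi 2 1 (etaMinus (r + 1) 2 P)) else 0) +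
      ∑ j ∈ Finset.Icc 1 r, cons (lett n d) (if 2 ≤ j then
        ((2⁻¹ : ℚ) • wordOf (r - 1) (phi j (j - 1) (etaMinus r j p))) else 0) := by
    have h := hite (fun j => (2⁻¹ : ℚ) • wordOf r (phi (j + 1) j (etaMinus (r + 1) (j + 1) P))) r
    simp only [and_self] at h
    have e1 : (∑ j ∈ Finset.Icc 1 r, if 2 ≤ j + 1 then (2⁻¹ : ℚ) • wordOf r (phi (j + 1) j
      (etaMinus (r + 1) (j + 1) P)) else 0) = ∑ j ∈ Finset.Icc 1 r, if j ≤ r then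
        (2⁻¹ : ℚ) • wordOf r (phi (j + 1) j (etaMinus (r + 1) (j + 1) P)) else 0 := by
      refine Finset.sum_congr rfl fun j hj => ?_
      rw [Finset.mem_Icc] at hj
      rw [if_pos (by omega), if_pos hj.2]
    rw [e1, h]
    congr 1
    refine Finset.sum_congr rfl fun j hj => ?_
    rw [Finset.mem_Icc] at hj
    by_cases h2 : 2 ≤ j
    · obtain ⟨r, rfl⟩ : ∃ k, r = k + 1 := ⟨r - 1, by omega⟩
      obtain ⟨j, rfl⟩ : ∃ k, j = k + 1 := ⟨j - 1, by omega⟩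
      rw [if_pos ⟨h2, hj.2⟩, if_pos h2, hP, etaMinus_mon_mul_shiftP h2,
        phi_mon_mul_shiftP hj.1 (by omega), wordOf_mon_mul_shiftP, map_smul, Nat.add_sub_cancel,
        Nat.add_sub_cancel]
    · rw [if_neg (by omega), if_neg h2, map_zero]
  have t4 : (∑ j ∈ Finset.Icc 1 r, if j + 1 ≤ r then (4⁻¹ : ℚ) • wordOf (r - 1)
      (phi (j + 1) (j + 1) (phi (j + 1) (j + 1) P)) else 0) =
      ∑ j ∈ Finset.Icc 1 r, cons (lett n d) (if j ≤ r - 1 then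
        (4⁻¹ : ℚ) • wordOf (r - 1 - 1) (phi j j (phi j j p)) else 0) := by
    refine Finset.sum_congr rfl fun j hj => ?_
    rw [Finset.mem_Icc] at hj
    by_cases h2 : j + 1 ≤ r
    · obtain ⟨r, rfl⟩ : ∃ k, r = k + 2 := ⟨r - 2, by omega⟩
      rw [if_pos h2, if_pos (by omega), hP, phi_mon_mul_shiftP hj.1 (by omega), phi_mon_mul_shiftP hj.1 (by omega),
        show r + 2 - 1 = r + 1 by omega, wordOf_mon_mul_shiftP, map_smul, Nat.add_sub_cancel]
    · rw [if_neg h2, if_neg (by omega), map_zero]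
  have t5 : (∑ j ∈ Finset.Icc 1 r, if 2 ≤ j + 1 ∧ j + 1 ≤ r then (4⁻¹ : ℚ) • wordOf (r - 1)
      (phi (j + 1) j (phi (j + 1) j P)) else 0) =
      (if 2 ≤ r then (4⁻¹ : ℚ) • wordOf (r - 1) (phi 2 1 (phi 2 1 P)) else 0) +
      ∑ j ∈ Finset.Icc 1 r, cons (lett n d) (if 2 ≤ j ∧ j ≤ r - 1 then
        (4⁻¹ : ℚ) • wordOf (r - 1 - 1) (phi j (j - 1) (phi j (j - 1) p)) else 0) := by
    have h := hite (fun j => (4⁻¹ : ℚ) • wordOf (r - 1)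
      (phi (j + 1) j (phi (j + 1) j P))) (r - 1)
    have e1 : (∑ j ∈ Finset.Icc 1 r, if 2 ≤ j + 1 ∧ j + 1 ≤ r then (4⁻¹ : ℚ) • wordOf (r - 1)
      (phi (j + 1) j (phi (j + 1) j P)) else 0) = ∑ j ∈ Finset.Icc 1 r, if j ≤ r - 1 then
        (4⁻¹ : ℚ) • wordOf (r - 1) (phi (j + 1) j (phi (j + 1) j P)) else 0 := by
      refine Finset.sum_congr rfl fun j hj => ?_
      rw [Finset.mem_Icc] at hj
      by_cases h2 : j + 1 ≤ r
      · rw [if_pos (by omega), if_pos (by omega)]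
      · rw [if_neg (by omega), if_neg (by omega)]
    rw [e1, h]
    congr 1
    · by_cases h2 : 2 ≤ r
      · rw [if_pos (by omega), if_pos h2]
      · rw [if_neg (by omega), if_neg h2]
    refine Finset.sum_congr rfl fun j hj => ?_
    rw [Finset.mem_Icc] at hj
    by_cases h2 : 2 ≤ j ∧ j ≤ r - 1
    · obtain ⟨r, rfl⟩ : ∃ k, r = k + 2 := ⟨r - 2, by omega⟩
      obtain ⟨j, rfl⟩ : ∃ k, j = k + 1 := ⟨j - 1, by omega⟩
      rw [if_pos h2, if_pos h2, hP, phi_mon_mul_shiftP hj.1 (by omega), phi_mon_mul_shiftP hj.1 (by omega),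
        show r + 2 - 1 = r + 1 by omega, wordOf_mon_mul_shiftP, map_smul, Nat.add_sub_cancel,
        Nat.add_sub_cancel]
    · rw [if_neg h2, if_neg h2, map_zero]
  simp only [Nat.add_sub_cancel]
  have s1 : dy (r + 1) 1 (dx (r + 1) 1 P) = dy (r + 1) 1 (dx (r + 1) 1 A) * shiftP p := by
    rw [hP, dx_one_mon_mul_shiftP, Derivation.leibniz]
    have h := dy_shiftP r 0 p
    rw [dy_out] at h
    rw [h]; simp [mul_comm, A]
  rw [t1, s1]
  simp only [Finset.sum_add_distrib, Finset.sum_sub_distrib, map_add, map_sub, map_sum]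
  -- There is no φ_1^-, so the terms with j = 1 in the two minus families vanish.
  rw [t2, t3, t4, t5, if_neg (show ¬ 2 ≤ 1 by omega),
    if_neg (show ¬ (2 ≤ 1 ∧ 1 ≤ r) by omega)]
  abel

end DeltaRecursion

/-! ### δ as a sum over windows and suffixes. -/

section DeltaLocal

theorem consL_basisL (n d : ℕ) (x : QA) : consL (basisL n d) x = cons (lett n d) x := by
  rw [basisL, consL_single, one_smul]

theorem wordOf_lower (r n d : ℕ) (p : Poly) :
    wordOf (r + 1) (dy (r + 1) 1 (dx (r + 1) 1 (mon n d)) * shiftP p) =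
      consL (theta₁ n d) (wordOf r p) := by
  cases n with
  | zero => rw [dx_mon_zero]; simp [theta₁]
  | succ n =>
    rw [dx_mon_succ (by omega), dy_mon (by omega), smul_mul_assoc, map_smul, wordOf_mon_mul_shiftP,
      theta₁, if_pos (by omega), lowerL, map_smul, LinearMap.smul_apply, Nat.add_sub_cancel,
      consL_basisL]

/-- This is the source of the suffix part of δ: when the removed letter has no successor to receive
its exponent, only exponent 0 survives. -/
theorem wordOf_zero_py_pow (d : ℕ) : wordOf 0 (py 1 ^ d) = if d = 0 then 1 else 0 := by
  split_ifs with h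
  · rw [h, pow_zero, wordOf_zero_one]
  · rw [wordOf, pairing_apply, map_pow, res_py_eq_zero (by omega), zero_pow h, map_zero]

theorem wordOf_py_pow_mul (r D m e : ℕ) (p : Poly) :
    wordOf (r + 1) (py 1 ^ D * (mon m e * shiftP p)) = cons (lett m (e + D)) (wordOf r p) := by
  rw [← mul_assoc, py_pow_mul_mon, wordOf_mon_mul_shiftP]

theorem res_phi_one_one_mon_mul_shiftP (r n d : ℕ) (p : Poly) :
    res r (phi 1 1 (mon n d * shiftP p)) = res r ((if n = 0 then py 1 ^ d else 0) * p) := by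
  rw [map_mul, map_mul, map_mul, phi_one_one_mon, res_phi_one_one_shiftP]

/-- Setting x_1 to 0 forces the first letter to have upper index 1; identifying y_1 and y_2 passes
its lower index on to the next letter. -/
theorem wordOf_phi_one_one (r n d : ℕ) (p : Poly) :
    wordOf r (phi 1 1 (mon n d * shiftP p)) = if n = 0 then wordOf r (py 1 ^ d * p) else 0 := by
  rw [wordOf_congr (res_phi_one_one_mon_mul_shiftP r n d p)]
  split_ifs <;> simp

theorem eta_one_mon_mul_shiftP (r n d : ℕ) (p : Poly) :
    eta (r + 1) 1 (mon n d * shiftP p) = (dx (r + 1) 1 (mon n d) + dy (r + 1) 1 (mon n d)) * shiftP p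
      - mon n d * shiftP (dx r 1 p) := by
  simp only [eta, Derivation.add_apply, Derivation.sub_apply]
  rw [dx_mon_mul_shiftP (le_refl 1), dx_one_mon_mul_shiftP, dy_one_mon_mul_shiftP]
  ring

theorem wordOf_phi_one_one_eta (r n d : ℕ) (p : Poly) :
    wordOf r (phi 1 1 (eta (r + 1) 1 (mon n d * shiftP p))) =
      (if n = 1 then wordOf r (py 1 ^ d * p) else 0)
      + (if n = 0 then (d : ℚ) • wordOf r (py 1 ^ (d - 1) * p) else 0)
      - (if n = 0 then wordOf r (py 1 ^ d * dx r 1 p) else 0) := by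
  rw [eta_one_mon_mul_shiftP, add_mul, map_sub, map_add, map_sub, map_add, wordOf_phi_one_one,
    dy_mon (by omega), smul_mul_assoc, map_smul, map_smul, wordOf_phi_one_one, smul_ite, smul_zero]
  congr 2
  cases n with
  | zero => rw [dx_mon_zero]; simp
  | succ n => rw [dx_mon_succ (by omega), wordOf_phi_one_one]; simp

/-- The half of `theta₂` in which the first of two letters is absorbed into the second;
`wordOf_phi_two_one_etaMinus` is the other half. -/
theorem wordOf_phi_one_one_eta_cons (r n d m e : ℕ) (p : Poly) :
    wordOf (r + 1) (phi 1 1 (eta (r + 1 + 1) 1 (mon n d * shiftP (mon m e * shiftP p)))) =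
      consL ((if n = 1 then basisL m (d + e) else 0)
        - (if n = 0 ∧ 1 ≤ m then basisL (m - 1) (d + e) else 0)
        + (if n = 0 then lowerL d m (d + e) else 0)) (wordOf r p) := by
  rw [wordOf_phi_one_one_eta, wordOf_py_pow_mul, wordOf_py_pow_mul, dx_one_mon_mul_shiftP]
  have h1 : (d : ℚ) • cons (lett m (e + (d - 1))) (wordOf r p) =
      consL (lowerL d m (d + e)) (wordOf r p) := by
    rw [lowerL, map_smul, LinearMap.smul_apply, consL_basisL]
    rcases Nat.eq_zero_or_pos d with rfl | hd
    · simp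
    · rw [show e + (d - 1) = d + e - 1 by omega]
  have h2 : wordOf (r + 1) (py 1 ^ d * (dx (r + 1) 1 (mon m e) * shiftP p)) =
      if 1 ≤ m then cons (lett (m - 1) (d + e)) (wordOf r p) else 0 := by
    cases m with
    | zero => rw [dx_mon_zero]; simp
    | succ m =>
      rw [dx_mon_succ (by omega), wordOf_py_pow_mul, if_pos (by omega), Nat.add_sub_cancel,
        add_comm e]
  rw [h1, h2, add_comm e d, map_add, map_sub]
  by_cases hn : n = 0
  · subst hn
    by_cases hm : 1 ≤ m
    · simp [hm, consL_basisL]; abel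
    · simp [hm]
  · simp only [hn, false_and, if_false, add_zero, sub_zero, map_zero]
    split_ifs <;> simp [consL_basisL]

theorem etaMinus_two_mon_mul_shiftP (r n d m e : ℕ) (p : Poly) :
    etaMinus (r + 1 + 1) 2 (mon n d * shiftP (mon m e * shiftP p)) =
      dx (r + 1 + 1) 1 (mon n d) * shiftP (mon m e * shiftP p)
      - mon n d * shiftP (dx (r + 1) 1 (mon m e) * shiftP p)
      + mon n d * shiftP (dy (r + 1) 1 (mon m e) * shiftP p) := by
  simp only [etaMinus, Derivation.add_apply, Derivation.sub_apply]
  rw [dx_mon_mul_shiftP (le_refl 1), dy_mon_mul_shiftP (le_refl 1), dx_one_mon_mul_shiftP,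
    dx_one_mon_mul_shiftP, dy_one_mon_mul_shiftP]

theorem wordOf_phi_two_one_etaMinus (r n d m e : ℕ) (p : Poly) :
    wordOf (r + 1) (phi 2 1 (etaMinus (r + 1 + 1) 2 (mon n d * shiftP (mon m e * shiftP p)))) =
      consL ((if m = 0 ∧ 1 ≤ n then basisL (n - 1) (d + e) else 0)
        - (if m = 1 then basisL n (d + e) else 0)
        + (if m = 0 then lowerL e n (d + e) else 0)) (wordOf r p) := by
  have h1 : wordOf (r + 1) (phi 2 1 (dx (r + 1 + 1) 1 (mon n d) * shiftP (mon m e * shiftP p))) =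
      consL (if m = 0 ∧ 1 ≤ n then basisL (n - 1) (d + e) else 0) (wordOf r p) := by
    cases n with
    | zero => rw [dx_mon_zero]; simp
    | succ n =>
      rw [dx_mon_succ (by omega), phi_two_one_mon_mul_shiftP_mon_mul]
      by_cases hm : m = 0
      · rw [if_pos hm, if_pos ⟨hm, by omega⟩, wordOf_mon_mul_shiftP, consL_basisL,
          Nat.add_sub_cancel]
      · rw [if_neg hm, if_neg (by tauto)]; simp
  have h2 : wordOf (r + 1) (phi 2 1 (mon n d * shiftP (dx (r + 1) 1 (mon m e) * shiftP p))) =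
      consL (if m = 1 then basisL n (d + e) else 0) (wordOf r p) := by
    cases m with
    | zero => rw [dx_mon_zero]; simp
    | succ m =>
      rw [dx_mon_succ (by omega), phi_two_one_mon_mul_shiftP_mon_mul]
      by_cases hm : m = 0
      · rw [if_pos hm, if_pos (by omega), wordOf_mon_mul_shiftP, consL_basisL]
      · rw [if_neg hm, if_neg (by omega)]; simp
  have h3 : wordOf (r + 1) (phi 2 1 (mon n d * shiftP (dy (r + 1) 1 (mon m e) * shiftP p))) =
      consL (if m = 0 then lowerL e n (d + e) else 0) (wordOf r p) := by
    rw [dy_mon (by omega), smul_mul_assoc, map_smul, mul_smul_comm, map_smul, map_smul,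
      phi_two_one_mon_mul_shiftP_mon_mul]
    split_ifs
    · rw [wordOf_mon_mul_shiftP, lowerL, map_smul, LinearMap.smul_apply, consL_basisL]
      rcases Nat.eq_zero_or_pos e with rfl | he
      · simp
      · rw [show d + (e - 1) = d + e - 1 by omega]
    · simp
  rw [etaMinus_two_mon_mul_shiftP, map_add, map_sub, map_add, map_sub, h1, h2, h3, map_add, map_sub]
  rfl

theorem wordOf_phi_phi_one_one (s n d m e : ℕ) (q : Poly) :
    wordOf s (phi 1 1 (phi 1 1 (mon n d * shiftP (mon m e * shiftP q)))) =
      if n = 0 ∧ m = 0 then wordOf s (py 1 ^ (d + e) * q) else 0 := by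
  have h : wordOf (s + 1 - 1) (phi 1 1 (phi 1 1 (mon n d * shiftP (mon m e * shiftP q)))) =
      wordOf (s + 1 - 1) (phi 1 1 ((if n = 0 then py 1 ^ d else 0) * (mon m e * shiftP q))) := by
    exact wordOf_phi_congr (by omega) (by omega) (res_phi_one_one_mon_mul_shiftP _ _ _ _)
  rw [Nat.add_sub_cancel] at h
  rw [h]
  by_cases hn : n = 0
  · rw [if_pos hn, ← mul_assoc, py_pow_mul_mon, wordOf_phi_one_one, add_comm e]
    simp [hn]
  · rw [if_neg hn, if_neg (by tauto)]; simp

theorem wordOf_phi_phi_two_one (s n d m e k f : ℕ) (q : Poly) :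
    wordOf (s + 1) (phi 2 1 (phi 2 1
        (mon n d * shiftP (mon m e * shiftP (mon k f * shiftP q))))) =
      if m = 0 ∧ k = 0 then cons (lett n (d + e + f)) (wordOf s q) else 0 := by
  rw [phi_two_one_mon_mul_shiftP_mon_mul]
  by_cases hm : m = 0
  · rw [if_pos hm, phi_two_one_mon_mul_shiftP_mon_mul]
    by_cases hk : k = 0
    · rw [if_pos hk, wordOf_mon_mul_shiftP, if_pos ⟨hm, hk⟩]
    · rw [if_neg hk, if_neg (by tauto), map_zero]
  · rw [if_neg hm, if_neg (by tauto)]; simp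

theorem act_deconc_cons (φ : QA →ₗ[ℚ] Letters) (a : Letter) (x : QA) :
    act φ (deconc (cons a x)) = consL (φ 1) (cons a x) + act (φ ∘ₗ cons a) (deconc x) := by
  have h : act φ ∘ₗ (cons a).rTensor QA = act (φ ∘ₗ cons a) := by ext; simp
  have h' := LinearMap.congr_fun h (deconc x)
  simp only [LinearMap.comp_apply] at h'
  rw [deconc_cons, map_add, h', act_tmul]

theorem act_deconc_one (φ : QA →ₗ[ℚ] Letters) : act φ (deconc 1) = consL (φ 1) 1 := by
  rw [deconc_one, act_tmul]

theorem act_theta_cons_cons_cons (n d m e k f : ℕ) (x : QA) :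
    act (((theta ∘ₗ cons (lett n d)) ∘ₗ cons (lett m e)) ∘ₗ cons (lett k f)) (deconc x) =
      consL (theta₃ n d m e k f) x := by
  have : act (((theta ∘ₗ cons (lett n d)) ∘ₗ cons (lett m e)) ∘ₗ cons (lett k f)) ∘ₗ deconc =
      consL (theta₃ n d m e k f) := hom_ext fun w => by
    cases w with
    | nil => simp [← one_def, act_deconc_one, theta_three]
    | cons a w =>
      have h : (((theta ∘ₗ cons (lett n d)) ∘ₗ cons (lett m e)) ∘ₗ cons (lett k f)) ∘ₗ cons a = 0 :=
        LinearMap.ext fun x => theta_four _ _ _ _ x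
      rw [← cons_word, LinearMap.comp_apply, act_deconc_cons, h, act_zero]
      simp [theta_three]
  exact LinearMap.congr_fun this x

theorem consL_ite_basisL (p : Prop) [Decidable p] (n d : ℕ) (x : QA) :
    consL (if p then basisL n d else 0) x = if p then cons (lett n d) x else 0 := by
  split_ifs
  · exact consL_basisL n d x
  · simp

theorem theta₂_eq (n d m e : ℕ) : theta₂ n d m e = (-(2⁻¹) : ℚ) •
    (((if n = 1 then basisL m (d + e) else 0)
        - (if n = 0 ∧ 1 ≤ m then basisL (m - 1) (d + e) else 0)
        + (if n = 0 then lowerL d m (d + e) else 0)) +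
      ((if m = 0 ∧ 1 ≤ n then basisL (n - 1) (d + e) else 0)
        - (if m = 1 then basisL n (d + e) else 0)
        + (if m = 0 then lowerL e n (d + e) else 0))) := by
  rw [theta₂]; congr 1; abel

/-- Induction on the first letter. The residual terms of `delta_wordOf_succ` are the windows of one,
two or three letters at the front, plus the suffix term in which the whole word disappears; hence
the cases by length. -/
theorem delta_word (w : List Letter) :
    induced deltaB (word w) = localOp theta (word w) + truncOp tail (word w) := by
  induction w with
  | nil =>
    have h := delta_wordOf 0 1
    rw [wordOf_zero_one] at h
    rw [← one_def, localOp_one, truncOp_one, tail_one, h]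
    simp
  | cons a w ih =>
    obtain ⟨n, d, rfl⟩ := exists_lett a
    have h := delta_wordOf_succ w.length n d (mono w)
    rw [wordOf_mon_mul_shiftP, wordOf_mono, ih] at h
    rw [← cons_word, h, localOp_cons, truncOp_cons, map_add, wordOf_lower, wordOf_mono]
    suffices hs : consL (theta₁ n d) (word w)
        - (2⁻¹ : ℚ) • wordOf w.length (phi 1 1 (eta (w.length + 1) 1 (mon n d * shiftP (mono w))))
        - (if 1 ≤ w.length then (2⁻¹ : ℚ) • wordOf w.length (phi 2 1
            (etaMinus (w.length + 1) 2 (mon n d * shiftP (mono w)))) else 0)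
        + (if 1 ≤ w.length then (4⁻¹ : ℚ) • wordOf (w.length - 1)
            (phi 1 1 (phi 1 1 (mon n d * shiftP (mono w)))) else 0)
        - (if 2 ≤ w.length then (4⁻¹ : ℚ) • wordOf (w.length - 1)
            (phi 2 1 (phi 2 1 (mon n d * shiftP (mono w)))) else 0) =
        act (theta ∘ₗ cons (lett n d)) (deconc (word w)) + tail (cons (lett n d) (word w)) • 1 by
      rw [hs]; abel
    have hone : word [] = 1 := rfl
    match w with
    | [] =>
      rw [List.length_nil, if_neg (by omega), if_neg (by omega), if_neg (by omega),
        wordOf_phi_one_one_eta, hone, act_deconc_one, tail_cons_one, LinearMap.comp_apply,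
        theta_one, mono, mul_one, mul_one, wordOf_zero_py_pow, wordOf_zero_py_pow]
      -- For d = 0 the truncated d - 1 is 0 as well, but the coefficient d removes that case.
      have hd : (d : ℚ) • (if d - 1 = 0 then (1 : QA) else 0) = if d = 1 then 1 else 0 := by
        rcases d with _ | _ | d <;> simp
      rw [hd]
      by_cases h1 : n = 1 <;> by_cases h2 : n = 0 <;> by_cases h3 : d = 1 <;>
        by_cases h4 : d = 0 <;> simp_all <;> module
    | [b] =>
      obtain ⟨m, e, rfl⟩ := exists_lett b
      rw [List.length_singleton, mono_cons, wordOf_phi_one_one_eta_cons,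
        wordOf_phi_two_one_etaMinus, wordOf_phi_phi_one_one, mono, mul_one, Nat.sub_self,
        wordOf_zero_py_pow, wordOf_zero_one, ← cons_word, hone, act_deconc_cons, act_deconc_one,
        tail_cons_cons_one]
      simp only [LinearMap.comp_apply, theta_one, theta_two, theta₂_eq, map_smul,
        LinearMap.smul_apply, map_add consL, LinearMap.add_apply]
      rw [if_pos (show 1 ≤ 0 + 1 by omega), if_pos (show 1 ≤ 0 + 1 by omega),
        if_neg (show ¬ 2 ≤ 0 + 1 by omega)]
      have ht : (if n = 0 ∧ m = 0 then if d + e = 0 then (1 : QA) else 0 else 0) =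
          if (n = 0 ∧ d = 0) ∧ m = 0 ∧ e = 0 then 1 else 0 := by
        split_ifs <;> first | rfl | omega
      rw [ht, ite_smul, zero_smul, smul_ite, smul_zero]
      generalize (if (n = 0 ∧ d = 0) ∧ m = 0 ∧ e = 0 then (4⁻¹ : ℚ) • (1 : QA) else 0) = z
      module
    | b :: c :: w =>
      obtain ⟨m, e, rfl⟩ := exists_lett b
      obtain ⟨k, f, rfl⟩ := exists_lett c
      rw [List.length_cons, List.length_cons, mono_cons, mono_cons, Nat.add_sub_cancel,
        wordOf_phi_one_one_eta_cons, wordOf_phi_two_one_etaMinus, wordOf_phi_phi_one_one,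
        wordOf_phi_phi_two_one, wordOf_py_pow_mul, wordOf_mon_mul_shiftP, wordOf_mono, ← cons_word,
        ← cons_word, act_deconc_cons, act_deconc_cons, tail_three, act_theta_cons_cons_cons]
      simp only [LinearMap.comp_apply, theta_one, theta_two, theta₂_eq, map_smul, theta₃,
        LinearMap.smul_apply, map_add consL, LinearMap.add_apply]
      rw [if_pos (show 1 ≤ w.length + 1 + 1 by omega), if_pos (show 1 ≤ w.length + 1 + 1 by omega),
        if_pos (show 2 ≤ w.length + 1 + 1 by omega), add_comm f]
      simp only [map_sub, LinearMap.sub_apply, consL_ite_basisL]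
      module

end DeltaLocal

/-! ### D as a sum over single letters. -/

section RaiseLocal

theorem quad_succ (r : ℕ) : quad (r + 1) = px 1 * py 1 + shiftP (quad r) := by
  induction r with
  | zero => simp [quad]
  | succ r ih =>
    have h (s : ℕ) : quad (s + 1) = quad s + px (s + 1) * py (s + 1) :=
      Finset.sum_Icc_succ_top (by omega) _
    have hs : shiftP (quad (r + 1)) = shiftP (quad r) + px (r + 1 + 1) * py (r + 1 + 1) := by
      rw [h r, map_add, map_mul, shiftP_px, shiftP_py, if_neg (by omega), if_neg (by omega)]
    rw [hs, h (r + 1), ih, add_assoc]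

theorem px_mul_py_mul_mon (n d : ℕ) :
    px 1 * py 1 * mon n d = ((n : ℚ) + 1) • mon (n + 1) (d + 1) := by
  have h : ((n : ℚ) + 1) * (((n + 1).factorial : ℚ)⁻¹) = (n.factorial : ℚ)⁻¹ := by
    have : (n.factorial : ℚ) ≠ 0 := by positivity
    rw [Nat.factorial_succ]; push_cast; field_simp
  rw [mon, mon, MvPolynomial.smul_eq_C_mul, ← h, map_mul]
  ring

/-- The summand x_1 y_1 of the quadratic form raises the first letter and the remaining summands act
on the rest of the word, which is the recursion of a local operator with one-letter windows. -/
theorem d_word (w : List Letter) : induced dB (word w) = localOp raise (word w) := by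
  induction w with
  | nil =>
    have h := d_wordOf 0 1
    rw [wordOf_zero_one] at h
    rw [← one_def, localOp_one, h, quad]
    simp
  | cons a w ih =>
    obtain ⟨n, d, rfl⟩ := exists_lett a
    have h := d_wordOf (w.length + 1) (mon n d * shiftP (mono w))
    have h' := d_wordOf w.length (mono w)
    rw [wordOf_mono] at h'
    rw [wordOf_mon_mul_shiftP, wordOf_mono, quad_succ, add_mul, ← mul_assoc, px_mul_py_mul_mon,
      mul_left_comm, ← map_mul, map_add, smul_mul_assoc, map_smul, wordOf_mon_mul_shiftP,
      wordOf_mon_mul_shiftP, ← h', wordOf_mono, ih] at h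
    have hact : act (raise ∘ₗ cons (lett n d)) (deconc (word w)) =
        ((n : ℚ) + 1) • cons (lett (n + 1) (d + 1)) (word w) := by
      cases w with
      | nil => rw [← one_def, act_deconc_one, LinearMap.comp_apply, raise_one, map_smul,
          LinearMap.smul_apply, consL_basisL]
      | cons b w =>
        have hz : (raise ∘ₗ cons (lett n d)) ∘ₗ cons b = 0 :=
          LinearMap.ext fun x => raise_two _ _ x
        rw [← cons_word, act_deconc_cons, hz, act_zero, LinearMap.comp_apply, raise_one, map_smul,
          LinearMap.smul_apply, consL_basisL, LinearMap.zero_apply, add_zero]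
    rw [← cons_word, h, localOp_cons, hact, add_comm]

end RaiseLocal

/-! ### Descent of the derivations to the quotient. -/

section Derivations

theorem hom_ext_wordOf {f g : QA →ₗ[ℚ] QA} (h : ∀ r p, f (wordOf r p) = g (wordOf r p)) : f = g :=
  hom_ext fun w => by rw [← wordOf_mono]; exact h _ _

/-- The derivation of `(ℚ⟨A⟩, ∗)` induced by `D`. -/
def derD : Derivation ℚ QA QA := Derivation.mk' (induced dB) fun x y => by
  rw [show induced dB = localOp raise from hom_ext d_word, localOp_mul raise_isLocalDerivation,
    smul_eq_mul, smul_eq_mul]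
  ring

/-- The derivation of `(ℚ⟨A⟩, ∗)` induced by `δ`. -/
def derDelta : Derivation ℚ QA QA := Derivation.mk' (induced deltaB) fun x y => by
  rw [show induced deltaB = localOp theta + truncOp tail from hom_ext delta_word]
  simp only [LinearMap.add_apply, localOp_mul theta_isLocalDerivation, truncOp_mul tail_mul,
    smul_eq_mul]
  ring

theorem delta_d (x : QA) : induced deltaB (induced dB x) =
    induced dB (induced deltaB x) + induced wB x :=
  LinearMap.congr_fun (f := induced deltaB ∘ₗ induced dB)
    (g := induced dB ∘ₗ induced deltaB + induced wB) (hom_ext_wordOf delta_d_wordOf) x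

theorem w_d (x : QA) : induced wB (induced dB x) =
    induced dB (induced wB x) + (2 : ℚ) • induced dB x :=
  LinearMap.congr_fun (f := induced wB ∘ₗ induced dB)
    (g := induced dB ∘ₗ induced wB + (2 : ℚ) • induced dB) (hom_ext_wordOf w_d_wordOf) x

theorem w_delta (x : QA) : induced wB (induced deltaB x) =
    induced deltaB (induced wB x) + (-2 : ℚ) • induced deltaB x :=
  LinearMap.congr_fun (f := induced wB ∘ₗ induced deltaB)
    (g := induced deltaB ∘ₗ induced wB + (-2 : ℚ) • induced deltaB) (hom_ext_wordOf w_delta_wordOf) x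

theorem d_swap (x : QA) : induced dB (swap x) = swap (induced dB x) :=
  LinearMap.congr_fun (f := induced dB ∘ₗ swap) (g := swap ∘ₗ induced dB)
    (hom_ext_wordOf d_swap_wordOf) x

theorem delta_swap (x : QA) : induced deltaB (swap x) = swap (induced deltaB x) :=
  LinearMap.congr_fun (f := induced deltaB ∘ₗ swap) (g := swap ∘ₗ induced deltaB)
    (hom_ext_wordOf delta_swap_wordOf) x

/-- The derivation of `(ℚ⟨A⟩, ∗)` induced by `W`. -/
def derW : Derivation ℚ QA QA := ⁅derDelta, derD⁆

/-- W needs no product computation of its own: a commutator of derivations is a derivation, and the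
bracket relation on words identifies it. -/
theorem derW_apply (x : QA) : derW x = induced wB x := by
  rw [derW, Derivation.commutator_apply]
  exact sub_eq_of_eq_add' (delta_d x)

theorem toFMES_surjective : Function.Surjective toFMES := Ideal.Quotient.mk_surjective

theorem toFMES_eq_zero {x : QA} : toFMES x = 0 ↔ x ∈ swapIdeal := Ideal.Quotient.eq_zero_iff_mem

theorem toFMES_swap (x : QA) : toFMES (swap x) = toFMES x := by
  rw [← sub_eq_zero, ← map_sub, toFMES_eq_zero]
  exact Ideal.subset_span ⟨x, rfl⟩

/-- On a generator, d(σ(y) - y) = σ(dy) - dy is again a generator; multiples are handled by the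
Leibniz rule. -/
theorem toFMES_derivation_eq_zero (d : Derivation ℚ QA QA) (hd : ∀ x, d (swap x) = swap (d x))
    (x : QA) (hx : toFMES x = 0) : toFMES (d x) = 0 := by
  rw [toFMES_eq_zero] at hx
  induction hx using Submodule.span_induction with
  | mem x h =>
    obtain ⟨y, rfl⟩ := h
    simp only [map_sub, hd, toFMES_swap, sub_self]
  | zero => simp
  | add x y _ _ h₁ h₂ => simp only [map_add, h₁, h₂, add_zero]
  | smul a x hx h =>
    rw [smul_eq_mul, Derivation.leibniz, map_add, smul_eq_mul, smul_eq_mul, map_mul, map_mul, h,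
      toFMES_eq_zero.2 hx, mul_zero, zero_mul, add_zero]

/-- The derivation of `FMES` induced by a derivation that commutes with the swap. -/
def descend (d : Derivation ℚ QA QA) (hd : ∀ x, d (swap x) = swap (d x)) : Derivation ℚ FMES FMES :=
  Derivation.liftOfSurjective toFMES_surjective (toFMES_derivation_eq_zero d hd)

theorem descend_toFMES (d : Derivation ℚ QA QA) (hd : ∀ x, d (swap x) = swap (d x)) (x : QA) :
    descend d hd (toFMES x) = toFMES (d x) :=
  Derivation.liftOfSurjective_apply toFMES_surjective (toFMES_derivation_eq_zero d hd) x

/-- The derivation `D` of `FMES`. -/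
def fD : Derivation ℚ FMES FMES := descend derD d_swap

/-- The derivation `δ` of `FMES`. -/
def fDelta : Derivation ℚ FMES FMES := descend derDelta delta_swap

/-- The derivation `W` of `FMES`. -/
def fW : Derivation ℚ FMES FMES := descend derW fun x => by
  have h (y : QA) : derW y = induced deltaB (induced dB y) - induced dB (induced deltaB y) := rfl
  rw [h, h, d_swap, delta_swap, delta_swap, d_swap, map_sub]

theorem fD_isInducedBy : IsInducedBy fD dB := descend_toFMES _ _

theorem fDelta_isInducedBy : IsInducedBy fDelta deltaB := descend_toFMES _ _

theorem fW_isInducedBy : IsInducedBy fW wB := fun x => by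
  rw [fW, descend_toFMES, derW_apply]

theorem isSl2Triple : IsSl2Triple fD fW fDelta := by
  refine ⟨?_, ?_, ?_⟩
  · refine Derivation.ext fun y => ?_
    obtain ⟨x, rfl⟩ := toFMES_surjective y
    rw [Derivation.commutator_apply, Derivation.smul_apply, fD_isInducedBy, fW_isInducedBy,
      fW_isInducedBy, fD_isInducedBy, w_d, map_add, map_smul]
    abel
  · refine Derivation.ext fun y => ?_
    obtain ⟨x, rfl⟩ := toFMES_surjective y
    rw [Derivation.commutator_apply, Derivation.smul_apply, fDelta_isInducedBy, fW_isInducedBy,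
      fW_isInducedBy, fDelta_isInducedBy, w_delta, map_add, map_smul]
    abel
  · refine Derivation.ext fun y => ?_
    obtain ⟨x, rfl⟩ := toFMES_surjective y
    rw [Derivation.commutator_apply, fD_isInducedBy, fDelta_isInducedBy, fDelta_isInducedBy,
      fD_isInducedBy, fW_isInducedBy, delta_d, map_add]
    abel

end Derivations

/-! ### Double shuffle relations in depth two. -/

section DoubleShuffle

open Finset.HasAntidiagonal (antidiagonal)

/-- The class of `[n + 1; d]`. -/
def g (n d : ℕ) : FMES := toFMES (cons (lett n d) 1)

/-- The class of `[n + 1, m + 1; d, e]`. -/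
def gg (n d m e : ℕ) : FMES := toFMES (cons (lett n d) (cons (lett m e) 1))

theorem stuffle_relation (n d m e : ℕ) :
    g n d * g m e = gg n d m e + gg m e n d + g (n + m + 1) (d + e) := by
  simp only [g, gg, ← map_mul, ← map_add, cons_mul_cons, one_mul, mul_one, lett_add_lett]

theorem wordOf_one_mon (n d : ℕ) : wordOf 1 (mon n d) = cons (lett n d) 1 := by
  have h := wordOf_mon_mul_shiftP 0 n d 1
  rwa [map_one, mul_one, wordOf_zero_one] at h

theorem wordOf_two_mon (n d m e : ℕ) :
    wordOf 2 (mon n d * shiftP (mon m e)) = cons (lett n d) (cons (lett m e) 1) := by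
  rw [wordOf_mon_mul_shiftP, wordOf_one_mon]

theorem mon_eq (n d : ℕ) : (n.factorial : ℚ) • mon n d = px 1 ^ n * py 1 ^ d := by
  have : (n.factorial : ℚ) ≠ 0 := by positivity
  rw [mon, MvPolynomial.smul_eq_C_mul, ← mul_assoc, ← mul_assoc, ← map_mul, mul_inv_cancel₀ this,
    map_one, one_mul]

theorem g_swap (n d : ℕ) : (n.factorial : ℚ) • g n d = (d.factorial : ℚ) • g d n := by
  have h (n d : ℕ) : (n.factorial : ℚ) • g n d = toFMES (wordOf 1 (px 1 ^ n * py 1 ^ d)) := by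
    rw [g, ← mon_eq, ← wordOf_one_mon, map_smul, map_smul]
  rw [h, h, ← toFMES_swap, swap_wordOf]
  congr 1
  refine wordOf_congr ?_
  simp only [map_mul, map_pow, swapPoly_px, swapPoly_py]
  simp [res_py_eq_zero, mul_comm]

/-- The dual swap sends y_1^d y_2^e to (x_1 + x_2)^d x_1^e; the binomial expansion is rewritten in
the basis of words, where monomials carry factorials. -/
theorem gg_swap (d e : ℕ) : gg 0 d 0 e = ((d.factorial * e.factorial : ℕ) : ℚ) •
    ∑ x ∈ antidiagonal (d + e), ((x.1.choose e : ℕ) : ℚ) • gg x.1 0 x.2 0 := by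
  have h2 (a b : ℕ) : toFMES (wordOf 2 (px 1 ^ a * px 2 ^ b)) =
      ((a.factorial * b.factorial : ℕ) : ℚ) • gg a 0 b 0 := by
    have hs : px 2 ^ b = shiftP (px 1 ^ b) := by rw [map_pow, shiftP_px, if_neg (by omega)]
    have hm (n : ℕ) : (n.factorial : ℚ) • mon n 0 = px 1 ^ n := by rw [mon_eq, pow_zero, mul_one]
    rw [hs, ← hm, ← hm, map_smul, smul_mul_smul_comm, map_smul, wordOf_two_mon, map_smul,
      Nat.cast_mul]
    rfl
  have h1 : swap (cons (lett 0 d) (cons (lett 0 e) 1)) = wordOf 2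
      (∑ m ∈ Finset.range (d + 1), ((d.choose m : ℕ) : ℚ) • (px 1 ^ (e + m) * px 2 ^ (d - m))) := by
    rw [← wordOf_two_mon, swap_wordOf]
    congr 1
    have hm (n : ℕ) : mon 0 n = py 1 ^ n := by simp [mon]
    rw [hm, hm, map_mul, map_pow, map_pow, map_pow, shiftP_py, if_neg (by omega), swapPoly_py,
      if_pos (by omega), swapPoly_py, if_pos (by omega)]
    simp only [Nat.reduceAdd, Nat.reduceSub, Finset.Icc_self, Finset.sum_singleton]
    rw [show Finset.Icc 1 2 = {1, 2} from rfl, Finset.sum_pair (by omega), add_pow, Finset.sum_mul]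
    refine Finset.sum_congr rfl fun m _ => ?_
    rw [Nat.cast_smul_eq_nsmul, nsmul_eq_mul]
    ring
  have h3 : ∑ x ∈ antidiagonal (d + e),
        ((x.1.choose e : ℕ) : ℚ) • gg x.1 0 x.2 0 =
      ∑ m ∈ Finset.range (d + 1), (((e + m).choose e : ℕ) : ℚ) • gg (e + m) 0 (d - m) 0 := by
    rw [Finset.Nat.sum_antidiagonal_eq_sum_range_succ_mk, show (d + e).succ = e + (d + 1) by omega,
      Finset.sum_range_add, Finset.sum_eq_zero, zero_add]
    · refine Finset.sum_congr rfl fun m hm => ?_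
      rw [show d + e - (e + m) = d - m by omega]
    · intro m hm
      rw [Finset.mem_range] at hm
      rw [Nat.choose_eq_zero_of_lt hm, Nat.cast_zero, zero_smul]
  rw [h3, gg, ← toFMES_swap, h1, map_sum, map_sum, Finset.smul_sum]
  refine Finset.sum_congr rfl fun m hm => ?_
  rw [Finset.mem_range] at hm
  rw [map_smul, map_smul, h2, smul_smul, smul_smul, ← Nat.cast_mul, ← Nat.cast_mul]
  congr 2
  have e1 := Nat.choose_mul_factorial_mul_factorial (show m ≤ d by omega)
  have e2 := Nat.add_choose_mul_factorial_mul_factorial e m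
  rw [← Nat.choose_symm_add] at e2
  -- After multiplication by m!, both binomial coefficients can be expressed by factorials.
  apply Nat.eq_of_mul_eq_mul_right m.factorial_pos
  rw [← e1, ← e2]
  ring

/-- The stuffle product of [1; p] and [1; q], rewritten by the swap and divided by p! q!. The merged
letter [2; p + q] becomes a multiple of [p + q + 1; 1]. -/
theorem shuffle_relation (p q : ℕ) : g p 0 * g q 0 =
    ∑ x ∈ antidiagonal (p + q),
      (((x.1.choose q : ℕ) : ℚ) + ((x.1.choose p : ℕ) : ℚ)) • gg x.1 0 x.2 0 +
    (((p + q).choose p : ℕ) : ℚ) • g (p + q) 1 := by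
  have h := stuffle_relation 0 p 0 q
  have hp := g_swap 0 p
  have hq := g_swap 0 q
  have hr := g_swap 1 (p + q)
  have h0 : ((p.factorial * q.factorial : ℕ) : ℚ) ≠ 0 := by positivity
  have hc : (((p + q).factorial : ℕ) : ℚ) = ((p.factorial * q.factorial : ℕ) : ℚ) *
      (((p + q).choose p : ℕ) : ℚ) := by
    rw [← Nat.add_choose_mul_factorial_mul_factorial p q, Nat.choose_symm_add]; push_cast; ring
  simp only [Nat.factorial_zero, Nat.factorial_one, Nat.cast_one, one_smul, zero_add] at h hp hq hr
  rw [hp, hq, hr, gg_swap, gg_swap, add_comm q p, mul_comm q.factorial, hc, mul_smul, ← smul_add,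
    ← smul_add, smul_mul_smul_comm, ← Nat.cast_mul] at h
  have h' := smul_right_injective FMES h0 h
  rw [h', ← Finset.sum_add_distrib]
  simp only [add_smul]

theorem sum_antidiagonal_neg_one_pow_mul_choose {N a : ℕ} (h : a ≤ N) :
    ∑ x ∈ antidiagonal N, (-1 : ℚ) ^ x.1 * ((a.choose x.1 : ℕ) : ℚ) = if a = 0 then 1 else 0 := by
  rw [Finset.Nat.sum_antidiagonal_eq_sum_range_succ_mk]
  have h' := congrArg (Int.cast : ℤ → ℚ) (Int.alternating_sum_range_choose (n := a))
  push_cast at h'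
  rw [← h']
  symm
  refine Finset.sum_subset (fun m hm => ?_) fun m _ hm => ?_
  · rw [Finset.mem_range] at hm ⊢; omega
  · rw [Finset.mem_range] at hm
    rw [Nat.choose_eq_zero_of_lt (by omega), Nat.cast_zero, mul_zero]

/-- In the alternating sum of the shuffle relations, the alternating sums of binomial coefficients
vanish unless the first index is 0. Evenness of N gives x.1 and x.2 equal parity, so both binomials
contribute alike; N ≠ 0 removes the term [N + 1; 1]. -/
theorem sum_neg_one_pow_smul_mul {N : ℕ} (hN : Even N) (h0 : N ≠ 0) :
    ∑ x ∈ antidiagonal N, (-1 : ℚ) ^ x.1 • (g x.1 0 * g x.2 0) = (2 : ℚ) • gg 0 0 N 0 := by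
  have hcoef {a : ℕ} (h : a ≤ N) : ∑ x ∈ antidiagonal N, (-1 : ℚ) ^ x.1 *
      (((a.choose x.2 : ℕ) : ℚ) + ((a.choose x.1 : ℕ) : ℚ)) = if a = 0 then 2 else 0 := by
    have hs : ∑ x ∈ antidiagonal N, (-1 : ℚ) ^ x.1 * ((a.choose x.2 : ℕ) : ℚ) =
        if a = 0 then 1 else 0 := by
      rw [← sum_antidiagonal_neg_one_pow_mul_choose h, ← Finset.Nat.sum_antidiagonal_swap]
      refine Finset.sum_congr rfl fun x hx => ?_
      have hx' : x.1 + x.2 = N := Finset.HasAntidiagonal.mem_antidiagonal.1 hx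
      rw [Prod.fst_swap, Prod.snd_swap]
      congr 1
      have : Even x.1 ↔ Even x.2 := by rw [← hx', Nat.even_add] at hN; exact hN
      rcases Nat.even_or_odd x.1 with hp | hp
      · rw [hp.neg_one_pow, (this.1 hp).neg_one_pow]
      · rw [hp.neg_one_pow, Odd.neg_one_pow]
        rw [← Nat.not_even_iff_odd] at hp ⊢; tauto
    simp only [mul_add, Finset.sum_add_distrib, hs, sum_antidiagonal_neg_one_pow_mul_choose h]
    split_ifs <;> norm_num
  have h1 : ∑ x ∈ antidiagonal N, (-1 : ℚ) ^ x.1 • (g x.1 0 * g x.2 0) =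
      ∑ x ∈ antidiagonal N, (∑ y ∈ antidiagonal N, ((-1 : ℚ) ^ x.1 *
        (((y.1.choose x.2 : ℕ) : ℚ) + ((y.1.choose x.1 : ℕ) : ℚ))) • gg y.1 0 y.2 0 +
        ((-1 : ℚ) ^ x.1 * ((N.choose x.1 : ℕ) : ℚ)) • g N 1) := by
    refine Finset.sum_congr rfl fun x hx => ?_
    have hx' : x.1 + x.2 = N := Finset.HasAntidiagonal.mem_antidiagonal.1 hx
    rw [shuffle_relation, hx', smul_add, Finset.smul_sum]
    simp only [smul_smul]
  rw [h1, Finset.sum_add_distrib, Finset.sum_comm, ← Finset.sum_smul,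
    sum_antidiagonal_neg_one_pow_mul_choose le_rfl, if_neg h0, zero_smul, add_zero]
  have h2 : ∀ y ∈ antidiagonal N, ∑ x ∈ antidiagonal N, ((-1 : ℚ) ^ x.1 *
      (((y.1.choose x.2 : ℕ) : ℚ) + ((y.1.choose x.1 : ℕ) : ℚ))) • gg y.1 0 y.2 0 =
      if y = (0, N) then (2 : ℚ) • gg 0 0 N 0 else 0 := by
    intro y hy
    have hy' : y.1 + y.2 = N := Finset.HasAntidiagonal.mem_antidiagonal.1 hy
    rw [← Finset.sum_smul, hcoef (by omega)]
    by_cases h : y = (0, N)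
    · subst h; simp
    · rw [if_neg h, if_neg, zero_smul]
      intro h'
      exact h (Prod.ext h' (by simpa [h'] using hy'))
  rw [Finset.sum_congr rfl h2, Finset.sum_ite_eq', if_pos (Finset.HasAntidiagonal.mem_antidiagonal.2 (zero_add N))]

/-- The Eisenstein series of even weight satisfy the recursion of the classical ones, up to the
derivative `[k - 1; 1]`. -/
theorem eisenstein_relation {N : ℕ} (hN : Even N) (h0 : N ≠ 0) :
    ((N : ℚ) + 3) • g (N + 1) 0 = (2 : ℚ) • g N 1 +
      ∑ x ∈ antidiagonal N, (1 - (-1 : ℚ) ^ x.1) • (g x.1 0 * g x.2 0) := by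
  have halt := sum_neg_one_pow_smul_mul hN h0
  have hst : ∑ x ∈ antidiagonal N, g x.1 0 * g x.2 0 =
      (2 : ℚ) • ∑ x ∈ antidiagonal N, gg x.1 0 x.2 0 + ((N : ℚ) + 1) • g (N + 1) 0 := by
    have h1 : ∑ x ∈ antidiagonal N, g x.1 0 * g x.2 0 = ∑ x ∈ antidiagonal N,
        (gg x.1 0 x.2 0 + gg x.2 0 x.1 0 + g (N + 1) 0) :=
      Finset.sum_congr rfl fun x hx => by
        rw [stuffle_relation, Finset.HasAntidiagonal.mem_antidiagonal.1 hx]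
    have h2 : ∑ x ∈ antidiagonal N, gg x.2 0 x.1 0 = ∑ x ∈ antidiagonal N, gg x.1 0 x.2 0 :=
      Finset.Nat.sum_antidiagonal_swap (f := fun x => gg x.1 0 x.2 0)
    rw [h1, Finset.sum_add_distrib, Finset.sum_add_distrib, h2, Finset.sum_const,
      Finset.Nat.card_antidiagonal, ← Nat.cast_smul_eq_nsmul ℚ, Nat.cast_add, Nat.cast_one]
    module
  -- Comparing both product formulas for [N + 1; 0] and [1; 0] eliminates the sum of all double
  -- words minus [1, N + 1; 0, 0], the combination left by `hst` and `halt`.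
  have h1 := stuffle_relation N 0 0 0
  have h2 := shuffle_relation N 0
  simp only [add_zero, Nat.choose_zero_right, Nat.choose_self, Nat.cast_one, one_smul, add_smul,
    Finset.sum_add_distrib] at h1 h2
  have h3 : ∑ x ∈ antidiagonal N, ((x.1.choose N : ℕ) : ℚ) • gg x.1 0 x.2 0 = gg N 0 0 0 := by
    have : ∀ x ∈ antidiagonal N, ((x.1.choose N : ℕ) : ℚ) • gg x.1 0 x.2 0 =
        if x = (N, 0) then gg N 0 0 0 else 0 := by
      intro x hx
      have hx' : x.1 + x.2 = N := Finset.HasAntidiagonal.mem_antidiagonal.1 hx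
      by_cases h : x = (N, 0)
      · subst h; simp
      · rw [if_neg h, Nat.choose_eq_zero_of_lt, Nat.cast_zero, zero_smul]
        by_contra h'
        exact h (Prod.ext (by simp; omega) (by simp; omega))
    rw [Finset.sum_congr rfl this, Finset.sum_ite_eq',
      if_pos (Finset.HasAntidiagonal.mem_antidiagonal.2 (add_zero N))]
  simp only [sub_smul, one_smul, Finset.sum_sub_distrib]
  rw [hst, halt]
  rw [h3] at h2
  rw [h1] at h2
  linear_combination (norm := module) (2 : ℚ) • h2

/-- The weights 4 and 3 of the shuffle relations (2, 4) and (3, 3) cancel the term [7; 1], as 4 · 15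
= 3 · 20. The double words left over are in the ratio 4 : 6 : 4, which the two stuffle relations
turn into products and [8; 0]. -/
theorem eisenstein_eight : g 7 0 = (6 / 7 : ℚ) • (g 3 0 * g 3 0) := by
  have h1 := stuffle_relation 2 0 4 0
  have h2 := stuffle_relation 3 0 3 0
  have h3 := shuffle_relation 2 4
  have h4 := shuffle_relation 3 3
  simp only [Finset.Nat.sum_antidiagonal_eq_sum_range_succ_mk, Finset.sum_range_succ,
    Finset.sum_range_zero] at h3 h4
  norm_num [Nat.choose] at h1 h2 h3 h4
  rw [h1] at h3
  linear_combination (norm := module) (4 / 7 : ℚ) • h3 - (3 / 7 : ℚ) • h2 - (3 / 7 : ℚ) • h4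

end DoubleShuffle

/-! ### Ramanujan equations, quasimodular forms and the Chazy equation. -/

section Quasimodular

theorem d_cons_one (n d : ℕ) :
    induced dB (cons (lett n d) 1) = ((n : ℚ) + 1) • cons (lett (n + 1) (d + 1)) 1 := by
  rw [show induced dB = localOp raise from hom_ext d_word, localOp_cons, localOp_one, map_zero,
    zero_add, act_deconc_one, LinearMap.comp_apply, raise_one, map_smul, LinearMap.smul_apply,
    consL_basisL]

theorem delta_cons_one (n d : ℕ) :
    induced deltaB (cons (lett n d) 1) = consL (theta₁ n d) 1 + tail (cons (lett n d) 1) • 1 := by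
  rw [show induced deltaB = localOp theta + truncOp tail from hom_ext delta_word,
    LinearMap.add_apply, localOp_cons, localOp_one, map_zero, zero_add, act_deconc_one,
    LinearMap.comp_apply, theta_one, truncOp_cons, truncOp_one, tail_one, zero_smul, map_zero,
    add_zero]

theorem fD_g (n d : ℕ) : fD (g n d) = ((n : ℚ) + 1) • g (n + 1) (d + 1) := by
  rw [g, fD_isInducedBy, d_cons_one, map_smul, g]

theorem fDelta_g_zero (n : ℕ) : fDelta (g n 0) = if n = 1 then algebraMap ℚ FMES (-2⁻¹) else 0 := by
  have h : theta₁ n 0 = 0 := by simp [theta₁, lowerL]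
  rw [g, fDelta_isInducedBy, delta_cons_one, h, tail_cons_one, map_zero, LinearMap.zero_apply,
    zero_add, map_smul, map_one, Algebra.algebraMap_eq_smul_one]
  split_ifs <;> simp_all

theorem fDelta_g_succ_one (n : ℕ) : fDelta (g (n + 1) 1) = g n 0 := by
  have h : theta₁ (n + 1) 1 = basisL n 0 := by simp [theta₁, lowerL]
  rw [g, fDelta_isInducedBy, delta_cons_one, h, tail_cons_one, consL_basisL]
  simp [g]

/-- Read off from [δ, D] = W: δ of an Eisenstein series is a constant, so D kills it, and δ undoes
the shift made by D up to the factor n + 1. -/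
theorem fW_g (n : ℕ) : fW (g n 0) = ((n : ℚ) + 1) • g n 0 := by
  have h : fDelta (fD (g n 0)) - fD (fDelta (g n 0)) = fW (g n 0) :=
    DFunLike.congr_fun isSl2Triple.2.2 (g n 0)
  have h0 : fD (fDelta (g n 0)) = 0 := by
    rw [fDelta_g_zero]
    split_ifs
    · exact fD.map_algebraMap _
    · exact map_zero _
  rw [← h, h0, sub_zero, fD_g, zero_add, fDelta.map_smul, fDelta_g_succ_one]

theorem G_eq (k : ℕ+) : G k = g (k - 1) 0 := by
  rw [G, g, one_def, cons_word, lett]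
  congr 4
  exact PNat.eq (by simp; have := k.pos; omega)

theorem G_eq_g {n : ℕ} (k : ℕ+) (h : (k : ℕ) = n + 1) : G k = g n 0 := by
  rw [G_eq, h, Nat.add_sub_cancel]

theorem fD_G_two : fD (G 2) = 5 * G 4 - 2 * G 2 ^ 2 := by
  have h := eisenstein_relation (N := 2) (by decide) (by decide)
  simp only [Finset.Nat.sum_antidiagonal_eq_sum_range_succ_mk, Finset.sum_range_succ,
    Finset.sum_range_zero] at h
  rw [G_eq_g (n := 1) 2 rfl, G_eq_g (n := 3) 4 rfl, fD_g]
  norm_num [Algebra.smul_def, map_ofNat] at h ⊢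
  linear_combination -h

theorem fD_G_four : fD (G 4) = 14 * G 6 - 8 * (G 2 * G 4) := by
  have h := eisenstein_relation (N := 4) (by decide) (by decide)
  simp only [Finset.Nat.sum_antidiagonal_eq_sum_range_succ_mk, Finset.sum_range_succ,
    Finset.sum_range_zero] at h
  rw [G_eq_g (n := 1) 2 rfl, G_eq_g (n := 3) 4 rfl, G_eq_g (n := 5) 6 rfl, fD_g]
  norm_num [Algebra.smul_def, map_ofNat] at h ⊢
  linear_combination -2 * h

theorem fD_G_six : fD (G 6) = (120 / 7 : ℚ) • G 4 ^ 2 - 12 * (G 2 * G 6) := by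
  have h := eisenstein_relation (N := 6) (by decide) (by decide)
  simp only [Finset.Nat.sum_antidiagonal_eq_sum_range_succ_mk, Finset.sum_range_succ,
    Finset.sum_range_zero] at h
  rw [G_eq_g (n := 1) 2 rfl, G_eq_g (n := 3) 4 rfl, G_eq_g (n := 5) 6 rfl, fD_g]
  have h12 : (12 : FMES) * (g 1 0 * g 5 0) = (12 : ℚ) • (g 1 0 * g 5 0) := by
    rw [Algebra.smul_def, map_ofNat]
  have hcomm : g 5 0 * g 1 0 = g 1 0 * g 5 0 := mul_comm _ _
  -- Replacing G(8) by (6/7) G(4)^2 gives the coefficient 27 · 6/7 - 6 = 120/7.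
  norm_num [hcomm, eisenstein_eight] at h
  rw [h12, pow_two]
  norm_num
  linear_combination (norm := module) (-3 : ℚ) • h

theorem mem_of_smul_mem {A : Type*} [CommRing A] [Algebra ℚ A] (S : Subalgebra ℚ A) {c : ℚ}
    (hc : c ≠ 0) {x : A} (h : c • x ∈ S) : x ∈ S := by
  simpa [smul_smul, hc] using S.smul_mem h c⁻¹

theorem derivation_mem_adjoin {A : Type*} [CommRing A] [Algebra ℚ A] (d : Derivation ℚ A A)
    (s : Set A) (h : ∀ x ∈ s, d x ∈ Algebra.adjoin ℚ s) (x : A) (hx : x ∈ Algebra.adjoin ℚ s) :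
    d x ∈ Algebra.adjoin ℚ s := by
  induction hx using Algebra.adjoin_induction with
  | mem x hx => exact h x hx
  | algebraMap r => rw [d.map_algebraMap]; exact zero_mem _
  | add x y _ _ hx hy => rw [map_add]; exact add_mem hx hy
  | mul x y hx' hy' hx hy =>
    rw [Derivation.leibniz]
    exact add_mem (mul_mem hx' hy) (mul_mem hy' hx)

theorem isSl2Subalgebra_quasimodular :
    IsSl2Subalgebra fD fW fDelta (quasimodular fD fW fDelta) := fun x hx => by
  simp only [quasimodular, Algebra.mem_sInf] at hx ⊢
  exact ⟨fun S hS => (hS.1 x (hx S hS)).1, fun S hS => (hS.1 x (hx S hS)).2.1,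
    fun S hS => (hS.1 x (hx S hS)).2.2⟩

theorem G_two_mem_quasimodular : G 2 ∈ quasimodular fD fW fDelta := by
  simp only [quasimodular, Algebra.mem_sInf]
  exact fun S hS => hS.2

/-- In `eisenstein_relation` only products of two series of smaller even weight survive, and the
extra term is a multiple of D of the series two weights below. -/
theorem g_mem_quasimodular (n : ℕ) (hn : Odd n) : g n 0 ∈ quasimodular fD fW fDelta := by
  induction n using Nat.strong_induction_on with
  | _ n ih =>
    match n, hn with
    | 1, _ => exact G_eq_g (n := 1) 2 rfl ▸ G_two_mem_quasimodular
    | 2, hn => exact absurd hn (by decide)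
    | n + 3, hn =>
      have hn1 : Odd (n + 1) := by rw [Nat.odd_iff] at hn ⊢; omega
      have hD : ((n : ℚ) + 2) • g (n + 2) 1 ∈ quasimodular fD fW fDelta := by
        have := (isSl2Subalgebra_quasimodular _ (ih (n + 1) (by omega) hn1)).1
        rw [fD_g] at this
        convert this using 2
        push_cast; ring
      have hD' := mem_of_smul_mem _ (by positivity) hD
      refine mem_of_smul_mem _ (c := ((n + 2 : ℕ) : ℚ) + 3) (by positivity) ?_
      have h := eisenstein_relation (N := n + 2) hn1.add_one (by omega)
      rw [show n + 3 = n + 2 + 1 from rfl, h]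
      refine add_mem (Subalgebra.smul_mem _ hD' _) (sum_mem fun x hx => ?_)
      have hx' : x.1 + x.2 = n + 2 := Finset.HasAntidiagonal.mem_antidiagonal.1 hx
      rcases Nat.even_or_odd x.1 with h | h
      · rw [h.neg_one_pow, sub_self, zero_smul]; exact zero_mem _
      · have h' : Odd x.2 := by rw [Nat.odd_iff] at h hn1 ⊢; omega
        have := h.pos
        have := h'.pos
        exact Subalgebra.smul_mem _ (mul_mem (ih _ (by omega) h) (ih _ (by omega) h')) _

theorem G_mem_quasimodular (k : ℕ+) (hk : Even (k : ℕ)) : G k ∈ quasimodular fD fW fDelta := by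
  rw [G_eq]
  exact g_mem_quasimodular _ (Nat.Even.sub_odd k.pos hk odd_one)

/-- A derivation preserves a generated subalgebra once it maps the generators into it. For D this is
the content of the Ramanujan equations; W scales the generators and δ makes them constants. -/
theorem isSl2Subalgebra_adjoin :
    IsSl2Subalgebra fD fW fDelta (Algebra.adjoin ℚ {G 2, G 4, G 6}) := by
  have h2 : G 2 ∈ Algebra.adjoin ℚ {G 2, G 4, G 6} := Algebra.subset_adjoin (by simp)
  have h4 : G 4 ∈ Algebra.adjoin ℚ {G 2, G 4, G 6} := Algebra.subset_adjoin (by simp)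
  have h6 : G 6 ∈ Algebra.adjoin ℚ {G 2, G 4, G 6} := Algebra.subset_adjoin (by simp)
  have hW (k : ℕ+) (h : G k ∈ Algebra.adjoin ℚ {G 2, G 4, G 6}) :
      fW (G k) ∈ Algebra.adjoin ℚ {G 2, G 4, G 6} := by
    have h' := fW_g (k - 1)
    rw [← G_eq] at h'
    rw [h']; exact Subalgebra.smul_mem _ h _
  have hδ (k : ℕ+) : fDelta (G k) ∈ Algebra.adjoin ℚ {G 2, G 4, G 6} := by
    have h' := fDelta_g_zero (k - 1)
    rw [← G_eq] at h'
    rw [h']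
    split_ifs
    · exact Subalgebra.algebraMap_mem _ _
    · exact zero_mem _
  have hnat (n : ℕ) [n.AtLeastTwo] : (OfNat.ofNat n : FMES) ∈ Algebra.adjoin ℚ {G 2, G 4, G 6} :=
    ofNat_mem _ n
  intro x hx
  refine ⟨derivation_mem_adjoin _ _ ?_ x hx, derivation_mem_adjoin _ _ ?_ x hx,
    derivation_mem_adjoin _ _ ?_ x hx⟩
  · rintro x (rfl | rfl | rfl)
    · rw [fD_G_two]
      exact sub_mem (mul_mem (hnat _) h4) (mul_mem (hnat _) (pow_mem h2 2))
    · rw [fD_G_four]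
      exact sub_mem (mul_mem (hnat _) h6) (mul_mem (hnat _) (mul_mem h2 h4))
    · rw [fD_G_six]
      exact sub_mem (Subalgebra.smul_mem _ (pow_mem h4 2) _) (mul_mem (hnat _) (mul_mem h2 h6))
  · rintro x (rfl | rfl | rfl)
    exacts [hW _ h2, hW _ h4, hW _ h6]
  · rintro x (rfl | rfl | rfl) <;> exact hδ _

theorem quasimodular_eq_adjoin_G :
    quasimodular fD fW fDelta = Algebra.adjoin ℚ {G 2, G 4, G 6} := by
  refine le_antisymm (sInf_le ⟨isSl2Subalgebra_adjoin, Algebra.subset_adjoin (by simp)⟩)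
    (Algebra.adjoin_le ?_)
  rintro x (rfl | rfl | rfl)
  · exact G_mem_quasimodular 2 (by decide)
  · exact G_mem_quasimodular 4 (by decide)
  · exact G_mem_quasimodular 6 (by decide)

theorem derivation_ofNat_mul {A : Type*} [CommRing A] [Algebra ℚ A] (d : Derivation ℚ A A) (n : ℕ)
    [n.AtLeastTwo] (x : A) : d (OfNat.ofNat n * x) = OfNat.ofNat n * d x := by
  rw [← Nat.cast_ofNat, Derivation.leibniz, d.map_natCast, smul_zero, add_zero, smul_eq_mul]

theorem fD_fD_G_two : fD (fD (G 2)) = 70 * G 6 - 60 * (G 2 * G 4) + 8 * G 2 ^ 3 := by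
  rw [fD_G_two, map_sub, derivation_ofNat_mul, derivation_ofNat_mul, Derivation.leibniz_pow,
    fD_G_four, fD_G_two]
  simp only [smul_eq_mul, nsmul_eq_mul]
  push_cast
  ring

theorem seven_mul_fD_G_six : 7 * fD (G 6) = 120 * G 4 ^ 2 - 84 * (G 2 * G 6) := by
  have h : (7 : FMES) * ((120 / 7 : ℚ) • G 4 ^ 2) = 120 * G 4 ^ 2 := by
    rw [mul_smul_comm, ← smul_mul_assoc, Algebra.smul_def, ← map_ofNat (algebraMap ℚ FMES) 7,
      ← map_mul, ← map_ofNat (algebraMap ℚ FMES) 120]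
    norm_num
  rw [fD_G_six, mul_sub, h]
  ring

/-- Expressed in G(2), G(4), G(6) the left side is a polynomial identity; the term 70 D G(6) is ten
times the equation cleared of its denominator 7. -/
theorem chazy : fD (fD (fD (G 2))) + 24 * (G 2 * fD (fD (G 2))) - 36 * fD (G 2) ^ 2 = 0 := by
  rw [fD_fD_G_two, map_add, map_sub, derivation_ofNat_mul, derivation_ofNat_mul,
    derivation_ofNat_mul, Derivation.leibniz_pow, Derivation.leibniz, fD_G_four, fD_G_two]
  simp only [smul_eq_mul, nsmul_eq_mul]
  push_cast
  linear_combination 10 * seven_mul_fD_G_six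

/-- The equations for D G(2) and D² G(2) are triangular, with coefficients 5 and 70 at G(4) and
G(6), so they can be solved for these generators. -/
theorem quasimodular_eq_adjoin_fD :
    quasimodular fD fW fDelta = Algebra.adjoin ℚ {G 2, fD (G 2), fD (fD (G 2))} := by
  refine le_antisymm ?_ (Algebra.adjoin_le ?_)
  · rw [quasimodular_eq_adjoin_G]
    have h0 : G 2 ∈ Algebra.adjoin ℚ {G 2, fD (G 2), fD (fD (G 2))} :=
      Algebra.subset_adjoin (by simp)
    have h1 : fD (G 2) ∈ Algebra.adjoin ℚ {G 2, fD (G 2), fD (fD (G 2))} :=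
      Algebra.subset_adjoin (by simp)
    have h2 : fD (fD (G 2)) ∈ Algebra.adjoin ℚ {G 2, fD (G 2), fD (fD (G 2))} :=
      Algebra.subset_adjoin (by simp)
    have hnat (n : ℕ) [n.AtLeastTwo] :
        (OfNat.ofNat n : FMES) ∈ Algebra.adjoin ℚ {G 2, fD (G 2), fD (fD (G 2))} := ofNat_mem _ n
    have h4 : G 4 ∈ Algebra.adjoin ℚ {G 2, fD (G 2), fD (fD (G 2))} := by
      refine mem_of_smul_mem _ (c := 5) (by norm_num) ?_
      have : (5 : ℚ) • G 4 = fD (G 2) + 2 * G 2 ^ 2 := by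
        rw [fD_G_two, Algebra.smul_def, map_ofNat]; ring
      rw [this]
      exact add_mem h1 (mul_mem (hnat _) (pow_mem h0 2))
    have h6 : G 6 ∈ Algebra.adjoin ℚ {G 2, fD (G 2), fD (fD (G 2))} := by
      refine mem_of_smul_mem _ (c := 70) (by norm_num) ?_
      have : (70 : ℚ) • G 6 = fD (fD (G 2)) + 60 * (G 2 * G 4) - 8 * G 2 ^ 3 := by
        rw [fD_fD_G_two, Algebra.smul_def, map_ofNat]; ring
      rw [this]
      exact sub_mem (add_mem h2 (mul_mem (hnat _) (mul_mem h0 h4))) (mul_mem (hnat _) (pow_mem h0 3))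
    refine Algebra.adjoin_le ?_
    rintro x (rfl | rfl | rfl)
    exacts [h0, h4, h6]
  · have h1 := (isSl2Subalgebra_quasimodular _ G_two_mem_quasimodular).1
    rintro x (rfl | rfl | rfl)
    exacts [G_two_mem_quasimodular, h1, (isSl2Subalgebra_quasimodular _ h1).1]

end Quasimodular
end FormalMES
end

open FormalMES in
theorem mainTheorem9 :
    ∃ D W δ : Derivation ℚ FMES FMES,
      IsInducedBy D dB ∧ IsInducedBy W wB ∧ IsInducedBy δ deltaB ∧
      FormalMES.IsSl2Triple D W δ ∧
      -- the Ramanujan equations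
      D (G 2) = 5 * G 4 - 2 * G 2 ^ 2 ∧
      D (G 4) = 14 * G 6 - 8 * (G 2 * G 4) ∧
      D (G 6) = (120 / 7 : ℚ) • G 4 ^ 2 - 12 * (G 2 * G 6) ∧
      -- formal quasimodular forms
      (∀ k : ℕ+, Even (k : ℕ) → G k ∈ quasimodular D W δ) ∧
      quasimodular D W δ = Algebra.adjoin ℚ {G 2, G 4, G 6} ∧
      quasimodular D W δ = Algebra.adjoin ℚ {G 2, D (G 2), D (D (G 2))} ∧
      -- the Chazy equation
      D (D (D (G 2))) + 24 * (G 2 * D (D (G 2))) - 36 * D (G 2) ^ 2 = 0 := by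
  exact ⟨fD, fW, fDelta, fD_isInducedBy, fW_isInducedBy, fDelta_isInducedBy, isSl2Triple, fD_G_two,
    fD_G_four, fD_G_six, G_mem_quasimodular, quasimodular_eq_adjoin_G, quasimodular_eq_adjoin_fD,
    chazy⟩
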